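/- Let $\mathcal E$ be a monoidal model category, i.e. a complete and cocomplete closed symmetric monoidal category $(\mathcal E,\otimes,e)$ with a model structure satisfying the pushout-product axiom and the unit axiom (for every weak equivalence $q\colon Q\to e$ with $Q$ cofibrant and every cofibrant $X$, the maps $q\otimes X$ and $X\otimes q$ are weak equivalences). Let $W$ be its class of weak equivalences. A class of morphisms is saturated if it is closed under cobase change, transfinite composition and retracts, and monoidally saturated if it is moreover closed under tensoring with arbitrary objects. The monoidal saturation of a class is the least monoidally saturated class containing it; $I^\otimes$ denotes the monoidal saturation of the class of cofibrations. Assume that $\mathcal E$ is compactly generated: it is cofibrantly generated, $W$ is closed under filtered colimits along morphisms in $I^\otimes$ (i.e. a filtered colimit of weak equivalences is a weak equivalence whenever all transition maps of the diagrams of domains and of codomains lie in $I^\otimes$), and every object is small with respect to $I^\otimes$. The monoid axiom says that the monoidal saturation of the class of trivial cofibrations is contained in $W$. A morphism $f\colon X\to Y$ is an $h$-cofibration if cobase change along $f$, as a functor $X/\mathcal E\to Y/\mathcal E$, preserves weak equivalences. $\mathcal E$ is strongly $h$-monoidal if $f\otimes Z$ is an $h$-cofibration (resp. an $h$-cofibration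 and a weak equivalence) for every cofibration (resp. trivial cofibration) $f$ and every object $Z$, and $W$ is closed under tensor product. For a monad $T$ on $\mathcal E$ with free-forgetful adjunction $F_T\dashv U_T$, a morphism $u\colon X\to Y$ in $\mathcal E$ and a map of $T$-algebras $\alpha\colon F_T(X)\to R$, let $u_\alpha\colon R\to R[u,\alpha]$ be the pushout of $F_T(u)$ along $\alpha$ in $T$-algebras. The monad $T$ is $\otimes$-adequate if these pushouts exist and there is a factorisation, functorial in $(u,\alpha,R)$, $$U_T(R)=R[u]^{(0)}\to R[u]^{(1)}\to\cdots\to R[u]^{(n)}\to\cdots\to\operatorname{colim}_n R[u]^{(n)}=U_T(R[u,\alpha])$$ of $U_T(u_\alpha)$ such that (1) if $u$ is a cofibration (resp. trivial cofibration), then each map $R[u]^{(n)}\to R[u]^{(n+1)}$ belongs to $I^\otimes$ (resp. to $W\cap I^\otimes$); and (2) if $u$ is a cofibration and $f\colon R\to S$ is a map of $T$-algebras with $U_T(f)\in W$, then the induced maps $R[u]^{(n)}\to S[u]^{(n)}$, where $S[u]^{(n)}$ is formed from $(u,f\alpha)$, are weak equivalences for all $n\ge 0$. It is relatively $\otimes$-adequate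 if there is such a functorial factorisation satisfying (1), and (2) for those $u$ and $f$ for which moreover the domain of $u$ and the objects $U_T(R)$, $U_T(S)$ are cofibrant in $\mathcal E$. Then the free monoid monad $T(X)=\coprod_{n\ge 0}X^{\otimes n}$ on $\mathcal E$ is (a) relatively $\otimes$-adequate if the monoid axiom holds; (b) $\otimes$-adequate if $\mathcal E$ is strongly $h$-monoidal. Moreover: (a$'$) if the monoid axiom holds, then the category of monoids in $\mathcal E$ is complete and cocomplete and has a model structure transferred from $\mathcal E$, i.e. one in which a map is a weak equivalence (resp. a fibration) if and only if its underlying map in $\mathcal E$ is, and this model structure is relatively left proper: weak equivalences between monoids with cofibrant underlying objects are closed under cobase change along cofibrations of monoids; (b$'$) if $\mathcal E$ is strongly $h$-monoidal, then the category of monoids in $\mathcal E$ is complete and cocomplete, the transferred model structure exists, and it is left proper. -/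

import Mathlib

open CategoryTheory Limits MonoidalCategory HomotopicalAlgebra

universe v u u'

noncomputable section

/-! ### The free monoid monad -/

namespace FreeMonoidObject

variable {E : Type u} [Category.{v} E] [MonoidalCategory E]

/-- The tensor powers `X^{⊗n}`, with `X^{⊗0} = 𝟙_ E` and `X^{⊗(n+1)} = X^{⊗n} ⊗ X`. -/
def tpow (X : E) : ℕ → E
  | 0 => 𝟙_ E
  | n + 1 => tpow X n ⊗ X

variable [HasColimits E]

/-- The underlying object `∐ₙ X^{⊗n}` of the free monoid on `X`. -/
def carrier (X : E) : E := ∐ (fun n : ULift.{v} ℕ => tpow X n.down)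

/-- The coproduct inclusion `X^{⊗n} ⟶ ∐ₙ X^{⊗n}`. -/
def incl (X : E) (n : ℕ) : tpow X n ⟶ carrier X :=
  Sigma.ι (fun n : ULift.{v} ℕ => tpow X n.down) ⟨n⟩

/-- A morphism out of `∐ₙ X^{⊗n}` given by its components. -/
def desc {X Z : E} (g : ∀ n, tpow X n ⟶ Z) : carrier X ⟶ Z :=
  Sigma.desc (fun n => g n.down)

lemma incl_desc {X Z : E} (g : ∀ n, tpow X n ⟶ Z) (n : ℕ) : incl X n ≫ desc g = g n := by
  exact Sigma.ι_desc _ _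

lemma hom_ext {X Z : E} {f g : carrier X ⟶ Z} (h : ∀ n, incl X n ≫ f = incl X n ≫ g) :
    f = g :=
  Sigma.hom_ext _ _ (fun n => h n.down)

variable [MonoidalClosed E]

/-- A morphism out of `A ⊗ ∐ₙ X^{⊗n}` given by its components. -/
def descL {A X Z : E} (g : ∀ n, A ⊗ tpow X n ⟶ Z) : A ⊗ carrier X ⟶ Z :=
  MonoidalClosed.uncurry (desc (fun n => MonoidalClosed.curry (g n)))

lemma incl_descL {A X Z : E} (g : ∀ n, A ⊗ tpow X n ⟶ Z) (n : ℕ) :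
    A ◁ incl X n ≫ descL g = g n := by
  rw [descL, ← MonoidalClosed.uncurry_natural_left, incl_desc, MonoidalClosed.uncurry_curry]

lemma hom_extL {A X Z : E} {f g : A ⊗ carrier X ⟶ Z}
    (h : ∀ n, A ◁ incl X n ≫ f = A ◁ incl X n ≫ g) : f = g := by
  apply MonoidalClosed.curry_injective
  refine hom_ext (fun n => ?_)
  rw [← MonoidalClosed.curry_natural_left, ← MonoidalClosed.curry_natural_left, h]

/-- The unit `𝟙_ E ⟶ ∐ₙ X^{⊗n}`: the inclusion of the summand `X^{⊗0}`. -/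
def nil (X : E) : 𝟙_ E ⟶ carrier X := incl X 0

/-- The inclusion of the summand `X^{⊗(n+1)} = X^{⊗n} ⊗ X`. -/
def inclSucc (X : E) (n : ℕ) : tpow X n ⊗ X ⟶ carrier X := incl X (n + 1)

/-- The components of `recL`. -/
def recAux {A X Z : E} (f : A ⟶ Z) (step : Z ⊗ X ⟶ Z) : ∀ n : ℕ, A ⊗ tpow X n ⟶ Z
  | 0 => (ρ_ _).hom ≫ f
  | n + 1 => (α_ _ _ _).inv ≫ recAux f step n ▷ X ≫ step

/-- The morphism `A ⊗ ∐ₙ X^{⊗n} ⟶ Z` obtained from `f : A ⟶ Z` by letting the tensor factors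
`X` act successively from the right by `step : Z ⊗ X ⟶ Z`. -/
def recL {A X Z : E} (f : A ⟶ Z) (step : Z ⊗ X ⟶ Z) : A ⊗ carrier X ⟶ Z :=
  descL (recAux f step)

lemma nil_recL {A X Z : E} (f : A ⟶ Z) (step : Z ⊗ X ⟶ Z) :
    A ◁ nil X ≫ recL f step = (ρ_ A).hom ≫ f :=
  incl_descL (recAux f step) 0

/-- The extension of `f : X ⟶ M` to `∐ₙ X^{⊗n} ⟶ M`. -/
def lift {X M : E} [MonObj M] (f : X ⟶ M) : carrier X ⟶ M :=
  (λ_ _).inv ≫ recL (MonObj.one : 𝟙_ E ⟶ M) (M ◁ f ≫ MonObj.mul)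

lemma nil_lift {X M : E} [MonObj M] (f : X ⟶ M) : nil X ≫ lift f = MonObj.one := by
  rw [lift, leftUnitor_inv_naturality_assoc, nil_recL, ← unitors_equal, Iso.inv_hom_id_assoc]

variable [SymmetricCategory E]

/-- The morphism `(∐ₙ X^{⊗n}) ⊗ X ⟶ ∐ₙ X^{⊗n}` sending `X^{⊗n} ⊗ X` to the summand
`X^{⊗(n+1)}`. -/
def snoc (X : E) : carrier X ⊗ X ⟶ carrier X :=
  (β_ _ _).hom ≫ descL (fun n => (β_ _ _).hom ≫ inclSucc X n)

lemma incl_snoc (X : E) (n : ℕ) : incl X n ▷ X ≫ snoc X = inclSucc X n := by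
  rw [snoc, BraidedCategory.braiding_naturality_left_assoc, incl_descL]
  exact SymmetricCategory.symmetry_assoc _ _ _

lemma hom_ext_snoc {A X Z : E} {f g : A ⊗ (carrier X ⊗ X) ⟶ Z}
    (h : ∀ n, A ◁ (incl X n ▷ X) ≫ f = A ◁ (incl X n ▷ X) ≫ g) : f = g := by
  apply MonoidalClosed.curry_injective
  rw [← cancel_epi (β_ X (carrier X)).hom]
  refine hom_extL (fun n => ?_)
  rw [BraidedCategory.braiding_naturality_right_assoc,
    BraidedCategory.braiding_naturality_right_assoc]
  congr 1
  rw [← MonoidalClosed.curry_natural_left, ← MonoidalClosed.curry_natural_left, h]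

lemma snoc_recL {A X Z : E} (f : A ⟶ Z) (step : Z ⊗ X ⟶ Z) :
    A ◁ snoc X ≫ recL f step = (α_ _ _ _).inv ≫ recL f step ▷ X ≫ step := by
  refine hom_ext_snoc (fun n => ?_)
  rw [← MonoidalCategory.whiskerLeft_comp_assoc, incl_snoc]
  have h₁ : A ◁ inclSucc X n ≫ recL f step =
      (α_ _ _ _).inv ≫ recAux f step n ▷ X ≫ step := incl_descL (recAux f step) (n + 1)
  have h₂ : A ◁ incl X n ≫ recL f step = recAux f step n := incl_descL (recAux f step) n
  rw [h₁, ← h₂]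
  simp

lemma recL_ext {A X Z : E} (step : Z ⊗ X ⟶ Z) {f g : A ⊗ carrier X ⟶ Z}
    (h₀ : A ◁ nil X ≫ f = A ◁ nil X ≫ g)
    (hf : A ◁ snoc X ≫ f = (α_ _ _ _).inv ≫ f ▷ X ≫ step)
    (hg : A ◁ snoc X ≫ g = (α_ _ _ _).inv ≫ g ▷ X ≫ step) : f = g := by
  refine hom_extL (fun n => ?_)
  induction n with
  | zero => exact h₀
  | succ n ih =>
    change A ◁ inclSucc X n ≫ f = A ◁ inclSucc X n ≫ g
    have key (k : A ⊗ carrier X ⟶ Z)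
        (hk : A ◁ snoc X ≫ k = (α_ _ _ _).inv ≫ k ▷ X ≫ step) :
        A ◁ inclSucc X n ≫ k = (α_ _ _ _).inv ≫ (A ◁ incl X n ≫ k) ▷ X ≫ step := by
      rw [← incl_snoc, MonoidalCategory.whiskerLeft_comp_assoc, hk]
      simp
    rw [key f hf, key g hg, ih]

/-- The multiplication of the free monoid: concatenation of tensor factors. -/
def mul (X : E) : carrier X ⊗ carrier X ⟶ carrier X := recL (𝟙 _) (snoc X)

lemma mul_one (X : E) : carrier X ◁ nil X ≫ mul X = (ρ_ (carrier X)).hom := by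
  rw [mul, nil_recL, Category.comp_id]

lemma snoc_mul (X : E) :
    carrier X ◁ snoc X ≫ mul X = (α_ _ _ _).inv ≫ mul X ▷ X ≫ snoc X :=
  snoc_recL _ _

lemma one_mul (X : E) : nil X ▷ carrier X ≫ mul X = (λ_ (carrier X)).hom := by
  refine recL_ext (snoc X) ?_ ?_ ?_
  · rw [whisker_exchange_assoc, mul_one, rightUnitor_naturality, leftUnitor_naturality,
      unitors_equal]
  · rw [whisker_exchange_assoc, snoc_mul]
    simp
  · simp

lemma mul_assoc (X : E) : mul X ▷ carrier X ≫ mul X =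
    (α_ _ _ _).hom ≫ carrier X ◁ mul X ≫ mul X := by
  refine recL_ext (snoc X) ?_ ?_ ?_
  · rw [whisker_exchange_assoc, mul_one]
    simp only [rightUnitor_naturality]
    have := congrArg (fun t => carrier X ◁ t ≫ mul X) (mul_one X)
    simp only [MonoidalCategory.whiskerLeft_comp, Category.assoc] at this
    simp [this]
  · rw [whisker_exchange_assoc, snoc_mul]
    simp
  · have := congrArg (fun t => carrier X ◁ t ≫ mul X) (snoc_mul X)
    simp only [MonoidalCategory.whiskerLeft_comp, Category.assoc] at this
    simp [this, snoc_mul]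

/-- The monoid structure on `∐ₙ X^{⊗n}`. -/
@[simps]
instance (X : E) : MonObj (carrier X) where
  one := nil X
  mul := mul X
  one_mul := one_mul X
  mul_one := mul_one X
  mul_assoc := mul_assoc X

/-- The inclusion of generators: `X ≅ X^{⊗1} ⟶ ∐ₙ X^{⊗n}`. -/
def of (X : E) : X ⟶ carrier X := (λ_ X).inv ≫ nil X ▷ X ≫ snoc X

lemma of_mul (X : E) : carrier X ◁ of X ≫ mul X = snoc X := by
  have h := congrArg (fun t => t ▷ X ≫ snoc X) (mul_one X)
  simp only [comp_whiskerRight, Category.assoc] at h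
  simp only [of, MonoidalCategory.whiskerLeft_comp, Category.assoc, snoc_mul,
    associator_inv_naturality_middle_assoc]
  rw [h]
  simp

lemma snoc_lift {X M : E} [MonObj M] (f : X ⟶ M) :
    snoc X ≫ lift f = lift f ▷ X ≫ M ◁ f ≫ MonObj.mul := by
  rw [lift, leftUnitor_inv_naturality_assoc, snoc_recL]
  simp

lemma mul_lift {X M : E} [MonObj M] (f : X ⟶ M) :
    mul X ≫ lift f = (lift f ⊗ₘ lift f) ≫ MonObj.mul := by
  refine recL_ext (M ◁ f ≫ MonObj.mul) ?_ ?_ ?_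
  · rw [reassoc_of% mul_one X, MonoidalCategory.tensorHom_def', Category.assoc,
      ← MonoidalCategory.whiskerLeft_comp_assoc, nil_lift, whisker_exchange_assoc,
      MonObj.mul_one, rightUnitor_naturality]
  · rw [reassoc_of% snoc_mul X, snoc_lift]
    simp
  · rw [MonoidalCategory.tensorHom_def', Category.assoc,
      ← MonoidalCategory.whiskerLeft_comp_assoc, snoc_lift]
    simp only [MonoidalCategory.whiskerLeft_comp, Category.assoc, comp_whiskerRight]
    rw [whisker_exchange_assoc, MonObj.mul_assoc_flip, ← whisker_exchange_assoc,
      tensor_whiskerLeft_assoc]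
    simp only [Category.assoc, whiskerRight_tensor, Iso.inv_hom_id_assoc, MonObj.mul_assoc]
    rw [associator_inv_naturality_right_assoc, whisker_exchange_assoc]
    simp

lemma of_lift {X M : E} [MonObj M] (f : X ⟶ M) : of X ≫ lift f = f := by
  rw [of, Category.assoc, Category.assoc, snoc_lift, ← comp_whiskerRight_assoc, nil_lift,
    ← whisker_exchange_assoc, MonObj.one_mul, leftUnitor_naturality, Iso.inv_hom_id_assoc]

lemma eq_lift {X M : E} [MonObj M] (g : carrier X ⟶ M) [IsMonHom g] : g = lift (of X ≫ g) := by
  rw [← cancel_epi (λ_ (carrier X)).hom]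
  have h (k : carrier X ⟶ M) (hk : snoc X ≫ k = k ▷ X ≫ M ◁ (of X ≫ g) ≫ MonObj.mul) :
      𝟙_ E ◁ snoc X ≫ (λ_ (carrier X)).hom ≫ k = (α_ _ _ _).inv ≫
        ((λ_ (carrier X)).hom ≫ k) ▷ X ≫ M ◁ (of X ≫ g) ≫ MonObj.mul := by
    rw [leftUnitor_naturality_assoc, hk]
    simp
  refine recL_ext (M ◁ (of X ≫ g) ≫ MonObj.mul) ?_ (h _ ?_) (h _ (snoc_lift _))
  · have h₁ : nil X ≫ g = MonObj.one := IsMonHom.one_hom g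
    rw [leftUnitor_naturality_assoc, leftUnitor_naturality_assoc, nil_lift, h₁]
  · have h₂ : mul X ≫ g = (g ⊗ₘ g) ≫ MonObj.mul := IsMonHom.mul_hom g
    rw [← of_mul, Category.assoc, h₂]
    simp [MonoidalCategory.tensorHom_def, whisker_exchange_assoc]

/-- The universal property of the free monoid. -/
def homEquiv (X : E) (M : Mon E) : (Mon.mk (carrier X) ⟶ M) ≃ (X ⟶ M.X) where
  toFun g := of X ≫ g.hom
  invFun f :=
    { hom := lift f
      isMonHom_hom := ⟨nil_lift f, mul_lift f⟩ }
  left_inv g := by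
    ext
    exact (eq_lift g.hom).symm
  right_inv f := of_lift f

/-- The free monoid functor `X ↦ ∐ₙ X^{⊗n}`. -/
def free (E : Type u) [Category.{v} E] [MonoidalCategory E] [HasColimits E] [MonoidalClosed E]
    [SymmetricCategory E] : E ⥤ Mon E :=
  Adjunction.leftAdjointOfEquiv (G := Mon.forget E) (F_obj := fun X => Mon.mk (carrier X))
    homEquiv (fun _ _ _ _ _ => (Category.assoc _ _ _).symm)

/-- The free monoid functor is left adjoint to the forgetful functor. -/
def adj (E : Type u) [Category.{v} E] [MonoidalCategory E] [HasColimits E] [MonoidalClosed E]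
    [SymmetricCategory E] : free E ⊣ Mon.forget E :=
  Adjunction.adjunctionOfEquivLeft _ _

end FreeMonoidObject

/-- The free monoid monad `X ↦ ∐ₙ X^{⊗n}` on `E`. -/
def freeMonoidMonad (E : Type u) [Category.{v} E] [MonoidalCategory E] [HasColimits E]
    [MonoidalClosed E] [SymmetricCategory E] : Monad E :=
  (FreeMonoidObject.adj E).toMonad

/-! ### Classes of morphisms in model categories -/

section Saturation

variable {E : Type u} [Category.{v} E]

/-- A class of morphisms is saturated if it is closed under cobase change, transfinite
composition and retracts. -/
structure IsSaturated (K : MorphismProperty E) : Prop where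
  cobaseChange : K.IsStableUnderCobaseChange
  transfinite : MorphismProperty.IsStableUnderTransfiniteComposition.{v} K
  retracts : K.IsStableUnderRetracts

/-- A class of morphisms is monoidally saturated if it is saturated and closed under tensoring
with arbitrary objects. -/
structure IsMonoidallySaturated [MonoidalCategory E] (K : MorphismProperty E) : Prop
    extends IsSaturated K where
  tensor {X Y : E} (f : X ⟶ Y) (Z : E) : K f → K (f ▷ Z)

/-- The monoidal saturation of `K`: the least monoidally saturated class containing `K`. -/
def monoidalSaturation [MonoidalCategory E] (K : MorphismProperty E) : MorphismProperty E :=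
  sInf {L | K ≤ L ∧ IsMonoidallySaturated L}

/-- The object `A` is small with respect to `K`: for some regular cardinal `κ`, the functor
`Hom(A, -)` preserves the colimits of all `λ`-sequences of morphisms in `K`, for all `κ`-filtered
limit ordinals `λ`. -/
def IsSmallWithRespectTo (K : MorphismProperty E) (A : E) : Prop :=
  ∃ (κ : Cardinal.{v}) (_ : Fact κ.IsRegular),
    ∀ (J : Type v) [LinearOrder J] [SuccOrder J] [OrderBot J] [WellFoundedLT J] [NoMaxOrder J]
      [IsCardinalFiltered J κ] (F : J ⥤ E) [F.IsWellOrderContinuous],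
      (∀ j : J, K (F.map (homOfLE (Order.le_succ j)))) →
        PreservesColimit F (coyoneda.obj (Opposite.op A))

/-- A morphism `f` is an `h`-cofibration (with respect to a class `W` of weak equivalences) if
cobase change along `f` takes weak equivalences under the domain of `f` to weak equivalences:
for all pushout squares
```
X --g--> A --w--> B
|f       |        |
Y -----> A' -w'-> B'
```
with `w` in `W`, the morphism `w'` is in `W`. -/
def IsHCofibration (W : MorphismProperty E) {X Y : E} (f : X ⟶ Y) : Prop :=
  ∀ ⦃A B A' B' : E⦄ (g : X ⟶ A) (w : A ⟶ B) (a : A ⟶ A') (b : B ⟶ B') (g' : Y ⟶ A')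
    (w' : A' ⟶ B'), IsPushout g f a g' → IsPushout w a b w' → W w → W w'

/-- The class `W` is `K`-perfect: it is closed under filtered colimits along morphisms
in `K`. -/
def IsPerfect (K W : MorphismProperty E) : Prop :=
  ∀ (J : Type v) [SmallCategory J] [IsFiltered J] (F G : J ⥤ E) (α : F ⟶ G)
    (c : Cocone F) (d : Cocone G) (_ : IsColimit c) (_ : IsColimit d) (f : c.pt ⟶ d.pt),
    (∀ ⦃i j : J⦄ (φ : i ⟶ j), K (F.map φ)) → (∀ ⦃i j : J⦄ (φ : i ⟶ j), K (G.map φ)) →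
    (∀ j, W (α.app j)) → (∀ j, c.ι.app j ≫ f = α.app j ≫ d.ι.app j) → W f

end Saturation

section ModelCategories

variable (E : Type u) [Category.{v} E] [ModelCategory E]

/-- The model category `E` is cofibrantly generated: there are (small) sets `I` and `J` of
morphisms which permit the small object argument and detect the trivial fibrations,
respectively the fibrations, by the right lifting property. -/
def IsCofibrantlyGenerated : Prop :=
  ∃ I J : MorphismProperty E, MorphismProperty.IsSmall.{v} I ∧ MorphismProperty.IsSmall.{v} J ∧
    (∀ ⦃X Y : E⦄ (i : X ⟶ Y), I i →
      IsSmallWithRespectTo (MorphismProperty.transfiniteCompositions.{v} I.pushouts) X) ∧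
    (∀ ⦃X Y : E⦄ (j : X ⟶ Y), J j →
      IsSmallWithRespectTo (MorphismProperty.transfiniteCompositions.{v} J.pushouts) X) ∧
    I.rlp = trivialFibrations E ∧ J.rlp = fibrations E

/-- The model category `E` is `K`-compactly generated. -/
structure IsCompactlyGeneratedWith (K : MorphismProperty E) : Prop where
  cofibrantlyGenerated : IsCofibrantlyGenerated E
  perfect : IsPerfect K (weakEquivalences E)
  small (A : E) : IsSmallWithRespectTo K A

/-- A model category is left proper if weak equivalences are closed under cobase change along
cofibrations. -/
def IsLeftProper : Prop :=
  ∀ ⦃X Y A B : E⦄ (i : X ⟶ Y) (w : X ⟶ A) (w' : Y ⟶ B) (j : A ⟶ B),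
    IsPushout i w w' j → Cofibration i → WeakEquivalence w → WeakEquivalence w'

variable [MonoidalCategory E]

/-- The pushout-product axiom and the unit axiom, making a model category with a closed symmetric
monoidal structure a monoidal model category. -/
structure IsMonoidalModelCategory : Prop where
  /-- The pushout-product `X₁ ⊗ Y₀ ∪ X₀ ⊗ Y₁ ⟶ X₁ ⊗ Y₁` of two cofibrations is a cofibration. -/
  cofibration {X₀ X₁ Y₀ Y₁ : E} (f : X₀ ⟶ X₁) (g : Y₀ ⟶ Y₁)
    (p : (curriedTensor E).PushoutObjObj f g) :
    Cofibration f → Cofibration g → Cofibration p.ι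
  /-- It is a trivial cofibration if moreover the first cofibration is trivial. -/
  weakEquivalence_left {X₀ X₁ Y₀ Y₁ : E} (f : X₀ ⟶ X₁) (g : Y₀ ⟶ Y₁)
    (p : (curriedTensor E).PushoutObjObj f g) :
    Cofibration f → Cofibration g → WeakEquivalence f → WeakEquivalence p.ι
  /-- It is a trivial cofibration if moreover the second cofibration is trivial. -/
  weakEquivalence_right {X₀ X₁ Y₀ Y₁ : E} (f : X₀ ⟶ X₁) (g : Y₀ ⟶ Y₁)
    (p : (curriedTensor E).PushoutObjObj f g) :
    Cofibration f → Cofibration g → WeakEquivalence g → WeakEquivalence p.ι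
  /-- Cofibrant resolutions of the unit remain weak equivalences under tensor with cofibrant
  objects. -/
  unit_right {Q : E} (q : Q ⟶ 𝟙_ E) (X : E) :
    IsCofibrant Q → WeakEquivalence q → IsCofibrant X → WeakEquivalence (q ▷ X)
  unit_left {Q : E} (q : Q ⟶ 𝟙_ E) (X : E) :
    IsCofibrant Q → WeakEquivalence q → IsCofibrant X → WeakEquivalence (X ◁ q)

/-- The class of `⊗`-cofibrations: the monoidal saturation of the class of cofibrations. -/
def tensorCofibrations : MorphismProperty E := monoidalSaturation (cofibrations E)

/-- A monoidal model category is compactly generated if its underlying model category is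
compactly generated with respect to the class of `⊗`-cofibrations. -/
def IsCompactlyGeneratedMonoidal : Prop := IsCompactlyGeneratedWith E (tensorCofibrations E)

/-- The monoid axiom: the monoidal saturation of the class of trivial cofibrations is contained
in the class of weak equivalences. -/
def MonoidAxiom : Prop := monoidalSaturation (trivialCofibrations E) ≤ weakEquivalences E

/-- The tensor product of a (trivial) cofibration with any object is a (trivial)
`h`-cofibration. -/
structure IsHMonoidal : Prop where
  hCofibration {X Y : E} (f : X ⟶ Y) (Z : E) :
    Cofibration f → IsHCofibration (weakEquivalences E) (f ▷ Z)
  weakEquivalence {X Y : E} (f : X ⟶ Y) (Z : E) :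
    Cofibration f → WeakEquivalence f → WeakEquivalence (f ▷ Z)

/-- `E` is `h`-monoidal and its class of weak equivalences is closed under tensor product. -/
structure IsStronglyHMonoidal : Prop extends IsHMonoidal E where
  tensor {X Y X' Y' : E} (f : X ⟶ Y) (g : X' ⟶ Y') :
    WeakEquivalence f → WeakEquivalence g → WeakEquivalence (f ⊗ₘ g)

end ModelCategories

/-! ### Adequate monads and transferred model structures -/

section Adequate

variable {E : Type u} [Category.{v} E]

/-- The category of data for free algebra extensions over a monad `T`: the objects are a morphism
`u : X ⟶ Y` of `E` together with a morphism of `T`-algebras `α : F_T(X) ⟶ R`. -/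
abbrev ExtensionData (T : Monad E) :=
  Comma (Arrow.leftFunc ⋙ T.free) (𝟭 T.Algebra)

namespace ExtensionData

variable {T : Monad E} (d : ExtensionData T)

/-- The morphism `u : X ⟶ Y`. -/
abbrev u : d.left.left ⟶ d.left.right := d.left.hom

/-- The algebra `R`. -/
abbrev R : T.Algebra := d.right

/-- The morphism of algebras `α : F_T(X) ⟶ R`. -/
abbrev α : T.free.obj d.left.left ⟶ d.R := d.hom

/-- Replacing `(u, α : F_T(X) ⟶ R)` by `(u, α ≫ f : F_T(X) ⟶ S)`. -/
def push {S : T.Algebra} (f : d.R ⟶ S) : ExtensionData T :=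
  { left := d.left
    right := S
    hom := d.α ≫ f }

/-- The morphism of extension data given by the identity on `u` and by `f : R ⟶ S`. -/
def toPush {S : T.Algebra} (f : d.R ⟶ S) : d ⟶ d.push f :=
  { left := 𝟙 _
    right := f
    w := by simp [push] }

end ExtensionData

/-- A functorial factorisation, as a sequential colimit, of the underlying maps of the free algebra
extensions `u_α : R ⟶ R[u, α]`, for all `(u, α)`. -/
structure ExtensionFiltration (T : Monad E) where
  /-- the algebra `R[u, α]` -/
  ext : ExtensionData T ⥤ T.Algebra
  /-- the morphism `u_α : R ⟶ R[u, α]` -/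
  inl : Comma.snd _ _ ⟶ ext
  /-- the morphism `F_T(Y) ⟶ R[u, α]` -/
  inr : Comma.fst _ _ ⋙ Arrow.rightFunc ⋙ T.free ⟶ ext
  /-- `R[u, α]` is the pushout of `F_T(u)` along `α` -/
  isPushout (d : ExtensionData T) :
    IsPushout d.α (T.free.map d.u) (inl.app d) (inr.app d)
  /-- the sequence `R[u]⁽⁰⁾ ⟶ R[u]⁽¹⁾ ⟶ ⋯` in `E` -/
  seq : ExtensionData T ⥤ ℕ ⥤ E
  /-- the identification of `R[u]⁽⁰⁾` with the underlying object of `R` -/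
  zeroIso : seq ⋙ (evaluation ℕ E).obj 0 ≅ Comma.snd _ _ ⋙ T.forget
  /-- the maps from the sequence to the underlying object of `R[u, α]` -/
  toExt : seq ⟶ ext ⋙ T.forget ⋙ Functor.const ℕ
  /-- the underlying object of `R[u, α]` is the colimit of the sequence -/
  isColimit (d : ExtensionData T) :
    Nonempty (IsColimit (Cocone.mk (T.forget.obj (ext.obj d)) (toExt.app d)))
  /-- the composite `R = R[u]⁽⁰⁾ ⟶ R[u, α]` is the underlying map of `u_α` -/
  fac (d : ExtensionData T) :
    zeroIso.inv.app d ≫ (toExt.app d).app 0 = T.forget.map (inl.app d)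

namespace ExtensionFiltration

variable {T : Monad E} (Φ : ExtensionFiltration T)

/-- The map `R[u]⁽ⁿ⁾ ⟶ R[u]⁽ⁿ⁺¹⁾`. -/
def step (d : ExtensionData T) (n : ℕ) : (Φ.seq.obj d).obj n ⟶ (Φ.seq.obj d).obj (n + 1) :=
  (Φ.seq.obj d).map (homOfLE (Nat.le_succ n))

/-- The map `R[u]⁽ⁿ⁾ ⟶ S[u]⁽ⁿ⁾` induced by a morphism of algebras `f : R ⟶ S`. -/
def induced (d : ExtensionData T) {S : T.Algebra} (f : d.R ⟶ S) (n : ℕ) :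
    (Φ.seq.obj d).obj n ⟶ (Φ.seq.obj (d.push f)).obj n :=
  (Φ.seq.map (d.toPush f)).app n

variable [ModelCategory E]

/-- For a cofibration `u` each map of the sequence belongs to `K`, and for a trivial cofibration
`u` each map of the sequence is a weak equivalence which belongs to `K`. -/
structure StepsIn (K : MorphismProperty E) : Prop where
  cofibration (d : ExtensionData T) (n : ℕ) : Cofibration d.u → K (Φ.step d n)
  trivialCofibration (d : ExtensionData T) (n : ℕ) :
    Cofibration d.u → WeakEquivalence d.u → K (Φ.step d n) ∧ WeakEquivalence (Φ.step d n)

end ExtensionFiltration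

variable [ModelCategory E]

/-- The monad `T` is `K`-adequate. -/
def IsAdequate (K : MorphismProperty E) (T : Monad E) : Prop :=
  ∃ Φ : ExtensionFiltration T, Φ.StepsIn K ∧
    ∀ (d : ExtensionData T) {S : T.Algebra} (f : d.R ⟶ S),
      Cofibration d.u → WeakEquivalence (T.forget.map f) →
        ∀ n : ℕ, WeakEquivalence (Φ.induced d f n)

/-- The monad `T` is relatively `K`-adequate. -/
def IsRelativelyAdequate (K : MorphismProperty E) (T : Monad E) : Prop :=
  ∃ Φ : ExtensionFiltration T, Φ.StepsIn K ∧
    ∀ (d : ExtensionData T) {S : T.Algebra} (f : d.R ⟶ S),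
      Cofibration d.u → IsCofibrant d.left.left → WeakEquivalence (T.forget.map f) →
        IsCofibrant (T.forget.obj d.R) → IsCofibrant (T.forget.obj S) →
          ∀ n : ℕ, WeakEquivalence (Φ.induced d f n)

end Adequate

section Transfer

variable {E : Type u} [Category.{v} E] [ModelCategory E]
  {D : Type u'} [Category.{v} D] [ModelCategory D] (U : D ⥤ E)

/-- The model structure on `D` is transferred along `U : D ⥤ E`: a morphism of `D` is a weak
equivalence (resp. a fibration) if and only if its image in `E` is. As for any model category,
`D` is required to have all small limits and colimits. -/
structure IsTransferred : Prop where
  hasLimits : HasLimits D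
  hasColimits : HasColimits D
  weakEquivalences_eq : weakEquivalences D = (weakEquivalences E).inverseImage U
  fibrations_eq : fibrations D = (fibrations E).inverseImage U

/-- The model structure on `D` is relatively left proper: weak equivalences between objects with
cofibrant image in `E` are closed under cobase change along cofibrations. -/
def IsRelativelyLeftProper : Prop :=
  ∀ ⦃X Y A B : D⦄ (i : X ⟶ Y) (w : X ⟶ A) (w' : Y ⟶ B) (j : A ⟶ B),
    IsPushout i w w' j → Cofibration i → WeakEquivalence w →
      IsCofibrant (U.obj X) → IsCofibrant (U.obj A) → WeakEquivalence w'

end Transfer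

end

noncomputable section

/-! ### Sifted colimits of monoids -/

section Sifted

/-! The free extension `R[u, α]` of a monoid consists of words `r₀ y₁ r₁ ⋯ yₙ rₙ`, where a letter
coming from `X` may be absorbed into `R` through `α`. Filter it by the number of letters from `Y`.
Instead of attaching at each stage a cell shaped like an `n`-dimensional cube, the recursion adds
one letter at a time: if `i n : obj n ⟶ obj (n + 1)` is an inclusion of the filtration, the next
object is obtained from `obj (n + 1)` by attaching `(i n □ u) ⊗ R`, where `□` is the pushout-product
(`Tower`). It starts with the initial object and `R`.

That the colimit is the pushout of monoids is proved with modules rather than words. The colimit is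
a right `R`-module with a compatible action of `Y`, and it is free on one generator, even after
tensoring on the left (`Tower.Colimit.isFree`). Freeness produces a multiplication, its
associativity and the universal property among monoids (`IsFree.monObj`, `IsFree.exists_monHom`,
`IsFree.monHom_ext`). The construction is carried out once in a functor category over all extension
data, which makes the filtration functorial.

For condition (1), associativity of `□` moves factors from the tower to the other side: `i (n + 1) □
w` is a cobase change of `i n □ (u □ (R ⊗ w))`, and `i 0 □ w` is `R ⊗ w`. Hence each step of the
filtration is a cobase change of maps controlled by tensored (trivial) cofibrations
(`Tower.pprod_i_mem`, `Tower.i_mem`). For condition (2), two applications of the gluing lemma per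
stage compare the towers of `R` and `S` (`Tower.Hom.weakEquivalences`). The argument is run in an
abstract `MonoidalContext` with two instances: cofibrant objects with cofibrations, and all objects
with `h`-cofibrations.

For the model structures, the forgetful functor from monoids creates sifted colimits and is monadic,
whence cocompleteness. Since `W` is perfect, the filtrations show that relative cell complexes on
free trivial cofibrations are weak equivalences, and the small object argument transfers the model
structure (`exists_transferred`). For left properness, the maps along which cobase change behaves
well (`properExtensions`) include the free maps on cofibrations and are closed under cobase change,
transfinite composition and retracts; so they include all cofibrations of monoids. -/

open WalkingReflexivePair WalkingReflexivePair.Hom in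
-- Siftedness makes reflexive coequalizers of monoids computable in the underlying category, as
-- needed for monadicity.
instance isSifted_walkingReflexivePair : IsSifted WalkingReflexivePair where
  out := by
    have key : ∀ (X Y : WalkingReflexivePair),
        IsConnected (StructuredArrow (X, Y) (Functor.diag WalkingReflexivePair)) := by
      intro X Y
      let mk {Z : WalkingReflexivePair} (f : X ⟶ Z) (g : Y ⟶ Z) :
        StructuredArrow (X, Y) (Functor.diag WalkingReflexivePair) :=
        StructuredArrow.mk (Y := Z) (f, g)
      let hom {Z Z' : WalkingReflexivePair} (f : X ⟶ Z) (g : Y ⟶ Z) (h : Z ⟶ Z') :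
        mk f g ⟶ mk (f ≫ h) (g ≫ h) := StructuredArrow.homMk h
      have eta (A : StructuredArrow (X, Y) (Functor.diag WalkingReflexivePair)) :
          ∃ (Z : WalkingReflexivePair) (f : X ⟶ Z) (g : Y ⟶ Z), A = mk f g :=
        ⟨A.right, A.hom.1, A.hom.2, rfl⟩
      let to0 (X : WalkingReflexivePair) : X ⟶ zero :=
        match X with
        | zero => 𝟙 _
        | one => left
      let j₀ := mk (to0 X) (to0 Y)
      -- Every cospan maps to one with apex `zero`, so only those have to be connected to `j₀`.
      suffices h : ∀ (p : Set (StructuredArrow (X, Y) (Functor.diag WalkingReflexivePair))),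
          j₀ ∈ p → (∀ {a b} (_ : a ⟶ b), a ∈ p ↔ b ∈ p) →
          ∀ (f : X ⟶ zero) (g : Y ⟶ zero), mk f g ∈ p by
        have : Nonempty (StructuredArrow (X, Y) (Functor.diag WalkingReflexivePair)) := ⟨j₀⟩
        refine IsConnected.of_induct (j₀ := j₀) (fun p h₁ h₂ A => ?_)
        obtain ⟨Z, f, g, rfl⟩ := eta A
        exact (h₂ (hom f g (to0 Z))).2 (h p h₁ h₂ _ _)
      intro p h₁ h₂ f g
      -- Two cospans over `zero` which come from one cospan by different maps `h` and `h'` are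
      -- joined by a zigzag of length two.
      have link {Z : WalkingReflexivePair} (f : X ⟶ Z) (g : Y ⟶ Z) (h h' : Z ⟶ zero)
          (H : mk (f ≫ h) (g ≫ h) ∈ p) : mk (f ≫ h') (g ≫ h') ∈ p :=
        (h₂ (hom f g h')).1 ((h₂ (hom f g h)).2 H)
      have h00 (f : zero ⟶ zero) : f = 𝟙 _ := by
        match f with
        | .id _ => rfl
      have h10 (f : one ⟶ zero) : f = left ∨ f = right := by
        match f with
        | .left => exact Or.inl rfl
        | .right => exact Or.inr rfl
      cases X <;> cases Y
      · obtain rfl := h00 f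
        obtain rfl := h00 g
        exact h₁
      · obtain rfl := h00 f
        obtain rfl | rfl := h10 g
        · exact h₁
        · exact link reflexion (𝟙 _) left right h₁
      · obtain rfl := h00 g
        obtain rfl | rfl := h10 f
        · exact h₁
        · exact link (𝟙 _) reflexion left right h₁
      · obtain rfl | rfl := h10 f <;> obtain rfl | rfl := h10 g
        · exact h₁
        · exact link leftCompReflexion (𝟙 _) left right h₁
        · exact link (𝟙 _) leftCompReflexion left right h₁
        · exact link (𝟙 _) (𝟙 _) left right h₁
    exact fun ⟨X, Y⟩ => key X Y
  nonempty := ⟨WalkingReflexivePair.zero⟩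

end Sifted

/-- The tensor product of a monoidal category preserves colimits of shape `J` in each
variable. -/
class TensorPreservesColimits (J : Type*) [Category* J] (C : Type*) [Category* C]
    [MonoidalCategory C] : Prop where
  left (X : C) : PreservesColimitsOfShape J (tensorLeft X) := by infer_instance
  right (X : C) : PreservesColimitsOfShape J (tensorRight X) := by infer_instance

attribute [instance] TensorPreservesColimits.left TensorPreservesColimits.right

instance {J C : Type*} [Category* J] [Category* C] [MonoidalCategory C]
    [TensorPreservesColimits J C] (F G : J ⥤ C) : PreservesColimit₂ F G (curriedTensor C) := by
  have h₁ (x : C) : PreservesColimit F ((curriedTensor C).flip.obj x) :=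
    inferInstanceAs (PreservesColimit F (tensorRight x))
  have h₂ (x : C) : PreservesColimit G ((curriedTensor C).obj x) :=
    inferInstanceAs (PreservesColimit G (tensorLeft x))
  infer_instance

instance {J C : Type*} [Category* J] [Category* C] [MonoidalCategory C] [SymmetricCategory C]
    [MonoidalClosed C] : TensorPreservesColimits J C where
  right X := preservesColimitsOfShape_of_natIso (BraidedCategory.tensorLeftIsoTensorRight X)

namespace MonSifted

variable {C : Type*} [Category* C] [MonoidalCategory C] {J : Type*} [Category* J]

section

variable {F : J ⥤ Mon C} {c : Cocone (F ⋙ Mon.forget C)} (hc : IsColimit c)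

variable (c) in
/-- The components of a cocone over the underlying diagram of a diagram of monoids. -/
def leg (j : J) : (F.obj j).X ⟶ c.pt := c.ι.app j

lemma map_leg {i j : J} (f : i ⟶ j) : (F.map f).hom ≫ leg c j = leg c i := c.w f

include hc in
lemma leg_ext {Z : C} {f g : c.pt ⟶ Z} (h : ∀ j, leg c j ≫ f = leg c j ≫ g) : f = g :=
  hc.hom_ext h

variable (c) in
/-- The multiplications of a diagram of monoids, as a cocone with point that of `c`. -/
def mulCocone : Cocone ((F ⋙ Mon.forget C) ⊗ (F ⋙ Mon.forget C)) :=
  Cocone.mk c.pt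
    { app j := (MonObj.mul : (F.obj j).X ⊗ _ ⟶ _) ≫ leg c j
      naturality i j f := by
        change ((F.map f).hom ⊗ₘ (F.map f).hom) ≫ MonObj.mul ≫ leg c j =
          (MonObj.mul ≫ leg c i) ≫ 𝟙 _
        rw [← map_leg f, Category.comp_id, IsMonHom.mul_hom_assoc] }

variable [IsSifted J]

variable (c) in
-- The units all have domain `𝟙_ C` and are compatible with transition maps. A sifted category is
-- connected, so they have a single value in the colimit.
lemma one_leg_eq (i j : J) :
    (MonObj.one : _ ⟶ (F.obj i).X) ≫ leg c i = (MonObj.one : _ ⟶ (F.obj j).X) ≫ leg c j :=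
  constant_of_preserves_morphisms (fun j => (MonObj.one : _ ⟶ (F.obj j).X) ≫ leg c j)
    (fun i j f => by rw [← map_leg f, IsMonHom.one_hom_assoc]) i j

variable (c) in
/-- The unit of a sifted colimit of monoids. -/
def colimitOne : 𝟙_ C ⟶ c.pt :=
  (MonObj.one : _ ⟶ (F.obj (Classical.choice (IsSifted.nonempty (C := J)))).X) ≫ leg c _

variable (c) in
lemma colimitOne_eq (j : J) : colimitOne c = (MonObj.one : _ ⟶ (F.obj j).X) ≫ leg c j :=
  one_leg_eq c _ j

variable [TensorPreservesColimits J C]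

/-- The multiplication of a sifted colimit of monoids. -/
def colimitMul : c.pt ⊗ c.pt ⟶ c.pt := (hc.tensor hc).desc (mulCocone c)

lemma leg_colimitMul (j : J) :
    (leg c j ⊗ₘ leg c j) ≫ colimitMul hc = MonObj.mul ≫ leg c j :=
  (hc.tensor hc).fac (mulCocone c) j

include hc in
-- For sifted `J` the colimit over `J × J` is the colimit over the diagonal, so `c.pt ⊗ c.pt` is the
-- colimit of the objects `F j ⊗ F j` and one index serves for both factors.
lemma leg_ext₂ {Z : C} {f g : c.pt ⊗ c.pt ⟶ Z}
    (h : ∀ j, (leg c j ⊗ₘ leg c j) ≫ f = (leg c j ⊗ₘ leg c j) ≫ g) : f = g :=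
  (hc.tensor hc).hom_ext h

include hc in
lemma leg_ext₃ {Z : C} {f g : (c.pt ⊗ c.pt) ⊗ c.pt ⟶ Z}
    (h : ∀ j, ((leg c j ⊗ₘ leg c j) ⊗ₘ leg c j) ≫ f =
      ((leg c j ⊗ₘ leg c j) ⊗ₘ leg c j) ≫ g) : f = g :=
  ((hc.tensor hc).tensor hc).hom_ext h

/-- The monoid structure on a sifted colimit of monoids. -/
@[reducible]
def colimitMonObj : MonObj c.pt where
  one := colimitOne c
  mul := colimitMul hc
  one_mul := by
    rw [← cancel_epi (λ_ c.pt).inv]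
    refine leg_ext hc fun j => ?_
    rw [leftUnitor_inv_naturality_assoc, colimitOne_eq c j, comp_whiskerRight_assoc,
      whisker_exchange_assoc, ← MonoidalCategory.tensorHom_def'_assoc (leg c j) (leg c j),
      leg_colimitMul]
    simp
  mul_one := by
    rw [← cancel_epi (ρ_ c.pt).inv]
    refine leg_ext hc fun j => ?_
    rw [rightUnitor_inv_naturality_assoc, colimitOne_eq c j,
      MonoidalCategory.whiskerLeft_comp_assoc,
      ← whisker_exchange_assoc, ← MonoidalCategory.tensorHom_def_assoc (leg c j) (leg c j),
      leg_colimitMul]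
    simp
  mul_assoc := by
    refine leg_ext₃ hc fun j => ?_
    have h₁ : ((leg c j ⊗ₘ leg c j) ⊗ₘ leg c j) ≫ colimitMul hc ▷ c.pt =
        MonObj.mul ▷ _ ≫ (leg c j ⊗ₘ leg c j) := by
      rw [tensorHom_def', Category.assoc, ← comp_whiskerRight, leg_colimitMul,
        comp_whiskerRight, whisker_exchange_assoc, MonoidalCategory.tensorHom_def (leg c j),
        whisker_exchange]
    have h₂ : (leg c j ⊗ₘ leg c j ⊗ₘ leg c j) ≫ c.pt ◁ colimitMul hc =
        _ ◁ MonObj.mul ≫ (leg c j ⊗ₘ leg c j) := by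
      rw [MonoidalCategory.tensorHom_def, Category.assoc, ← MonoidalCategory.whiskerLeft_comp,
        leg_colimitMul, MonoidalCategory.whiskerLeft_comp, ← whisker_exchange_assoc,
        MonoidalCategory.tensorHom_def]
    rw [reassoc_of% h₁, associator_naturality_assoc, reassoc_of% h₂, leg_colimitMul,
      MonObj.mul_assoc_assoc]

variable (c) in
/-- The colimit cocone for a sifted diagram of monoids. -/
def colimitCocone : Cocone F :=
  letI := colimitMonObj hc
  Cocone.mk (Mon.mk c.pt)
    { app j :=
        { hom := leg c j
          isMonHom_hom := ⟨(colimitOne_eq c j).symm, (leg_colimitMul hc j).symm⟩ }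
      naturality i j f := by
        ext
        exact (map_leg f).trans (Category.comp_id _).symm }

/-- The underlying cocone of a cocone over a diagram of monoids. -/
def colimitDesc (s : Cocone F) : (colimitCocone c hc).pt ⟶ s.pt :=
  letI := colimitMonObj hc
  let d : c.pt ⟶ s.pt.X := hc.desc ((Mon.forget C).mapCocone s)
  have fac (j : J) : leg c j ≫ d = (s.ι.app j).hom :=
    hc.fac ((Mon.forget C).mapCocone s) j
  { hom := d
    isMonHom_hom :=
      { one_hom := by
          change colimitOne c ≫ d = _
          rw [colimitOne_eq c (Classical.choice (IsSifted.nonempty (C := J))), Category.assoc, fac]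
          exact IsMonHom.one_hom (s.ι.app _).hom
        mul_hom := by
          refine leg_ext₂ hc fun j => ?_
          change _ ≫ colimitMul hc ≫ d = _ ≫ (d ⊗ₘ d) ≫ _
          rw [reassoc_of% leg_colimitMul, fac, tensorHom_comp_tensorHom_assoc, fac]
          exact IsMonHom.mul_hom (s.ι.app j).hom } }

/-- The colimit cocone for a sifted diagram of monoids is a colimit cocone. -/
def isColimitColimitCocone : IsColimit (colimitCocone c hc) where
  desc s := colimitDesc hc s
  fac s j := by
    ext
    exact hc.fac ((Mon.forget C).mapCocone s) j
  uniq s m h := by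
    ext
    refine hc.hom_ext fun j => ?_
    refine Eq.trans ?_ (hc.fac ((Mon.forget C).mapCocone s) j).symm
    exact congrArg Mon.Hom.hom (h j)

instance : CreatesColimit F (Mon.forget C) :=
  createsColimitOfReflectsIso fun c hc =>
    { liftedCocone := colimitCocone c hc
      validLift := Iso.refl _
      makesColimit := isColimitColimitCocone hc }

end

section

variable [IsSifted J] [TensorPreservesColimits J C]

instance : CreatesColimitsOfShape J (Mon.forget C) := ⟨inferInstance⟩

instance hasColimitsOfShape_mon [HasColimitsOfShape J C] : HasColimitsOfShape J (Mon C) :=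
  hasColimitsOfShape_of_hasColimitsOfShape_createsColimitsOfShape (Mon.forget C)

instance preservesColimitsOfShape_forget [HasColimitsOfShape J C] :
    PreservesColimitsOfShape J (Mon.forget C) := inferInstance

end

end MonSifted

/-! ### Monadicity and cocompleteness of the category of monoids -/

section Cocomplete

variable (E : Type u) [Category.{v} E] [HasColimits E] [MonoidalCategory E] [SymmetricCategory E]
  [MonoidalClosed E]

instance hasColimitsOfShape_walkingReflexivePair : HasColimitsOfShape WalkingReflexivePair E :=
  hasReflexiveCoequalizers_iff.2 inferInstance

instance hasReflexiveCoequalizers_mon : HasReflexiveCoequalizers (Mon E) :=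
  hasReflexiveCoequalizers_iff.1 inferInstance

instance {J : Type v} [SmallCategory J] : HasReflexiveCoequalizers (J ⥤ Mon E) :=
  hasReflexiveCoequalizers_iff.1 inferInstance

lemma preservesColimit_of_isReflexivePair {A : Type*} {B : Type*} [Category.{v} A] [Category.{v} B]
    (G : A ⥤ B)
    [PreservesColimitsOfShape WalkingReflexivePair G] :
    Monad.PreservesColimitOfIsReflexivePair G where
  out X Y f g _ := by
    have h₁ : PreservesColimit (WalkingParallelPair.inclusionWalkingReflexivePair ⋙
      ofIsReflexivePair f g) G := inferInstance
    exact preservesColimit_of_iso_diagram G (inclusionWalkingReflexivePairOfIsReflexivePairIso f g)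

instance : Monad.PreservesColimitOfIsReflexivePair (Mon.forget E) :=
  preservesColimit_of_isReflexivePair _

/-- The forgetful functor from monoids is monadic. -/
instance monadicForget : MonadicRightAdjoint (Mon.forget E) :=
  Monad.monadicOfHasPreservesReflexiveCoequalizersOfReflectsIsomorphisms (FreeMonoidObject.adj E)

instance isEquivalence_comparison : (Monad.comparison (FreeMonoidObject.adj E)).IsEquivalence :=
  (monadicForget E).eqv

/-- The adjoint triangle theorem: diagrams of monoids are monadic over diagrams in `E`, and the
constant diagram functor followed by this monadic functor has a left adjoint, namely the free monoid
on a colimit in `E`. As `Mon E` has reflexive coequalizers, the constant diagram functor itself has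
a left adjoint. -/
instance hasColimits_mon : HasColimits (Mon E) where
  has_colimits_of_shape J _ := by
    let G : (J ⥤ Mon E) ⥤ (J ⥤ E) := (Functor.whiskeringRight J _ _).obj (Mon.forget E)
    have : MonadicRightAdjoint G :=
      @Monad.monadicOfHasPreservesReflexiveCoequalizersOfReflectsIsomorphisms _ _ _ _ _ _
        ((FreeMonoidObject.adj E).whiskerRight J) inferInstance inferInstance
        (preservesColimit_of_isReflexivePair _)
    have h : (Functor.const J ⋙ G : Mon E ⥤ _).IsRightAdjoint := by
      have e : Functor.const J ⋙ G ≅ Mon.forget E ⋙ Functor.const J := Iso.refl _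
      have : (Mon.forget E ⋙ Functor.const J).IsRightAdjoint :=
        (colimConstAdj.comp (FreeMonoidObject.adj E)).isRightAdjoint
      exact (Adjunction.ofIsRightAdjoint (Mon.forget E ⋙ Functor.const J)).ofNatIsoRight
        e.symm |>.isRightAdjoint
    have : (Functor.const J : Mon E ⥤ _).IsRightAdjoint := isRightAdjoint_triangle_lift_monadic G
    exact hasColimitsOfShape_iff_isRightAdjoint_const.2 this

end Cocomplete

end

noncomputable section

/-! ### Free extensions of monoids as modules -/

namespace MonoidExtension

section Tensor

variable {V : Type*} [Category* V] [MonoidalCategory V]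

lemma isPushout_whiskerLeft [TensorPreservesColimits WalkingSpan V] {A B C D : V} {f : A ⟶ B}
    {g : A ⟶ C} {h : B ⟶ D} {k : C ⟶ D} (sq : IsPushout f g h k) (Z : V) :
    IsPushout (Z ◁ f) (Z ◁ g) (Z ◁ h) (Z ◁ k) :=
  sq.map (tensorLeft Z)

lemma isPushout_whiskerRight [TensorPreservesColimits WalkingSpan V] {A B C D : V} {f : A ⟶ B}
    {g : A ⟶ C} {h : B ⟶ D} {k : C ⟶ D} (sq : IsPushout f g h k) (Z : V) :
    IsPushout (f ▷ Z) (g ▷ Z) (h ▷ Z) (k ▷ Z) :=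
  sq.map (tensorRight Z)

/-- The tensor product of an initial object on the left is initial. -/
def isInitialTensorLeft [TensorPreservesColimits (Discrete PEmpty.{1}) V] {I : V}
    (hI : IsInitial I) (Z : V) : IsInitial (Z ⊗ I) :=
  IsInitial.isInitialObj (tensorLeft Z) I hI

/-- The tensor product of an initial object on the right is initial. -/
def isInitialTensorRight [TensorPreservesColimits (Discrete PEmpty.{1}) V] {I : V}
    (hI : IsInitial I) (Z : V) : IsInitial (I ⊗ Z) :=
  IsInitial.isInitialObj (tensorRight Z) I hI

end Tensor

variable {V : Type*} [Category* V] [MonoidalCategory V] {R X Y : V} [MonObj R]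

/-- A right `R`-module `M` with a map `M ⊗ Y ⟶ M` whose restriction along `u : X ⟶ Y` is the action
of `X` through `α : X ⟶ R`. -/
structure ExtModule (u : X ⟶ Y) (α : X ⟶ R) (M : V) where
  /-- the action of `R` -/
  act : M ⊗ R ⟶ M
  /-- the action of `Y` -/
  actY : M ⊗ Y ⟶ M
  act_one : M ◁ MonObj.one ≫ act = (ρ_ M).hom
  act_assoc : act ▷ R ≫ act = (α_ _ _ _).hom ≫ M ◁ MonObj.mul ≫ act
  u_actY : M ◁ u ≫ actY = M ◁ α ≫ act

variable {u : X ⟶ Y} {α : X ⟶ R}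

/-- The linearity of a morphism `A ⊗ P ⟶ M`. -/
structure ExtModule.IsHom {P M : V} (p : ExtModule u α P) (q : ExtModule u α M) {A : V}
    (φ : A ⊗ P ⟶ M) : Prop where
  act : A ◁ p.act ≫ φ = (α_ _ _ _).inv ≫ φ ▷ R ≫ q.act
  actY : A ◁ p.actY ≫ φ = (α_ _ _ _).inv ≫ φ ▷ Y ≫ q.actY

/-- The module `p` is freely generated by `o : 𝟙_ V ⟶ P`, also after tensoring on the left. -/
structure ExtModule.IsFree {P : V} (p : ExtModule u α P) (o : 𝟙_ V ⟶ P) : Prop where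
  exists_lift {A M : V} (q : ExtModule u α M) (f : A ⟶ M) :
    ∃ φ : A ⊗ P ⟶ M, p.IsHom q φ ∧ A ◁ o ≫ φ = (ρ_ A).hom ≫ f
  hom_ext {A M : V} (q : ExtModule u α M) {φ ψ : A ⊗ P ⟶ M} (hφ : p.IsHom q φ) (hψ : p.IsHom q ψ)
    (h : A ◁ o ≫ φ = A ◁ o ≫ ψ) : φ = ψ

namespace ExtModule.IsFree

variable {P : V} {p : ExtModule u α P} {o : 𝟙_ V ⟶ P} (h : p.IsFree o)

/-- The multiplication of a free module. -/
def mul : P ⊗ P ⟶ P := (h.exists_lift p (𝟙 P)).choose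

lemma isHom_mul : p.IsHom p h.mul := (h.exists_lift p (𝟙 P)).choose_spec.1

lemma mul_one : P ◁ o ≫ h.mul = (ρ_ P).hom :=
  (h.exists_lift p (𝟙 P)).choose_spec.2.trans (Category.comp_id _)

/-- The monoid structure on a free module. -/
@[reducible]
def monObj : MonObj P where
  one := o
  mul := h.mul
  mul_one := h.mul_one
  one_mul := by
    -- Both sides are linear in the last tensor factor, so they only need to agree on the generator,
    -- where `mul_one` applies. Associativity is proved in the same way.
    refine h.hom_ext p ⟨?_, ?_⟩ ⟨by simp, by simp⟩ ?_
    · rw [whisker_exchange_assoc, h.isHom_mul.act]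
      simp
    · rw [whisker_exchange_assoc, h.isHom_mul.actY]
      simp
    · rw [whisker_exchange_assoc, h.mul_one, rightUnitor_naturality, leftUnitor_naturality,
        unitors_equal]
  mul_assoc := by
    refine h.hom_ext p ⟨?_, ?_⟩ ⟨?_, ?_⟩ ?_
    · rw [whisker_exchange_assoc, h.isHom_mul.act]
      simp
    · rw [whisker_exchange_assoc, h.isHom_mul.actY]
      simp
    · have := congrArg (fun t => P ◁ t ≫ h.mul) h.isHom_mul.act
      simp only [MonoidalCategory.whiskerLeft_comp, Category.assoc] at this
      simp [this, h.isHom_mul.act]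
    · have := congrArg (fun t => P ◁ t ≫ h.mul) h.isHom_mul.actY
      simp only [MonoidalCategory.whiskerLeft_comp, Category.assoc] at this
      simp [this, h.isHom_mul.actY]
    · have := congrArg (fun t => P ◁ t ≫ h.mul) h.mul_one
      simp only [MonoidalCategory.whiskerLeft_comp, Category.assoc] at this
      rw [whisker_exchange_assoc, h.mul_one]
      simp [this]

end ExtModule.IsFree

namespace ExtModule

variable {P : V} (p : ExtModule u α P) (o : 𝟙_ V ⟶ P)

/-- The morphism `R ⟶ P` given by the action on a generator. -/
def inl : R ⟶ P := (λ_ R).inv ≫ o ▷ R ≫ p.act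

/-- The morphism `Y ⟶ P` given by the action on a generator. -/
def inr : Y ⟶ P := (λ_ Y).inv ≫ o ▷ Y ≫ p.actY

lemma inl_inr : α ≫ p.inl o = u ≫ p.inr o := by
  rw [inl, inr, leftUnitor_inv_naturality_assoc, leftUnitor_inv_naturality_assoc,
    whisker_exchange_assoc, whisker_exchange_assoc, p.u_actY]

lemma one_inl : (MonObj.one : 𝟙_ V ⟶ R) ≫ p.inl o = o := by
  rw [inl, leftUnitor_inv_naturality_assoc, whisker_exchange_assoc, p.act_one,
    rightUnitor_naturality, ← unitors_equal, Iso.inv_hom_id_assoc]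

lemma inl_act : p.inl o ▷ R ≫ p.act = MonObj.mul ≫ p.inl o := by
  rw [inl, leftUnitor_inv_naturality_assoc, whisker_exchange_assoc]
  simp [p.act_assoc]

/-- A monoid structure on `P` which is compatible with the module structure. -/
structure IsCompatible [MonObj P] : Prop where
  one_eq : (MonObj.one : 𝟙_ V ⟶ P) = o
  isHom_mul : p.IsHom p (MonObj.mul : P ⊗ P ⟶ P)

namespace IsCompatible

variable {p o} [MonObj P] (hP : p.IsCompatible o)

include hP

/-- Linearity of the multiplication gives `p · (1 r) = (p · 1) r = p r`. Thus the module structure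
can be recovered from the monoid structure, which turns monoid maps into linear maps. -/
lemma inl_mul : P ◁ p.inl o ≫ MonObj.mul = p.act := by
  have h := congrArg (fun t => t ▷ R ≫ p.act) (MonObj.mul_one P)
  simp only [comp_whiskerRight, Category.assoc, hP.one_eq] at h
  simp only [inl, MonoidalCategory.whiskerLeft_comp, Category.assoc, hP.isHom_mul.act,
    associator_inv_naturality_middle_assoc]
  rw [h]
  simp

lemma inr_mul : P ◁ p.inr o ≫ MonObj.mul = p.actY := by
  have h := congrArg (fun t => t ▷ Y ≫ p.actY) (MonObj.mul_one P)
  simp only [comp_whiskerRight, Category.assoc, hP.one_eq] at h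
  simp only [inr, MonoidalCategory.whiskerLeft_comp, Category.assoc, hP.isHom_mul.actY,
    associator_inv_naturality_middle_assoc]
  rw [h]
  simp

lemma isMonHom_inl : IsMonHom (p.inl o) where
  one_hom := by rw [hP.one_eq, p.one_inl]
  mul_hom := by rw [MonoidalCategory.tensorHom_def, Category.assoc, hP.inl_mul, p.inl_act]

end IsCompatible

/-- A monoid under `R` with a compatible map from `Y`, as a module. -/
def ofMon {N : V} [MonObj N] (f : R ⟶ N) [IsMonHom f] (g : Y ⟶ N) (w : α ≫ f = u ≫ g) :
    ExtModule u α N where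
  act := N ◁ f ≫ MonObj.mul
  actY := N ◁ g ≫ MonObj.mul
  act_one := by
    rw [← MonoidalCategory.whiskerLeft_comp_assoc, IsMonHom.one_hom, MonObj.mul_one]
  act_assoc := by
    rw [← MonoidalCategory.whiskerLeft_comp_assoc, IsMonHom.mul_hom]
    simp only [comp_whiskerRight, Category.assoc, MonoidalCategory.tensorHom_def,
      MonoidalCategory.whiskerLeft_comp]
    rw [← whisker_exchange_assoc, MonObj.mul_assoc]
    simp
  u_actY := by
    rw [← MonoidalCategory.whiskerLeft_comp_assoc, ← MonoidalCategory.whiskerLeft_comp_assoc, w]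

variable {p} in
-- For linear `φ` the map `a ⊗ x ↦ ψ(a) φ(x)` is linear in `x` by associativity in `N`. This is what
-- allows multiplicativity of `φ` to be tested on the generator.
lemma isHom_tensor_mul {N : V} [MonObj N] (f : R ⟶ N) [IsMonHom f] (g : Y ⟶ N)
    (w : α ≫ f = u ≫ g) (φ : P ⟶ N) (hφ : p.act ≫ φ = φ ▷ R ≫ N ◁ f ≫ MonObj.mul)
    (hφ' : p.actY ≫ φ = φ ▷ Y ≫ N ◁ g ≫ MonObj.mul) {A : V} (ψ : A ⟶ N) :
    p.IsHom (ofMon f g w) ((ψ ⊗ₘ φ) ≫ MonObj.mul) := by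
  constructor
  · rw [MonoidalCategory.tensorHom_def', Category.assoc,
      ← MonoidalCategory.whiskerLeft_comp_assoc, hφ]
    simp only [ofMon, MonoidalCategory.whiskerLeft_comp, Category.assoc, comp_whiskerRight]
    rw [whisker_exchange_assoc, MonObj.mul_assoc_flip, ← whisker_exchange_assoc,
      tensor_whiskerLeft_assoc]
    simp only [Category.assoc, whiskerRight_tensor]
    rw [associator_inv_naturality_right_assoc, whisker_exchange_assoc]
    simp
  · rw [MonoidalCategory.tensorHom_def', Category.assoc,
      ← MonoidalCategory.whiskerLeft_comp_assoc, hφ']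
    simp only [ofMon, MonoidalCategory.whiskerLeft_comp, Category.assoc, comp_whiskerRight]
    rw [whisker_exchange_assoc, MonObj.mul_assoc_flip, ← whisker_exchange_assoc,
      tensor_whiskerLeft_assoc]
    simp only [Category.assoc, whiskerRight_tensor]
    rw [associator_inv_naturality_right_assoc, whisker_exchange_assoc]
    simp

variable {p o} [MonObj P] (hP : p.IsCompatible o)

include hP in
/-- The universal property of a compatible monoid structure on a free module. -/
lemma IsFree.exists_monHom (h : p.IsFree o) {N : V} [MonObj N] (f : R ⟶ N) [IsMonHom f]
    (g : Y ⟶ N) (w : α ≫ f = u ≫ g) :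
    ∃ φ : P ⟶ N, IsMonHom φ ∧ p.inl o ≫ φ = f ∧ p.inr o ≫ φ = g := by
  obtain ⟨φ', hφ', h₀⟩ := h.exists_lift (ofMon f g w) (MonObj.one : 𝟙_ V ⟶ N)
  obtain ⟨φ, rfl⟩ : ∃ φ, φ' = (λ_ P).hom ≫ φ := ⟨(λ_ P).inv ≫ φ', by simp⟩
  have hone : o ≫ φ = MonObj.one := by
    rw [leftUnitor_naturality_assoc, unitors_equal, cancel_epi] at h₀
    exact h₀
  have h₁ : p.act ≫ φ = φ ▷ R ≫ N ◁ f ≫ MonObj.mul := by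
    rw [← cancel_epi (λ_ _).hom, ← leftUnitor_naturality_assoc, hφ'.act]
    simp [ofMon]
  have h₂ : p.actY ≫ φ = φ ▷ Y ≫ N ◁ g ≫ MonObj.mul := by
    rw [← cancel_epi (λ_ _).hom, ← leftUnitor_naturality_assoc, hφ'.actY]
    simp [ofMon]
  refine ⟨φ, ⟨by rw [hP.one_eq, hone], ?_⟩, ?_, ?_⟩
  -- Both `φ(x x')` and `φ(x) φ(x')` are linear in `x'` and equal `φ(x)` when `x'` is the generator.
  · refine h.hom_ext (ofMon f g w) ?_ (isHom_tensor_mul f g w φ h₁ h₂ φ) ?_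
    · constructor
      · rw [reassoc_of% hP.isHom_mul.act, h₁]
        simp [ofMon]
      · rw [reassoc_of% hP.isHom_mul.actY, h₂]
        simp [ofMon]
    · rw [← hP.one_eq, MonObj.mul_one_assoc, MonoidalCategory.tensorHom_def', Category.assoc,
        ← MonoidalCategory.whiskerLeft_comp_assoc, hP.one_eq, hone, whisker_exchange_assoc,
        MonObj.mul_one, rightUnitor_naturality]
  · rw [inl, Category.assoc, Category.assoc, h₁, ← comp_whiskerRight_assoc, hone,
      ← whisker_exchange_assoc, MonObj.one_mul, leftUnitor_naturality, Iso.inv_hom_id_assoc]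
  · rw [inr, Category.assoc, Category.assoc, h₂, ← comp_whiskerRight_assoc, hone,
      ← whisker_exchange_assoc, MonObj.one_mul, leftUnitor_naturality, Iso.inv_hom_id_assoc]

include hP in
-- Since the actions on `P` are right multiplications, `φ` and `ψ` are linear for the same module
-- structure on `N`. They agree on the generator because it is the unit of `P`.
lemma IsFree.monHom_ext (h : p.IsFree o) {N : V} [MonObj N] {φ ψ : P ⟶ N} [IsMonHom φ]
    [IsMonHom ψ] (hl : p.inl o ≫ φ = p.inl o ≫ ψ) (hr : p.inr o ≫ φ = p.inr o ≫ ψ) : φ = ψ := by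
  have := hP.isMonHom_inl
  have w : α ≫ p.inl o ≫ φ = u ≫ p.inr o ≫ φ := by
    rw [← Category.assoc, ← Category.assoc, p.inl_inr]
  have key (ψ : P ⟶ N) [IsMonHom ψ] (hl : p.inl o ≫ φ = p.inl o ≫ ψ)
      (hr : p.inr o ≫ φ = p.inr o ≫ ψ) :
      p.IsHom (ofMon (p.inl o ≫ φ) (p.inr o ≫ φ) w) ((λ_ P).hom ≫ ψ) := by
    constructor
    · rw [leftUnitor_naturality_assoc, ← hP.inl_mul, Category.assoc, IsMonHom.mul_hom]
      simp [ofMon, hl, MonoidalCategory.tensorHom_def, whisker_exchange_assoc]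
    · rw [leftUnitor_naturality_assoc, ← hP.inr_mul, Category.assoc, IsMonHom.mul_hom]
      simp [ofMon, hr, MonoidalCategory.tensorHom_def, whisker_exchange_assoc]
  rw [← cancel_epi (λ_ P).hom]
  refine h.hom_ext _ (key φ rfl rfl) (key ψ hl hr) ?_
  rw [leftUnitor_naturality_assoc, leftUnitor_naturality_assoc, ← hP.one_eq, IsMonHom.one_hom,
    IsMonHom.one_hom]

end ExtModule

end MonoidExtension

end

/-! ### Construction of the filtration by the number of new letters -/

noncomputable section

namespace MonoidExtension

variable {V : Type*} [Category* V] [MonoidalCategory V] {R X Y : V} [MonObj R]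

/-- The filtration of a free extension of the monoid `R` along `u : X ⟶ Y` and `α : X ⟶ R`. The
object `obj (n + 1)` is generated by the words with at most `n` letters from `Y`, and `obj 0` is
initial. -/
structure Tower (u : X ⟶ Y) (α : X ⟶ R) where
  /-- the objects of the filtration -/
  obj : ℕ → V
  /-- the inclusions -/
  i (n : ℕ) : obj n ⟶ obj (n + 1)
  /-- the action of `R` -/
  act (n : ℕ) : obj (n + 1) ⊗ R ⟶ obj (n + 1)
  /-- adding a letter from `Y` to a word -/
  m (n : ℕ) : obj n ⊗ Y ⟶ obj (n + 1)
  /-- `obj 0` is initial -/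
  isInitial : IsInitial (obj 0)
  /-- `obj 1` is `R` -/
  e : R ≅ obj 1
  act_one (n : ℕ) : obj (n + 1) ◁ MonObj.one ≫ act n = (ρ_ _).hom
  act_assoc (n : ℕ) : act n ▷ R ≫ act n = (α_ _ _ _).hom ≫ obj (n + 1) ◁ MonObj.mul ≫ act n
  e_act : e.hom ▷ R ≫ act 0 = MonObj.mul ≫ e.hom
  i_act (n : ℕ) : i (n + 1) ▷ R ≫ act (n + 1) = act n ≫ i (n + 1)
  u_m (n : ℕ) : obj n ◁ u ≫ m n = i n ▷ X ≫ obj (n + 1) ◁ α ≫ act n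
  i_m (n : ℕ) : i n ▷ Y ≫ m (n + 1) = m n ≫ i (n + 1)
  /-- the domain of the pushout-product of `i n` and `u` -/
  Q (n : ℕ) : V
  /-- the first inclusion -/
  Qinl (n : ℕ) : obj n ⊗ Y ⟶ Q n
  /-- the second inclusion -/
  Qinr (n : ℕ) : obj (n + 1) ⊗ X ⟶ Q n
  isPushoutQ (n : ℕ) : IsPushout (obj n ◁ u) (i n ▷ X) (Qinl n) (Qinr n)
  /-- the pushout-product of `i n` and `u` -/
  q (n : ℕ) : Q n ⟶ obj (n + 1) ⊗ Y
  Qinl_q (n : ℕ) : Qinl n ≫ q n = i n ▷ Y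
  Qinr_q (n : ℕ) : Qinr n ≫ q n = obj (n + 1) ◁ u
  /-- the attaching map -/
  k (n : ℕ) : Q n ⟶ obj (n + 1)
  Qinl_k (n : ℕ) : Qinl n ≫ k n = m n
  Qinr_k (n : ℕ) : Qinr n ≫ k n = obj (n + 1) ◁ α ≫ act n
  isPushout (n : ℕ) :
    IsPushout (q n ▷ R) (k n ▷ R ≫ act n) (m (n + 1) ▷ R ≫ act (n + 1)) (i (n + 1))

section Construction

/-- Two consecutive objects of the filtration. -/
structure Stage (u : X ⟶ Y) (α : X ⟶ R) where
  /-- the first object -/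
  A : V
  /-- the second object -/
  B : V
  /-- the inclusion -/
  i : A ⟶ B
  /-- the action of `R` -/
  act : B ⊗ R ⟶ B
  /-- adding a letter from `Y` to a word -/
  m : A ⊗ Y ⟶ B
  act_one : B ◁ MonObj.one ≫ act = (ρ_ _).hom
  act_assoc : act ▷ R ≫ act = (α_ _ _ _).hom ≫ B ◁ MonObj.mul ≫ act
  u_m : A ◁ u ≫ m = i ▷ X ≫ B ◁ α ≫ act

variable {u : X ⟶ Y} {α : X ⟶ R} [HasPushouts V]

namespace Stage

variable (s : Stage u α)

/-- The domain of the pushout-product of the inclusion and `u`. -/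
abbrev Q : V := pushout (s.A ◁ u) (s.i ▷ X)

/-- The pushout-product of the inclusion and `u`. -/
def q : s.Q ⟶ s.B ⊗ Y := pushout.desc (s.i ▷ Y) (s.B ◁ u) (whisker_exchange _ _)

/-- The attaching map. -/
def k : s.Q ⟶ s.B := pushout.desc s.m (s.B ◁ α ≫ s.act) s.u_m

@[simp]
lemma inl_q : pushout.inl _ _ ≫ s.q = s.i ▷ Y := pushout.inl_desc _ _ _

@[simp]
lemma inr_q : pushout.inr _ _ ≫ s.q = s.B ◁ u := pushout.inr_desc _ _ _

@[simp]
lemma inl_k : pushout.inl _ _ ≫ s.k = s.m := pushout.inl_desc _ _ _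

@[simp]
lemma inr_k : pushout.inr _ _ ≫ s.k = s.B ◁ α ≫ s.act := pushout.inr_desc _ _ _

/-- The next object of the filtration. -/
abbrev C : V := pushout (s.q ▷ R) (s.k ▷ R ≫ s.act)

/-- The cell map. -/
abbrev cell : (s.B ⊗ Y) ⊗ R ⟶ s.C := pushout.inl _ _

/-- The inclusion into the next object. -/
abbrev j : s.B ⟶ s.C := pushout.inr _ _

lemma cell_condition : s.q ▷ R ≫ s.cell = s.k ▷ R ≫ s.act ≫ s.j := by
  simpa using pushout.condition (f := s.q ▷ R) (g := s.k ▷ R ≫ s.act)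

lemma isPushout_cell : IsPushout (s.q ▷ R) (s.k ▷ R ≫ s.act) s.cell s.j :=
  IsPushout.of_hasPushout _ _

variable [TensorPreservesColimits WalkingSpan V]

lemma isPushout_tensor :
    IsPushout (s.q ▷ R ▷ R) ((s.k ▷ R ≫ s.act) ▷ R) (s.cell ▷ R) (s.j ▷ R) :=
  isPushout_whiskerRight s.isPushout_cell R

/-- The action on the next object. -/
def actC : s.C ⊗ R ⟶ s.C :=
  s.isPushout_tensor.desc ((α_ _ _ _).hom ≫ (s.B ⊗ Y) ◁ MonObj.mul ≫ s.cell) (s.act ≫ s.j) (by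
    rw [associator_naturality_left_assoc, ← whisker_exchange_assoc, cell_condition,
      whisker_exchange_assoc, comp_whiskerRight, Category.assoc, reassoc_of% s.act_assoc]
    simp)

lemma cell_actC : s.cell ▷ R ≫ s.actC = (α_ _ _ _).hom ≫ (s.B ⊗ Y) ◁ MonObj.mul ≫ s.cell :=
  s.isPushout_tensor.inl_desc _ _ _

lemma j_actC : s.j ▷ R ≫ s.actC = s.act ≫ s.j :=
  s.isPushout_tensor.inr_desc _ _ _

/-- Adding a letter from `Y`. -/
def mC : s.B ⊗ Y ⟶ s.C := (ρ_ _).inv ≫ (s.B ⊗ Y) ◁ MonObj.one ≫ s.cell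

/-- The cell `b ⊗ y ⊗ r` is `(b y) r`, so the tower need only record adding a letter and acting by
`R`. -/
lemma mC_actC : s.mC ▷ R ≫ s.actC = s.cell := by
  simp only [mC, comp_whiskerRight, Category.assoc, cell_actC, associator_naturality_middle_assoc]
  rw [← MonoidalCategory.whiskerLeft_comp_assoc, MonObj.one_mul]
  simp

omit [TensorPreservesColimits WalkingSpan V] in
-- The gluing relation of the cell, with the unit of `R` inserted. Restricted to the two summands of
-- the pushout-product it yields `i_m` for the tower and `u_m` for the next stage.
lemma q_mC : s.q ≫ s.mC = s.k ≫ s.j := by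
  rw [mC, rightUnitor_inv_naturality_assoc, ← whisker_exchange_assoc, cell_condition,
    whisker_exchange_assoc, reassoc_of% s.act_one]
  simp

/-- The next stage. -/
def next : Stage u α where
  A := s.B
  B := s.C
  i := s.j
  act := s.actC
  m := s.mC
  act_one := by
    rw [← cancel_epi (ρ_ _).inv, Iso.inv_hom_id]
    refine pushout.hom_ext ?_ ?_
    · rw [rightUnitor_inv_naturality_assoc, ← whisker_exchange_assoc, cell_actC,
        associator_naturality_right_assoc, ← MonoidalCategory.whiskerLeft_comp_assoc,
        MonObj.mul_one]
      simp
    · rw [rightUnitor_inv_naturality_assoc, ← whisker_exchange_assoc, j_actC, reassoc_of% s.act_one]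
      simp
  act_assoc := by
    refine (isPushout_whiskerRight s.isPushout_tensor R).hom_ext ?_ ?_
    · rw [← comp_whiskerRight_assoc, cell_actC]
      simp only [comp_whiskerRight, Category.assoc, cell_actC]
      rw [associator_naturality_left_assoc, ← whisker_exchange_assoc, cell_actC,
        associator_naturality_middle_assoc, ← MonoidalCategory.whiskerLeft_comp_assoc,
        MonObj.mul_assoc]
      simp only [MonoidalCategory.whiskerLeft_comp, Category.assoc]
      rw [pentagon_assoc, associator_naturality_right_assoc]
    · rw [← comp_whiskerRight_assoc, j_actC, comp_whiskerRight_assoc, j_actC, reassoc_of% s.act_assoc,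
        associator_naturality_left_assoc, ← whisker_exchange_assoc, j_actC]
  u_m := by
    have := congrArg (fun t => pushout.inr _ _ ≫ t) s.q_mC
    simp only [reassoc_of% inr_q, reassoc_of% inr_k] at this
    rw [this, ← whisker_exchange_assoc, j_actC]

variable [HasInitial V] [TensorPreservesColimits (Discrete PEmpty.{1}) V]

variable (u α) in
/-- The first stage. -/
def first : Stage u α where
  A := ⊥_ V
  B := R
  i := initial.to R
  act := MonObj.mul
  m := (isInitialTensorRight initialIsInitial _).to _
  act_one := MonObj.mul_one R
  act_assoc := MonObj.mul_assoc R
  u_m := (isInitialTensorRight initialIsInitial _).hom_ext _ _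

variable (u α) in
/-- The stages. -/
def seq : ℕ → Stage u α
  | 0 => first u α
  | n + 1 => (seq n).next

end Stage

variable [TensorPreservesColimits WalkingSpan V] [HasInitial V]
  [TensorPreservesColimits (Discrete PEmpty.{1}) V]

variable (u α) in
/-- The tower exists. -/
def Tower.mk' : Tower u α where
  obj n := (Stage.seq u α n).A
  i n := (Stage.seq u α n).i
  act n := (Stage.seq u α n).act
  m n := (Stage.seq u α n).m
  isInitial := initialIsInitial
  e := Iso.refl _
  act_one n := (Stage.seq u α n).act_one
  act_assoc n := (Stage.seq u α n).act_assoc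
  e_act := (congrArg (· ≫ MonObj.mul) (id_whiskerRight R R)).trans
    ((Category.id_comp _).trans (Category.comp_id _).symm)
  i_act n := (Stage.seq u α n).j_actC
  u_m n := (Stage.seq u α n).u_m
  i_m n := by
    have := congrArg (fun t => pushout.inl _ _ ≫ t) (Stage.seq u α n).q_mC
    simp only [reassoc_of% Stage.inl_q, reassoc_of% Stage.inl_k] at this
    exact this
  Q n := (Stage.seq u α n).Q
  Qinl n := pushout.inl _ _
  Qinr n := pushout.inr _ _
  isPushoutQ n := IsPushout.of_hasPushout _ _
  q n := (Stage.seq u α n).q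
  Qinl_q n := (Stage.seq u α n).inl_q
  Qinr_q n := (Stage.seq u α n).inr_q
  k n := (Stage.seq u α n).k
  Qinl_k n := (Stage.seq u α n).inl_k
  Qinr_k n := (Stage.seq u α n).inr_k
  isPushout n := by
    have := (Stage.seq u α n).isPushout_cell
    rw [← (Stage.seq u α n).mC_actC] at this
    exact this

end Construction

section Sequence

variable {C : Type*} [Category* C]

/-- The cocone over a sequence given by compatible morphisms. -/
def sequenceCocone (F : ℕ ⥤ C) {Z : C} (f : ∀ n, F.obj n ⟶ Z)
    (h : ∀ n, F.map (homOfLE (Nat.le_succ n)) ≫ f (n + 1) = f n) : Cocone F :=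
  Cocone.mk Z (NatTrans.ofSequence f (fun n => (h n).trans (Category.comp_id _).symm))

lemma sequence_exists_desc {F : ℕ ⥤ C} {c : Cocone F} (hc : IsColimit c) {Z : C}
    (f : ∀ n, F.obj n ⟶ Z) (h : ∀ n, F.map (homOfLE (Nat.le_succ n)) ≫ f (n + 1) = f n) :
    ∃ g : c.pt ⟶ Z, ∀ n, c.ι.app n ≫ g = f n :=
  ⟨hc.desc (sequenceCocone F f h), fun n => hc.fac (sequenceCocone F f h) n⟩

end Sequence

/-! ### The colimit of a tower as a free module -/

namespace Tower

variable {u : X ⟶ Y} {α : X ⟶ R} (t : Tower u α)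

/-- The sequence of inclusions, without the initial object. -/
def seq : ℕ ⥤ V := Functor.ofSequence (X := fun n => t.obj (n + 1)) (fun n => t.i (n + 1))

lemma seq_map_succ (n : ℕ) : t.seq.map (homOfLE (Nat.le_succ n)) = t.i (n + 1) :=
  Functor.ofSequence_map_homOfLE_succ _ n

/-- The colimit of a tower, with its structure of a module. -/
structure Colimit where
  /-- the colimit -/
  P : V
  /-- the inclusions -/
  ι (n : ℕ) : t.obj (n + 1) ⟶ P
  i_ι (n : ℕ) : t.i (n + 1) ≫ ι (n + 1) = ι n
  exists_desc {Z : V} (f : ∀ n, t.obj (n + 1) ⟶ Z) (h : ∀ n, t.i (n + 1) ≫ f (n + 1) = f n) :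
    ∃ g : P ⟶ Z, ∀ n, ι n ≫ g = f n
  hom_ext {Z : V} {f g : P ⟶ Z} (h : ∀ n, ι n ≫ f = ι n ≫ g) : f = g
  /-- the action of `R` -/
  act : P ⊗ R ⟶ P
  /-- the action of `Y` -/
  actY : P ⊗ Y ⟶ P
  ι_act (n : ℕ) : ι n ▷ R ≫ act = t.act n ≫ ι n
  ι_actY (n : ℕ) : ι n ▷ Y ≫ actY = t.m (n + 1) ≫ ι (n + 1)

namespace Colimit

variable {t} (c : t.Colimit)

/-- The colimit cocone. -/
def cocone : Cocone t.seq :=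
  sequenceCocone t.seq c.ι (fun n =>
    (congrArg (· ≫ c.ι (n + 1)) (t.seq_map_succ n)).trans (c.i_ι n))

/-- The colimit cocone is a colimit cocone. -/
def isColimit : IsColimit c.cocone where
  desc s := (c.exists_desc (fun n => s.ι.app n) (fun n => by
    rw [← seq_map_succ]; exact s.w _)).choose
  fac s n := (c.exists_desc (fun n => s.ι.app n) (fun n => by
    rw [← seq_map_succ]; exact s.w _)).choose_spec n
  uniq s g h := c.hom_ext (fun n => (h n).trans ((c.exists_desc (fun n => s.ι.app n) (fun n => by
    rw [← seq_map_succ]; exact s.w _)).choose_spec n).symm)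

section

variable {D : Type*} [Category* D] (G : V ⥤ D) [PreservesColimitsOfShape ℕ G]

lemma map_exists_desc {Z : D} (f : ∀ n, G.obj (t.obj (n + 1)) ⟶ Z)
    (h : ∀ n, G.map (t.i (n + 1)) ≫ f (n + 1) = f n) :
    ∃ g : G.obj c.P ⟶ Z, ∀ n, G.map (c.ι n) ≫ g = f n :=
  sequence_exists_desc (isColimitOfPreserves G c.isColimit) f (fun n => by
    rw [Functor.comp_map, seq_map_succ]
    exact h n)

lemma map_hom_ext {Z : D} {f g : G.obj c.P ⟶ Z}
    (h : ∀ n, G.map (c.ι n) ≫ f = G.map (c.ι n) ≫ g) : f = g :=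
  (isColimitOfPreserves G c.isColimit).hom_ext h

end

variable [TensorPreservesColimits ℕ V]

lemma exists_desc_whiskerLeft (A : V) {Z : V} (f : ∀ n, A ⊗ t.obj (n + 1) ⟶ Z)
    (h : ∀ n, A ◁ t.i (n + 1) ≫ f (n + 1) = f n) :
    ∃ g : A ⊗ c.P ⟶ Z, ∀ n, A ◁ c.ι n ≫ g = f n :=
  c.map_exists_desc (tensorLeft A) f h

lemma hom_ext_whiskerLeft {A Z : V} {f g : A ⊗ c.P ⟶ Z}
    (h : ∀ n, A ◁ c.ι n ≫ f = A ◁ c.ι n ≫ g) : f = g :=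
  c.map_hom_ext (tensorLeft A) h

lemma hom_ext_whiskerRight {A Z : V} {f g : c.P ⊗ A ⟶ Z}
    (h : ∀ n, c.ι n ▷ A ≫ f = c.ι n ▷ A ≫ g) : f = g :=
  c.map_hom_ext (tensorRight A) h

/-- The module structure on the colimit of a tower. -/
def module : ExtModule u α c.P where
  act := c.act
  actY := c.actY
  act_one := c.hom_ext_whiskerRight fun n => by
    rw [← whisker_exchange_assoc, c.ι_act, reassoc_of% t.act_one, rightUnitor_naturality]
  act_assoc := c.map_hom_ext (tensorRight R ⋙ tensorRight R) fun n => by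
    dsimp
    rw [← comp_whiskerRight_assoc, c.ι_act, comp_whiskerRight_assoc, c.ι_act,
      reassoc_of% t.act_assoc, associator_naturality_left_assoc, ← whisker_exchange_assoc, c.ι_act]
  u_actY := c.hom_ext_whiskerRight fun n => by
    rw [← whisker_exchange_assoc, c.ι_actY, reassoc_of% t.u_m, ← whisker_exchange_assoc, ← whisker_exchange_assoc,
      reassoc_of% t.i_act, c.i_ι, c.ι_act]

/-- The generator of the colimit of a tower. -/
def one : 𝟙_ V ⟶ c.P := MonObj.one ≫ t.e.hom ≫ c.ι 0

section Lift

variable {A M : V} (q : ExtModule u α M) (f : A ⟶ M)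

/-- The components of a linear map. -/
structure LiftStage (n : ℕ) where
  /-- the map on `obj n` -/
  a : A ⊗ t.obj n ⟶ M
  /-- the map on `obj (n + 1)` -/
  b : A ⊗ t.obj (n + 1) ⟶ M
  i_b : A ◁ t.i n ≫ b = a
  act_b : A ◁ t.act n ≫ b = (α_ _ _ _).inv ≫ b ▷ R ≫ q.act
  m_b : A ◁ t.m n ≫ b = (α_ _ _ _).inv ≫ a ▷ Y ≫ q.actY

variable (t) in
/-- The first components of a linear map. -/
def LiftStage.first [TensorPreservesColimits (Discrete PEmpty.{1}) V] :
    LiftStage (t := t) (A := A) q 0 where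
  a := (isInitialTensorLeft t.isInitial A).to _
  b := A ◁ t.e.inv ≫ f ▷ R ≫ q.act
  i_b := (isInitialTensorLeft t.isInitial A).hom_ext _ _
  act_b := by
    have h : t.act 0 ≫ t.e.inv = t.e.inv ▷ R ≫ MonObj.mul := by
      rw [← cancel_epi (t.e.hom ▷ R), reassoc_of% t.e_act, Iso.hom_inv_id, Category.comp_id,
        ← comp_whiskerRight_assoc, Iso.hom_inv_id, id_whiskerRight, Category.id_comp]
    rw [← MonoidalCategory.whiskerLeft_comp_assoc, h]
    simp only [MonoidalCategory.whiskerLeft_comp, Category.assoc, comp_whiskerRight, q.act_assoc,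
      associator_naturality_left_assoc]
    rw [← whisker_exchange_assoc, ← associator_inv_naturality_middle_assoc,
      Iso.inv_hom_id_assoc]
  m_b := (isInitialTensorLeft (isInitialTensorRight t.isInitial Y) A).hom_ext _ _

variable {q}

omit [TensorPreservesColimits ℕ V] in
-- Linearity dictates the value on a cell: `a ⊗ (b y) r` must go to `(s.b(a ⊗ b) y) r`. This is
-- compatible with the attaching map because `s` is linear one stage below, and the pushout defining
-- the new object stays a pushout after tensoring with `A`.
lemma LiftStage.exists_next [TensorPreservesColimits WalkingSpan V] {n : ℕ}
    (s : LiftStage (t := t) (A := A) q n) :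
    ∃ s' : LiftStage (t := t) (A := A) q (n + 1), s'.a = s.b := by
  have sq := isPushout_whiskerLeft (t.isPushout n) A
  -- On the first summand of `Q n` this is `m_b` for the previous letter; on the second it is the
  -- relation `u_actY` in the target.
  have w : A ◁ t.q n ≫ (α_ _ _ _).inv ≫ s.b ▷ Y ≫ q.actY = A ◁ t.k n ≫ s.b := by
    refine (isPushout_whiskerLeft (t.isPushoutQ n) A).hom_ext ?_ ?_
    · rw [← MonoidalCategory.whiskerLeft_comp_assoc, ← MonoidalCategory.whiskerLeft_comp_assoc,
        t.Qinl_q, t.Qinl_k, s.m_b, associator_inv_naturality_middle_assoc,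
        ← comp_whiskerRight_assoc, s.i_b]
    · rw [← MonoidalCategory.whiskerLeft_comp_assoc, ← MonoidalCategory.whiskerLeft_comp_assoc,
        t.Qinr_q, t.Qinr_k, associator_inv_naturality_right_assoc, whisker_exchange_assoc,
        q.u_actY, MonoidalCategory.whiskerLeft_comp_assoc, s.act_b,
        associator_inv_naturality_right_assoc, whisker_exchange_assoc]
  obtain ⟨b, hb₁, hb₂⟩ := sq.exists_desc
    ((α_ _ _ _).inv ≫ ((α_ _ _ _).inv ≫ s.b ▷ Y ≫ q.actY) ▷ R ≫ q.act) s.b (by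
      rw [associator_inv_naturality_middle_assoc, ← comp_whiskerRight_assoc, w,
        MonoidalCategory.whiskerLeft_comp_assoc, s.act_b,
        associator_inv_naturality_middle_assoc, comp_whiskerRight_assoc])
  refine ⟨⟨s.b, b, hb₂, ?_, ?_⟩, rfl⟩
  · refine (isPushout_whiskerLeft (isPushout_whiskerRight (t.isPushout n) R) A).hom_ext ?_ ?_
    · have h : (t.m (n + 1) ▷ R ≫ t.act (n + 1)) ▷ R ≫ t.act (n + 1) = (α_ _ _ _).hom ≫
          (t.obj (n + 1) ⊗ Y) ◁ MonObj.mul ≫ t.m (n + 1) ▷ R ≫ t.act (n + 1) := by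
        rw [comp_whiskerRight_assoc, t.act_assoc, associator_naturality_left_assoc,
          whisker_exchange_assoc]
      rw [← MonoidalCategory.whiskerLeft_comp_assoc, h, associator_inv_naturality_middle_assoc,
        ← comp_whiskerRight_assoc, MonoidalCategory.whiskerLeft_comp_assoc,
        MonoidalCategory.whiskerLeft_comp_assoc, hb₁]
      generalize (α_ _ _ _).inv ≫ s.b ▷ Y ≫ q.actY = ψ
      simp only [Category.assoc, comp_whiskerRight, q.act_assoc, associator_naturality_left_assoc]
      rw [← whisker_exchange_assoc, associator_inv_naturality_right_assoc,
        ← pentagon_hom_inv_inv_inv_inv_assoc]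
      simp
    · rw [← MonoidalCategory.whiskerLeft_comp_assoc, t.i_act,
        MonoidalCategory.whiskerLeft_comp_assoc, hb₂, s.act_b,
        associator_inv_naturality_middle_assoc, ← comp_whiskerRight_assoc, hb₂]
  -- Adding a letter is the cell map with the unit of `R` as last entry, where the values are
  -- already known by `hb₁`.
  · have h : t.m (n + 1) = (ρ_ _).inv ≫ (t.obj (n + 1) ⊗ Y) ◁ MonObj.one ≫
        t.m (n + 1) ▷ R ≫ t.act (n + 1) := by
      rw [whisker_exchange_assoc, t.act_one, rightUnitor_naturality, Iso.inv_hom_id_assoc]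
    rw [h, MonoidalCategory.whiskerLeft_comp_assoc, MonoidalCategory.whiskerLeft_comp_assoc, hb₁,
      associator_inv_naturality_right_assoc, whisker_exchange_assoc, q.act_one]
    simp

variable (q) in
/-- The components of a linear map. -/
def LiftStage.seq [TensorPreservesColimits (Discrete PEmpty.{1}) V]
    [TensorPreservesColimits WalkingSpan V] : ∀ n, LiftStage (t := t) (A := A) q n
  | 0 => .first t q f
  | n + 1 => (seq n).exists_next.choose

variable [TensorPreservesColimits (Discrete PEmpty.{1}) V] [TensorPreservesColimits WalkingSpan V]

omit [TensorPreservesColimits ℕ V] in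
lemma LiftStage.seq_succ_a (n : ℕ) :
    (LiftStage.seq (t := t) q f (n + 1)).a = (LiftStage.seq q f n).b :=
  (LiftStage.seq (t := t) q f n).exists_next.choose_spec

lemma exists_lift (q : ExtModule u α M) (f : A ⟶ M) :
    ∃ φ : A ⊗ c.P ⟶ M, c.module.IsHom q φ ∧ A ◁ c.one ≫ φ = (ρ_ A).hom ≫ f := by
  let s := LiftStage.seq (t := t) q f
  have hs (n : ℕ) : (s (n + 1)).a = (s n).b := LiftStage.seq_succ_a f n
  obtain ⟨φ, hφ⟩ := c.exists_desc_whiskerLeft A (fun n => (s n).b)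
    (fun n => by rw [(s (n + 1)).i_b, hs])
  refine ⟨φ, ⟨?_, ?_⟩, ?_⟩
  · refine c.map_hom_ext (tensorRight R ⋙ tensorLeft A) fun n => ?_
    dsimp [module]
    rw [← MonoidalCategory.whiskerLeft_comp_assoc, c.ι_act, MonoidalCategory.whiskerLeft_comp_assoc,
      hφ, (s n).act_b, associator_inv_naturality_middle_assoc, ← comp_whiskerRight_assoc, hφ]
  · refine c.map_hom_ext (tensorRight Y ⋙ tensorLeft A) fun n => ?_
    dsimp [module]
    rw [← MonoidalCategory.whiskerLeft_comp_assoc, c.ι_actY,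
      MonoidalCategory.whiskerLeft_comp_assoc, hφ, (s (n + 1)).m_b, hs,
      associator_inv_naturality_middle_assoc, ← comp_whiskerRight_assoc, hφ]
  · have h₀ : (s 0).b = A ◁ t.e.inv ≫ f ▷ R ≫ q.act := rfl
    rw [one, MonoidalCategory.whiskerLeft_comp_assoc, MonoidalCategory.whiskerLeft_comp_assoc, hφ,
      h₀, ← MonoidalCategory.whiskerLeft_comp_assoc A t.e.hom, Iso.hom_inv_id,
      MonoidalCategory.whiskerLeft_id, Category.id_comp, whisker_exchange_assoc, q.act_one,
      rightUnitor_naturality]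

omit [TensorPreservesColimits (Discrete PEmpty.{1}) V] in
-- Induction along the tower: `obj 1 ≅ R` is generated by the unit, and each further object by the
-- preceding one together with the products `(p y) r`, on which a linear map is determined by its
-- value at `p`.
lemma hom_ext_of_isHom (q : ExtModule u α M) {φ ψ : A ⊗ c.P ⟶ M} (hφ : c.module.IsHom q φ)
    (hψ : c.module.IsHom q ψ) (h : A ◁ c.one ≫ φ = A ◁ c.one ≫ ψ) : φ = ψ := by
  refine c.hom_ext_whiskerLeft fun n => ?_
  have hact (φ : A ⊗ c.P ⟶ M) (hφ : c.module.IsHom q φ) (n : ℕ) :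
      A ◁ t.act n ≫ A ◁ c.ι n ≫ φ = (α_ _ _ _).inv ≫ (A ◁ c.ι n ≫ φ) ▷ R ≫ q.act := by
    rw [← MonoidalCategory.whiskerLeft_comp_assoc, ← c.ι_act,
      MonoidalCategory.whiskerLeft_comp_assoc, comp_whiskerRight_assoc,
      ← associator_inv_naturality_middle_assoc]
    exact congrArg _ hφ.act
  have hactY (φ : A ⊗ c.P ⟶ M) (hφ : c.module.IsHom q φ) (n : ℕ) :
      A ◁ t.m (n + 1) ≫ A ◁ c.ι (n + 1) ≫ φ =
        (α_ _ _ _).inv ≫ (A ◁ c.ι n ≫ φ) ▷ Y ≫ q.actY := by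
    rw [← MonoidalCategory.whiskerLeft_comp_assoc, ← c.ι_actY,
      MonoidalCategory.whiskerLeft_comp_assoc, comp_whiskerRight_assoc,
      ← associator_inv_naturality_middle_assoc]
    exact congrArg _ hφ.actY
  induction n with
  | zero =>
    have key (φ : A ⊗ c.P ⟶ M) (hφ : c.module.IsHom q φ) : A ◁ c.ι 0 ≫ φ =
        A ◁ t.e.inv ≫ A ◁ (λ_ R).inv ≫ (α_ _ _ _).inv ≫ (A ◁ c.one ≫ φ) ▷ R ≫ q.act := by
      have h₁ : c.one = (MonObj.one ≫ t.e.hom) ≫ c.ι 0 := by simp [one]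
      rw [h₁, MonoidalCategory.whiskerLeft_comp, Category.assoc, comp_whiskerRight_assoc,
        ← associator_inv_naturality_middle_assoc, ← hact φ hφ 0, comp_whiskerRight,
        MonoidalCategory.whiskerLeft_comp_assoc, ← MonoidalCategory.whiskerLeft_comp_assoc _
          (t.e.hom ▷ R), t.e_act]
      simp only [← MonoidalCategory.whiskerLeft_comp_assoc, Category.assoc]
      simp
    rw [key φ hφ, key ψ hψ, h]
  | succ n ih =>
    refine (isPushout_whiskerLeft (t.isPushout n) A).hom_ext ?_ ?_
    · rw [MonoidalCategory.whiskerLeft_comp_assoc, MonoidalCategory.whiskerLeft_comp_assoc,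
        hact φ hφ, hact ψ hψ, associator_inv_naturality_middle_assoc,
        associator_inv_naturality_middle_assoc, ← comp_whiskerRight_assoc,
        ← comp_whiskerRight_assoc, hactY φ hφ, hactY ψ hψ, ih]
    · rw [← MonoidalCategory.whiskerLeft_comp_assoc, ← MonoidalCategory.whiskerLeft_comp_assoc,
        c.i_ι, ih]

end Lift

/-- The map from `R` to the colimit. -/
lemma module_inl : c.module.inl c.one = t.e.hom ≫ c.ι 0 := by
  change (λ_ R).inv ≫ (MonObj.one ≫ t.e.hom ≫ c.ι 0) ▷ R ≫ c.act = _
  rw [comp_whiskerRight_assoc, comp_whiskerRight_assoc, c.ι_act, reassoc_of% t.e_act,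
    MonObj.one_mul_assoc, Iso.inv_hom_id_assoc]

variable [TensorPreservesColimits (Discrete PEmpty.{1}) V] [TensorPreservesColimits WalkingSpan V]

/-- The colimit of a tower is a free module. -/
lemma isFree : c.module.IsFree c.one where
  exists_lift q f := c.exists_lift q f
  hom_ext q _ _ hφ hψ h := c.hom_ext_of_isHom q hφ hψ h

end Colimit

section OfIsColimit

variable {c : Cocone t.seq} (hc : IsColimit c)

variable (c) in
/-- The components of a cocone over the sequence of a tower. -/
def leg (n : ℕ) : t.obj (n + 1) ⟶ c.pt := c.ι.app n

lemma i_leg (n : ℕ) : t.i (n + 1) ≫ t.leg c (n + 1) = t.leg c n := by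
  rw [← seq_map_succ]
  exact c.w _

variable [TensorPreservesColimits ℕ V]

include hc

lemma exists_colimitAct : ∃ act : c.pt ⊗ R ⟶ c.pt,
    ∀ n, t.leg c n ▷ R ≫ act = t.act n ≫ t.leg c n :=
  sequence_exists_desc (isColimitOfPreserves (tensorRight R) hc) (fun n => t.act n ≫ t.leg c n)
    (fun n => by
      have h : (t.seq ⋙ tensorRight R).map (homOfLE (Nat.le_succ n)) = t.i (n + 1) ▷ R :=
        congrArg (tensorRight R).map (t.seq_map_succ n)
      rw [h]
      exact ((reassoc_of% t.i_act n) _).trans (congrArg (t.act n ≫ ·) (t.i_leg n)))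

lemma exists_colimitActY : ∃ actY : c.pt ⊗ Y ⟶ c.pt,
    ∀ n, t.leg c n ▷ Y ≫ actY = t.m (n + 1) ≫ t.leg c (n + 1) :=
  sequence_exists_desc (isColimitOfPreserves (tensorRight Y) hc)
    (fun n => t.m (n + 1) ≫ t.leg c (n + 1))
    (fun n => by
      have h : (t.seq ⋙ tensorRight Y).map (homOfLE (Nat.le_succ n)) = t.i (n + 1) ▷ Y :=
        congrArg (tensorRight Y).map (t.seq_map_succ n)
      rw [h]
      exact ((reassoc_of% t.i_m (n + 1)) _).trans (congrArg (t.m (n + 1) ≫ ·) (t.i_leg (n + 1))))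

/-- A colimit cocone over the sequence of a tower, as a colimit of the tower. -/
def Colimit.ofIsColimit : t.Colimit where
  P := c.pt
  ι n := t.leg c n
  i_ι n := t.i_leg n
  exists_desc f h := sequence_exists_desc hc f (fun n => by rw [seq_map_succ]; exact h n)
  hom_ext h := hc.hom_ext h
  act := (t.exists_colimitAct hc).choose
  actY := (t.exists_colimitActY hc).choose
  ι_act := (t.exists_colimitAct hc).choose_spec
  ι_actY := (t.exists_colimitActY hc).choose_spec

end OfIsColimit

end Tower

end MonoidExtension

end

/-! ### Functoriality through functor categories -/

noncomputable section

namespace MonoidExtension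

section Evaluation

variable {J : Type*} [Category* J] {E : Type*} [Category* E] [MonoidalCategory E]

/-- Colimits and tensor products of functors are pointwise. Hence the tower can be formed for a
whole diagram of monoids at once, with no separate check of naturality. -/
instance {K : Type*} [Category* K] [HasColimitsOfShape K E] [TensorPreservesColimits K E] :
    TensorPreservesColimits K (J ⥤ E) where
  left X := preservesColimitsOfShape_of_evaluation _ _ (fun j => by
    have e : tensorLeft X ⋙ (evaluation J E).obj j ≅
      (evaluation J E).obj j ⋙ tensorLeft (X.obj j) := Iso.refl _
    exact preservesColimitsOfShape_of_natIso e.symm)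
  right X := preservesColimitsOfShape_of_evaluation _ _ (fun j => by
    have e : tensorRight X ⋙ (evaluation J E).obj j ≅
      (evaluation J E).obj j ⋙ tensorRight (X.obj j) := Iso.refl _
    exact preservesColimitsOfShape_of_natIso e.symm)

/-- The values of a monoid in a functor category are monoids. -/
@[reducible]
def evalMonObj (A : J ⥤ E) [MonObj A] (j : J) : MonObj (A.obj j) where
  one := (MonObj.one : 𝟙_ _ ⟶ A).app j
  mul := (MonObj.mul : A ⊗ A ⟶ A).app j
  one_mul := congr_app (MonObj.one_mul A) j
  mul_one := congr_app (MonObj.mul_one A) j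
  mul_assoc := congr_app (MonObj.mul_assoc A) j

attribute [local instance] evalMonObj

/-- A monoid in a functor category, as a functor to monoids. -/
def monFunctor (A : J ⥤ E) [MonObj A] : J ⥤ Mon E where
  obj j := Mon.mk (A.obj j)
  map {i j} f :=
    { hom := A.map f
      isMonHom_hom :=
        { one_hom := by
            have := (MonObj.one : 𝟙_ _ ⟶ A).naturality f
            exact this.symm.trans (Category.id_comp _)
          mul_hom := ((MonObj.mul : A ⊗ A ⟶ A).naturality f).symm } }
  map_id j := by ext; exact A.map_id j
  map_comp f g := by ext; exact A.map_comp f g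

/-- A functor to monoids, as a monoid in a functor category. -/
@[reducible]
def functorMonObj (A : J ⥤ Mon E) : MonObj (A ⋙ Mon.forget E) where
  one :=
    { app j := (MonObj.one : 𝟙_ E ⟶ (A.obj j).X)
      naturality i j f := (Category.id_comp _).trans (IsMonHom.one_hom (A.map f).hom).symm }
  mul :=
    { app j := (MonObj.mul : (A.obj j).X ⊗ (A.obj j).X ⟶ (A.obj j).X)
      naturality i j f := (IsMonHom.mul_hom (A.map f).hom).symm }
  one_mul := by ext j; exact MonObj.one_mul (A.obj j).X
  mul_one := by ext j; exact MonObj.mul_one (A.obj j).X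
  mul_assoc := by ext j; exact MonObj.mul_assoc (A.obj j).X

variable {R X Y : J ⥤ E} [MonObj R] {u : X ⟶ Y} {α : X ⟶ R}

/-- The values of a tower. -/
def Tower.eval (t : Tower u α) [HasPushouts E] [HasInitial E] (j : J) :
    Tower (u.app j) (α.app j) where
  obj n := (t.obj n).obj j
  i n := (t.i n).app j
  act n := (t.act n).app j
  m n := (t.m n).app j
  isInitial := IsInitial.isInitialObj ((evaluation J E).obj j) _ t.isInitial
  e := t.e.app j
  act_one n := congr_app (t.act_one n) j
  act_assoc n := congr_app (t.act_assoc n) j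
  e_act := congr_app t.e_act j
  i_act n := congr_app (t.i_act n) j
  u_m n := congr_app (t.u_m n) j
  i_m n := congr_app (t.i_m n) j
  Q n := (t.Q n).obj j
  Qinl n := (t.Qinl n).app j
  Qinr n := (t.Qinr n).app j
  isPushoutQ n := (t.isPushoutQ n).map ((evaluation J E).obj j)
  q n := (t.q n).app j
  Qinl_q n := congr_app (t.Qinl_q n) j
  Qinr_q n := congr_app (t.Qinr_q n) j
  k n := (t.k n).app j
  Qinl_k n := congr_app (t.Qinl_k n) j
  Qinr_k n := congr_app (t.Qinr_k n) j
  isPushout n := (t.isPushout n).map ((evaluation J E).obj j)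

variable [HasPushouts E] [HasInitial E] [HasColimitsOfShape ℕ E]

/-- The values of the colimit of a tower. -/
def Tower.Colimit.eval {t : Tower u α} (c : t.Colimit) (j : J) : (t.eval j).Colimit where
  P := c.P.obj j
  ι n := (c.ι n).app j
  i_ι n := congr_app (c.i_ι n) j
  exists_desc f h := c.map_exists_desc ((evaluation J E).obj j) f h
  hom_ext h := c.map_hom_ext ((evaluation J E).obj j) h
  act := c.act.app j
  actY := c.actY.app j
  ι_act n := congr_app (c.ι_act n) j
  ι_actY n := congr_app (c.ι_actY n) j

end Evaluation

/-! ### Families of extensions -/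

/-- A family of data for extensions of monoids. -/
structure Family (J : Type*) [Category* J] (E : Type*) [Category* E] [MonoidalCategory E] where
  /-- the monoids -/
  R : J ⥤ Mon E
  /-- the objects of generators that are already present -/
  X : J ⥤ E
  /-- the objects of generators -/
  Y : J ⥤ E
  /-- the maps between generators -/
  u : X ⟶ Y
  /-- the attaching maps -/
  α : X ⟶ R ⋙ Mon.forget E

namespace Family

variable {J : Type*} [Category* J] {E : Type*} [Category* E] [MonoidalCategory E]
  (D : Family J E)

attribute [local instance] functorMonObj

variable [HasPushouts E] [HasInitial E] [HasColimitsOfShape ℕ E]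
  [TensorPreservesColimits WalkingSpan E] [TensorPreservesColimits (Discrete PEmpty.{1}) E]
  [TensorPreservesColimits ℕ E]

/-- The tower of a family. -/
def tower : Tower D.u D.α := Tower.mk' D.u D.α

/-- The colimit of the tower of a family. -/
def colim : D.tower.Colimit := Tower.Colimit.ofIsColimit _ (colimit.isColimit D.tower.seq)

/-- The monoid structure on the colimit. -/
@[reducible]
def monObj : MonObj D.colim.P := D.colim.isFree.monObj

/-- The extended monoids. -/
def ext : J ⥤ Mon E :=
  letI := D.monObj
  monFunctor D.colim.P

/-- The maps from the monoids to the extended monoids. -/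
def inl : D.R ⟶ D.ext :=
  letI := D.monObj
  have h : D.colim.module.IsCompatible D.colim.one := ⟨rfl, D.colim.isFree.isHom_mul⟩
  have := h.isMonHom_inl
  { app j :=
      { hom := (D.colim.module.inl D.colim.one).app j
        isMonHom_hom :=
          { one_hom := congr_app (IsMonHom.one_hom (D.colim.module.inl D.colim.one)) j
            mul_hom := congr_app (IsMonHom.mul_hom (D.colim.module.inl D.colim.one)) j } }
    naturality i j f := by
      ext
      exact (D.colim.module.inl D.colim.one).naturality f }

/-- The maps from the generators to the extended monoids. -/
def inr : D.Y ⟶ D.ext ⋙ Mon.forget E where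
  app j := (D.colim.module.inr D.colim.one).app j
  naturality _ _ f := (D.colim.module.inr D.colim.one).naturality f

/-- The tower at an object. -/
def towerAt (j : J) : Tower (R := (D.R.obj j).X) (D.u.app j) (D.α.app j) := D.tower.eval j

/-- The colimit at an object. -/
def colimAt (j : J) : (D.towerAt j).Colimit := D.colim.eval j

/-- The multiplication was chosen by freeness in the functor category, while its universal property
is needed in `E`. Compatibility passes to values, and freeness of the value holds because it is
itself the colimit of a tower. -/
lemma isCompatible (j : J) :
    ExtModule.IsCompatible (P := (D.ext.obj j).X) (D.colimAt j).module (D.colimAt j).one where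
  one_eq := rfl
  isHom_mul :=
    { act := congr_app D.colim.isFree.isHom_mul.act j
      actY := congr_app D.colim.isFree.isHom_mul.actY j }

lemma condition (j : J) : D.α.app j ≫ (D.inl.app j).hom = D.u.app j ≫ D.inr.app j :=
  (D.colimAt j).module.inl_inr _

lemma exists_desc (j : J) {N : Mon E} (f : D.R.obj j ⟶ N) (g : D.Y.obj j ⟶ N.X)
    (w : D.α.app j ≫ f.hom = D.u.app j ≫ g) :
    ∃ φ : D.ext.obj j ⟶ N, D.inl.app j ≫ φ = f ∧ D.inr.app j ≫ φ.hom = g := by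
  obtain ⟨φ, h₁, h₂, h₃⟩ := ExtModule.IsFree.exists_monHom (D.isCompatible j)
    (D.colimAt j).isFree f.hom g w
  exact ⟨⟨φ⟩, by ext; exact h₂, h₃⟩

lemma hom_ext (j : J) {N : Mon E} {φ ψ : D.ext.obj j ⟶ N}
    (hl : D.inl.app j ≫ φ = D.inl.app j ≫ ψ)
    (hr : D.inr.app j ≫ φ.hom = D.inr.app j ≫ ψ.hom) : φ = ψ := by
  ext
  exact ExtModule.IsFree.monHom_ext (D.isCompatible j) (D.colimAt j).isFree
    (congrArg Mon.Hom.hom hl) hr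

/-- The filtrations of the extended monoids. -/
def seq : J ⥤ ℕ ⥤ E := D.tower.seq.flip

/-- The maps from the filtrations to the extended monoids. -/
def toExt : D.seq ⟶ D.ext ⋙ Mon.forget E ⋙ Functor.const ℕ where
  app j :=
    { app n := (D.colim.ι n).app j
      naturality m n f := congr_app (D.colim.cocone.ι.naturality f) j }
  naturality i j f := by
    ext n
    exact (D.colim.ι n).naturality f

/-- The extended monoids are the colimits of the filtrations. -/
def isColimitToExt (j : J) : IsColimit (Cocone.mk (D.ext.obj j).X (D.toExt.app j)) :=
  isColimitOfPreserves ((evaluation J E).obj j) D.colim.isColimit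

/-- The filtrations start with the given monoids. -/
def zeroIso : D.seq ⋙ (evaluation ℕ E).obj 0 ≅ D.R ⋙ Mon.forget E := D.tower.e.symm

lemma zeroIso_inv_toExt (j : J) :
    D.zeroIso.inv.app j ≫ (D.toExt.app j).app 0 = (D.inl.app j).hom :=
  (D.colimAt j).module_inl.symm

omit [HasColimitsOfShape ℕ E] [TensorPreservesColimits ℕ E] in
lemma seq_map (j : J) (n : ℕ) :
    (D.seq.obj j).map (homOfLE (Nat.le_succ n)) = (D.towerAt j).i (n + 1) :=
  congr_app (D.tower.seq_map_succ n) j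

end Family

end MonoidExtension

end

noncomputable section

/-! ### The filtration of free extensions of monoids -/

lemma isPushout_of_exists {C : Type*} [Category* C] {X Y Z P : C} {f : X ⟶ Y} {g : X ⟶ Z}
    {h : Y ⟶ P} {k : Z ⟶ P} (w : f ≫ h = g ≫ k)
    (exists_desc : ∀ {T : C} (a : Y ⟶ T) (b : Z ⟶ T), f ≫ a = g ≫ b →
      ∃ l : P ⟶ T, h ≫ l = a ∧ k ≫ l = b)
    (hom_ext : ∀ {T : C} {l l' : P ⟶ T}, h ≫ l = h ≫ l' → k ≫ l = k ≫ l' → l = l') :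
    IsPushout f g h k where
  w := w
  isColimit' := ⟨PushoutCocone.IsColimit.mk w
    (fun s => (exists_desc s.inl s.inr s.condition).choose)
    (fun s => (exists_desc s.inl s.inr s.condition).choose_spec.1)
    (fun s => (exists_desc s.inl s.inr s.condition).choose_spec.2)
    (fun s _ h₁ h₂ => hom_ext
      (h₁.trans (exists_desc s.inl s.inr s.condition).choose_spec.1.symm)
      (h₂.trans (exists_desc s.inl s.inr s.condition).choose_spec.2.symm))⟩

namespace MonoidExtension

variable (E : Type u) [Category.{v} E] [HasColimits E] [MonoidalCategory E] [SymmetricCategory E]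
  [MonoidalClosed E]

/-- The comparison functor from monoids to algebras over the free monoid monad. -/
def comparison : Mon E ⥤ (freeMonoidMonad E).Algebra :=
  Monad.comparison (FreeMonoidObject.adj E)

instance : (comparison E).IsEquivalence := isEquivalence_comparison E

/-- The monoid corresponding to an algebra over the free monoid monad. -/
def ofAlgebra : (freeMonoidMonad E).Algebra ⥤ Mon E := (comparison E).inv

/-- Data for extensions of algebras over the free monoid monad. -/
abbrev Data := ExtensionData (freeMonoidMonad E)

variable {E}

/-- An algebra is isomorphic to the one given by the corresponding monoid. -/
def algebraIso (A : (freeMonoidMonad E).Algebra) :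
    A ≅ (comparison E).obj ((ofAlgebra E).obj A) :=
  ((comparison E).asEquivalence.counitIso.app A).symm

lemma algebraIso_naturality {A B : (freeMonoidMonad E).Algebra} (f : A ⟶ B) :
    f ≫ (algebraIso B).hom = (algebraIso A).hom ≫ (comparison E).map ((ofAlgebra E).map f) :=
  (comparison E).asEquivalence.counitIso.inv.naturality f

/-- The underlying object of an algebra is isomorphic to that of the corresponding monoid. -/
def underlyingIso (A : (freeMonoidMonad E).Algebra) :
    (freeMonoidMonad E).forget.obj A ≅ ((ofAlgebra E).obj A).X :=
  (freeMonoidMonad E).forget.mapIso (algebraIso A)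

lemma underlyingIso_naturality {A B : (freeMonoidMonad E).Algebra} (f : A ⟶ B) :
    (freeMonoidMonad E).forget.map f ≫ (underlyingIso B).hom =
      (underlyingIso A).hom ≫ ((ofAlgebra E).map f).hom :=
  ((freeMonoidMonad E).forget.map_comp _ _).symm.trans
    ((congrArg (freeMonoidMonad E).forget.map (algebraIso_naturality f)).trans
      ((freeMonoidMonad E).forget.map_comp _ _))

/-- The attaching map, with the free algebra given by the free monoid. -/
def algebraAttach (d : Data E) :
    (comparison E).obj ((FreeMonoidObject.free E).obj d.left.left) ⟶ d.right := d.hom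

lemma algebraAttach_naturality {d d' : Data E} (f : d ⟶ d') :
    (comparison E).map ((FreeMonoidObject.free E).map f.left.left) ≫ algebraAttach d' =
    algebraAttach d ≫ f.right := f.w

/-- The attaching map of monoids of an extension. -/
def attach (d : Data E) : (FreeMonoidObject.free E).obj d.left.left ⟶ (ofAlgebra E).obj d.right :=
  (comparison E).preimage (algebraAttach d ≫ (algebraIso d.right).hom)

lemma comparison_attach (d : Data E) : (comparison E).map (attach d) =
    algebraAttach d ≫ (algebraIso d.right).hom := (comparison E).map_preimage _

lemma attach_naturality {d d' : Data E} (f : d ⟶ d') :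
    (FreeMonoidObject.free E).map f.left.left ≫ attach d' =
      attach d ≫ (ofAlgebra E).map f.right := by
  apply (comparison E).map_injective
  rw [Functor.map_comp, Functor.map_comp, comparison_attach, comparison_attach,
    reassoc_of% algebraAttach_naturality f, algebraIso_naturality, Category.assoc]

/-- The universal property of the free monoid. -/
def freeEquiv (X : E) (M : Mon E) : ((FreeMonoidObject.free E).obj X ⟶ M) ≃ (X ⟶ M.X) :=
  (FreeMonoidObject.adj E).homEquiv X M

lemma freeEquiv_comp {X : E} {M N : Mon E} (g : (FreeMonoidObject.free E).obj X ⟶ M) (φ : M ⟶ N) :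
    freeEquiv X N (g ≫ φ) = freeEquiv X M g ≫ φ.hom :=
  (FreeMonoidObject.adj E).homEquiv_naturality_right g φ

lemma freeEquiv_map_comp {X Y : E} {M : Mon E} (f : X ⟶ Y)
    (g : (FreeMonoidObject.free E).obj Y ⟶ M) :
    freeEquiv X M ((FreeMonoidObject.free E).map f ≫ g) = f ≫ freeEquiv Y M g :=
  (FreeMonoidObject.adj E).homEquiv_naturality_left f g

variable (E) in
/-- The family of all extensions. -/
def family : Family (Data E) E where
  R := Comma.snd _ _ ⋙ ofAlgebra E
  X := Comma.fst _ _ ⋙ Arrow.leftFunc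
  Y := Comma.fst _ _ ⋙ Arrow.rightFunc
  u := Functor.whiskerLeft _ Arrow.leftToRight
  α :=
    { app d := freeEquiv _ _ (attach d)
      naturality d d' f := by
        have := congrArg (freeEquiv _ _) (attach_naturality f)
        rw [freeEquiv_map_comp, freeEquiv_comp] at this
        exact this }

/-- The extended monoid. -/
def monExt (d : Data E) : Mon E := (family E).ext.obj d

/-- The inclusion into an extension of monoids. -/
def monInl (d : Data E) : (ofAlgebra E).obj d.right ⟶ monExt d :=
  (family E).inl.app d

/-- The map from the new generators. -/
def genInr (d : Data E) : d.left.right ⟶ (monExt d).X := (family E).inr.app d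

/-- The map of monoids from the free monoid on the new generators. -/
def monInr (d : Data E) : (FreeMonoidObject.free E).obj d.left.right ⟶ monExt d :=
  (freeEquiv _ _).symm (genInr d)

lemma freeEquiv_monInr (d : Data E) : freeEquiv _ _ (monInr d) = genInr d :=
  Equiv.apply_symm_apply _ _

lemma monExt_condition (d : Data E) :
    freeEquiv _ _ (attach d) ≫ (monInl d).hom = d.left.hom ≫ genInr d :=
  (family E).condition d

lemma monExt_exists_desc (d : Data E) {N : Mon E} (f : (ofAlgebra E).obj d.right ⟶ N)
    (g : d.left.right ⟶ N.X) (w : freeEquiv _ _ (attach d) ≫ f.hom = d.left.hom ≫ g) :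
    ∃ φ : monExt d ⟶ N, monInl d ≫ φ = f ∧ genInr d ≫ φ.hom = g :=
  (family E).exists_desc d f g w

lemma monExt_hom_ext (d : Data E) {N : Mon E} {φ ψ : monExt d ⟶ N}
    (hl : monInl d ≫ φ = monInl d ≫ ψ) (hr : genInr d ≫ φ.hom = genInr d ≫ ψ.hom) : φ = ψ :=
  (family E).hom_ext d hl hr

/-- Under the free monoid adjunction, cocones on the span of monoids are pairs of a monoid map on
`R` and a map on `Y` agreeing on `X`, so this is the universal property of the extension. -/
lemma isPushout_mon (d : Data E) :
    IsPushout (attach d) ((FreeMonoidObject.free E).map d.left.hom) (monInl d) (monInr d) := by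
  refine isPushout_of_exists ?_ (fun {N} f g w => ?_) (fun {N φ ψ} h₁ h₂ => ?_)
  · apply (freeEquiv _ _).injective
    rw [freeEquiv_comp, freeEquiv_map_comp, freeEquiv_monInr, monExt_condition]
  · have w := congrArg (freeEquiv _ _) w
    rw [freeEquiv_comp, freeEquiv_map_comp] at w
    obtain ⟨φ, h₁, h₂⟩ := monExt_exists_desc d f _ w
    refine ⟨φ, h₁, ?_⟩
    apply (freeEquiv _ _).injective
    rw [freeEquiv_comp, freeEquiv_monInr, h₂]
  · refine monExt_hom_ext d h₁ ?_
    rw [← freeEquiv_monInr, ← freeEquiv_comp, ← freeEquiv_comp, h₂]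

/-- The inclusion into an extension of algebras. -/
def algInl (d : Data E) : d.right ⟶ (comparison E).obj (monExt d) :=
  (algebraIso d.right).hom ≫ (comparison E).map (monInl d)

/-- The map of algebras from the free algebra on the new generators. -/
def algInr (d : Data E) : (freeMonoidMonad E).free.obj d.left.right ⟶
    (comparison E).obj (monExt d) :=
  (comparison E).map (monInr d)

lemma isPushout_alg (d : Data E) :
    IsPushout d.hom ((freeMonoidMonad E).free.map d.left.hom) (algInl d) (algInr d) :=
  ((isPushout_mon d).map (comparison E)).of_iso (Iso.refl _) (algebraIso d.right).symm (Iso.refl _)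
    (Iso.refl _) (by
      rw [comparison_attach, Category.assoc, Iso.symm_hom, Iso.hom_inv_id, Category.comp_id]
      exact (Category.id_comp _).symm) ((Category.comp_id _).trans (Category.id_comp _).symm)
    (by rw [algInl, Iso.symm_hom, Iso.inv_hom_id_assoc]; exact Category.comp_id _)
    ((Category.comp_id _).trans (Category.id_comp _).symm)

/-- The functoriality of the extended monoids. -/
def monExtMap {d d' : Data E} (f : d ⟶ d') : monExt d ⟶ monExt d' := (family E).ext.map f

lemma algInl_naturality {d d' : Data E} (f : d ⟶ d') :
    f.right ≫ algInl d' = algInl d ≫ (comparison E).map (monExtMap f) := by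
  have h : (ofAlgebra E).map f.right ≫ monInl d' = monInl d ≫ monExtMap f :=
    (family E).inl.naturality f
  rw [algInl, algInl, reassoc_of% algebraIso_naturality, ← Functor.map_comp, h, Functor.map_comp,
    Category.assoc]

lemma monInr_naturality {d d' : Data E} (f : d ⟶ d') :
    (FreeMonoidObject.free E).map f.left.right ≫ monInr d' = monInr d ≫ monExtMap f := by
  apply (freeEquiv _ _).injective
  rw [freeEquiv_map_comp, freeEquiv_comp, freeEquiv_monInr, freeEquiv_monInr]
  exact (family E).inr.naturality f

variable (E) in
/-- The filtration of the extensions of algebras over the free monoid monad. -/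
def filtration : ExtensionFiltration (freeMonoidMonad E) where
  ext := (family E).ext ⋙ comparison E
  inl :=
    { app d := algInl d
      naturality _ _ f := algInl_naturality f }
  inr :=
    { app d := algInr d
      naturality _ _ f := ((comparison E).map_comp _ _).symm.trans
        ((congrArg (comparison E).map (monInr_naturality f)).trans ((comparison E).map_comp _ _)) }
  isPushout d := isPushout_alg d
  seq := (family E).seq
  zeroIso := (family E).zeroIso ≪≫ NatIso.ofComponents
    (fun d => (underlyingIso d.right).symm) (fun {d d'} f => by
      apply (Iso.comp_inv_eq _).2
      refine Eq.trans ?_ (Category.assoc _ _ _).symm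
      refine ((Iso.inv_comp_eq _).2 ?_).symm
      exact underlyingIso_naturality f.right)
  toExt := (family E).toExt
  isColimit d := ⟨(family E).isColimitToExt d⟩
  fac d := by
    refine (Category.assoc _ _ _).trans ?_
    refine (congrArg ((underlyingIso d.right).hom ≫ ·) ((family E).zeroIso_inv_toExt d)).trans ?_
    exact ((freeMonoidMonad E).forget.map_comp (algebraIso d.right).hom
      ((comparison E).map (monInl d))).symm

/-- The tower of an extension. -/
def towerAt (d : Data E) : Tower (R := ((ofAlgebra E).obj d.right).X) d.left.hom
    (freeEquiv _ _ (attach d)) :=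
  (family E).towerAt d

/-- The shift by one arises because `obj 0` is initial and is dropped: stage `0` of the filtration
is `obj 1 ≅ R`. -/
lemma filtration_step (d : Data E) (n : ℕ) :
    (filtration E).step d n = (towerAt d).i (n + 1) :=
  (family E).seq_map d n

/-- A morphism of towers over a morphism `f` between the monoids. -/
structure Tower.Hom {V : Type*} [Category* V] [MonoidalCategory V] {R S X Y : V} [MonObj R]
    [MonObj S] {u : X ⟶ Y} {α : X ⟶ R} {β : X ⟶ S} (t : Tower u α) (t' : Tower u β)
    (f : R ⟶ S) where
  /-- the morphisms between the objects of the towers -/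
  φ (n : ℕ) : t.obj n ⟶ t'.obj n
  i_φ (n : ℕ) : t.i n ≫ φ (n + 1) = φ n ≫ t'.i n
  act_φ (n : ℕ) : t.act n ≫ φ (n + 1) = (φ (n + 1) ⊗ₘ f) ≫ t'.act n
  m_φ (n : ℕ) : t.m n ≫ φ (n + 1) = φ n ▷ Y ≫ t'.m n
  e_φ : t.e.hom ≫ φ 1 = f ≫ t'.e.hom
  α_f : α ≫ f = β

attribute [local instance] functorMonObj in
/-- The morphism of towers induced by a morphism of algebras. -/
def towerHom (d : Data E) {S : (freeMonoidMonad E).Algebra} (f : d.right ⟶ S) :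
    Tower.Hom (towerAt d) (towerAt (d.push f)) ((ofAlgebra E).map f).hom where
  φ n := ((family E).tower.obj n).map (d.toPush f)
  i_φ n := (((family E).tower.i n).naturality (d.toPush f)).symm
  act_φ n := (((family E).tower.act n).naturality (d.toPush f)).symm
  m_φ n := (((family E).tower.m n).naturality (d.toPush f)).symm.trans
    (congrArg (· ≫ _) (tensorHom_id _ _))
  e_φ := ((family E).tower.e.hom.naturality (d.toPush f)).symm
  α_f := ((family E).α.naturality (d.toPush f)).symm.trans (Category.id_comp _)

lemma filtration_induced (d : Data E) {S : (freeMonoidMonad E).Algebra} (f : d.right ⟶ S)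
    (n : ℕ) : (filtration E).induced d f n = (towerHom d f).φ (n + 1) := rfl

end MonoidExtension

end

noncomputable section

/-! ### Pushout-products -/

section PushoutProduct

variable {V : Type*} [Category* V] [MonoidalCategory V]

/-- The morphism `p` is a pushout-product of `f` and `g`. -/
def IsPushoutProduct {A B C D Q : V} (f : A ⟶ B) (g : C ⟶ D) (p : Q ⟶ B ⊗ D) : Prop :=
  ∃ (inl : A ⊗ D ⟶ Q) (inr : B ⊗ C ⟶ Q), IsPushout (A ◁ g) (f ▷ C) inl inr ∧
    inl ≫ p = f ▷ D ∧ inr ≫ p = B ◁ g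

/-- The pushout-product of two morphisms. -/
abbrev pprod [HasPushouts V] {A B C D : V} (f : A ⟶ B) (g : C ⟶ D) : Arrow V :=
  (Arrow.pushoutProduct.obj (Arrow.mk f)).obj (Arrow.mk g)

namespace IsPushoutProduct

variable {A B C D Q : V} {f : A ⟶ B} {g : C ⟶ D} {p : Q ⟶ B ⊗ D}

lemma of_pushoutObjObj (sq : (curriedTensor V).PushoutObjObj f g) : IsPushoutProduct f g sq.ι :=
  ⟨sq.inr, sq.inl, sq.isPushout.flip, sq.inr_ι, sq.inl_ι⟩

variable [HasPushouts V]

lemma pprod (f : A ⟶ B) (g : C ⟶ D) : IsPushoutProduct f g (pprod f g).hom :=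
  of_pushoutObjObj _

omit [HasPushouts V] in
lemma unique {Q' : V} {p' : Q' ⟶ B ⊗ D} (h : IsPushoutProduct f g p)
    (h' : IsPushoutProduct f g p') : Nonempty (Arrow.mk p ≅ Arrow.mk p') := by
  obtain ⟨inl, inr, h, h₁, h₂⟩ := h
  obtain ⟨inl', inr', h', h₁', h₂'⟩ := h'
  refine ⟨Arrow.isoMk (h.isoIsPushout _ _ h') (Iso.refl _) (h.hom_ext ?_ ?_)⟩
  · simp [h₁, h₁']
  · simp [h₂, h₂']

lemma arrowIso (h : IsPushoutProduct f g p) : Nonempty (Arrow.mk p ≅ _root_.pprod f g) :=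
  h.unique (pprod f g)

variable [TensorPreservesColimits WalkingSpan V]

omit [HasPushouts V] in
/-- Pushout-products are stable under cobase change. -/
lemma isPushout {A' B' Q' : V} {f' : A' ⟶ B'} {a : A ⟶ A'} {b : B ⟶ B'} {p' : Q' ⟶ B' ⊗ D}
    (sq : IsPushout f a b f') (h : IsPushoutProduct f g p) (h' : IsPushoutProduct f' g p') :
    ∃ c : Q ⟶ Q', IsPushout p c (b ▷ D) p' := by
  obtain ⟨inl, inr, h, h₁, h₂⟩ := h
  obtain ⟨inl', inr', h', h₁', h₂'⟩ := h'
  obtain ⟨c, hc₁, hc₂⟩ := h.exists_desc (a ▷ D ≫ inl') (b ▷ C ≫ inr') (by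
    rw [whisker_exchange_assoc, h'.w, ← comp_whiskerRight_assoc, ← comp_whiskerRight_assoc, sq.w])
  have sqC := MonoidExtension.isPushout_whiskerRight sq C
  have sqD := MonoidExtension.isPushout_whiskerRight sq D
  refine ⟨c, isPushout_of_exists (h.hom_ext ?_ ?_) (fun {T} x y w => ?_) (fun {T l l'} hl hl' => ?_)⟩
  · rw [reassoc_of% h₁, reassoc_of% hc₁, h₁', sqD.w]
  · rw [reassoc_of% h₂, reassoc_of% hc₂, h₂', whisker_exchange]
  · obtain ⟨l, hl₁, hl₂⟩ := sqD.exists_desc x (inl' ≫ y) (by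
      rw [← h₁, Category.assoc, w, reassoc_of% hc₁])
    refine ⟨l, hl₁, h'.hom_ext ?_ (sqC.hom_ext ?_ ?_)⟩
    · rw [reassoc_of% h₁', hl₂]
    · rw [reassoc_of% h₂', ← whisker_exchange_assoc, hl₁, ← h₂, Category.assoc, w,
        reassoc_of% hc₂]
    · rw [reassoc_of% h₂', ← whisker_exchange_assoc, hl₂, reassoc_of% h'.w]
  · refine sqD.hom_ext hl ?_
    rw [← h₁', Category.assoc, Category.assoc, hl']

omit [HasPushouts V] in
lemma whiskerRight (h : IsPushoutProduct f g p) (Z : V) :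
    IsPushoutProduct f (g ▷ Z) (p ▷ Z ≫ (α_ _ _ _).hom) := by
  obtain ⟨inl, inr, h, h₁, h₂⟩ := h
  refine ⟨(α_ _ _ _).inv ≫ inl ▷ Z, (α_ _ _ _).inv ≫ inr ▷ Z, ?_, ?_, ?_⟩
  · exact (MonoidExtension.isPushout_whiskerRight h Z).of_iso (α_ _ _ _) (α_ _ _ _) (α_ _ _ _)
      (Iso.refl _) (by simp) (by simp) (by simp) (by simp)
  · rw [Category.assoc, ← comp_whiskerRight_assoc, h₁]
    simp
  · rw [Category.assoc, ← comp_whiskerRight_assoc, h₂]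
    simp

omit [HasPushouts V] [TensorPreservesColimits WalkingSpan V] in
lemma of_whiskerRight_left {Z : V} {p : Q ⟶ (B ⊗ Z) ⊗ D} (h : IsPushoutProduct (f ▷ Z) g p) :
    IsPushoutProduct f (Z ◁ g) (p ≫ (α_ _ _ _).hom) := by
  obtain ⟨inl, inr, h, h₁, h₂⟩ := h
  refine ⟨(α_ _ _ _).inv ≫ inl, (α_ _ _ _).inv ≫ inr, ?_, ?_, ?_⟩
  · exact h.of_iso (α_ _ _ _) (α_ _ _ _) (α_ _ _ _)
      (Iso.refl _) (by simp) (by simp) (by simp) (by simp)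
  · rw [Category.assoc, reassoc_of% h₁]
    simp
  · rw [Category.assoc, reassoc_of% h₂]
    simp

omit [HasPushouts V] [TensorPreservesColimits WalkingSpan V] in
/-- The pushout-product with a map from an initial object. -/
lemma of_isInitial [TensorPreservesColimits (Discrete PEmpty.{1}) V] {I Z : V} (hI : IsInitial I)
    (i : I ⟶ Z) (g : C ⟶ D) : IsPushoutProduct i g (Z ◁ g) := by
  refine ⟨(MonoidExtension.isInitialTensorRight hI D).to _, 𝟙 _, ?_,
    (MonoidExtension.isInitialTensorRight hI D).hom_ext _ _, Category.id_comp _⟩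
  have : IsIso (I ◁ g) := isIso_of_isInitial (MonoidExtension.isInitialTensorRight hI C)
    (MonoidExtension.isInitialTensorRight hI D) _
  exact IsPushout.of_horiz_isIso ⟨(MonoidExtension.isInitialTensorRight hI C).hom_ext _ _⟩

end IsPushoutProduct

end PushoutProduct

/-! ### Pushout-products with the steps of a tower -/

namespace MonoidExtension.Tower

variable {V : Type*} [Category* V] [MonoidalCategory V] {R X Y : V} [MonObj R] {u : X ⟶ Y}
  {α : X ⟶ R} (t : Tower u α)

lemma isPushoutProduct_q (n : ℕ) : IsPushoutProduct (t.i n) u (t.q n) :=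
  ⟨t.Qinl n, t.Qinr n, t.isPushoutQ n, t.Qinl_q n, t.Qinr_q n⟩

variable [HasPushouts V] [TensorPreservesColimits WalkingSpan V]
  [TensorPreservesColimits (Discrete PEmpty.{1}) V] {C L : MorphismProperty V}
  [L.IsStableUnderCobaseChange]

/-- Write `□` for the pushout-product. As `i (n + 1)` is a cobase change of `(i n □ u) ▷ R`, the map
`i (n + 1) □ w` is a cobase change of `((i n □ u) ▷ R) □ w ≅ i n □ (u □ (R ◁ w))`, and `u □ (R ◁ w)`
is again in `C`. The induction must therefore range over all `w`. It starts with `i 0 □ w ≅ R ◁ w`,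
the source of `i 0` being initial. -/
lemma pprod_i_mem (hCL : C ≤ L) (hR : ∀ {A B : V} (w : A ⟶ B), C w → C (R ◁ w))
    (hu : ∀ {A B : V} (w : A ⟶ B), C w → C (pprod u w).hom) (n : ℕ) {A B : V} (w : A ⟶ B)
    (hw : C w) : L (pprod (t.i n) w).hom := by
  induction n generalizing A B w with
  | zero =>
    have h₁ := (IsPushoutProduct.of_isInitial t.isInitial (t.i 0) w).arrowIso
    have h₂ : Arrow.mk (t.obj 1 ◁ w) ≅ Arrow.mk (R ◁ w) :=
      Arrow.isoMk (whiskerRightIso t.e.symm _) (whiskerRightIso t.e.symm _) (by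
        simp [whisker_exchange])
    refine (L.arrow_iso_iff (h₁.some.symm ≪≫ h₂)).2 (hCL _ (hR w hw))
  | succ n ih =>
    obtain ⟨c, hc⟩ := IsPushoutProduct.isPushout (t.isPushout n)
      (IsPushoutProduct.pprod (t.q n ▷ R) w) (IsPushoutProduct.pprod (t.i (n + 1)) w)
    refine MorphismProperty.of_isPushout hc.flip ?_
    have h₁ := (IsPushoutProduct.pprod (t.q n ▷ R) w).of_whiskerRight_left.arrowIso
    have h₂ : Arrow.mk (pprod (t.q n ▷ R) w).hom ≅
        Arrow.mk ((pprod (t.q n ▷ R) w).hom ≫ (α_ _ _ _).hom) :=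
      Arrow.isoMk (Iso.refl _) (α_ _ _ _) (by simp)
    have h₃ : pprod (t.q n) (R ◁ w) ≅
      (Arrow.pushoutProduct.obj (pprod (t.i n) u)).obj (Arrow.mk (R ◁ w)) :=
      (Arrow.pushoutProduct.mapIso (t.isPushoutProduct_q n).arrowIso.some).app _
    have h₄ := Arrow.PushoutProduct.associator (Arrow.mk (t.i n)) (Arrow.mk u) (Arrow.mk (R ◁ w))
    exact (L.arrow_iso_iff (h₂ ≪≫ h₁.some ≪≫ h₃ ≪≫ h₄)).2 (ih _ (hu _ (hR _ hw)))

/-- Tensoring can be moved to one factor: `q n ▷ R` is the pushout-product of `i n` and `u ▷ R`, so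
`pprod_i_mem` applies, and `i (n + 1)` is a cobase change of it. -/
lemma i_mem (hCL : C ≤ L) (hR : ∀ {A B : V} (w : A ⟶ B), C w → C (R ◁ w))
    (hu : ∀ {A B : V} (w : A ⟶ B), C w → C (pprod u w).hom) (huR : C (u ▷ R)) (n : ℕ) :
    L (t.q n ▷ R) ∧ L (t.i (n + 1)) := by
  have h : L (t.q n ▷ R) := by
    have h₁ := ((t.isPushoutProduct_q n).whiskerRight R).arrowIso
    have h₂ : Arrow.mk (t.q n ▷ R) ≅ Arrow.mk (t.q n ▷ R ≫ (α_ _ _ _).hom) :=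
      Arrow.isoMk (Iso.refl _) (α_ _ _ _) (by simp)
    exact (L.arrow_iso_iff (h₂ ≪≫ h₁.some)).2 (t.pprod_i_mem hCL hR hu n _ huR)
  exact ⟨h, MorphismProperty.of_isPushout (t.isPushout n).flip h⟩

end MonoidExtension.Tower

end

noncomputable section

/-! ### The maps of the filtration -/

set_option linter.unusedSectionVars false

section HCofibrations

variable {E : Type u} [Category.{v} E]

/-- The class of `h`-cofibrations. -/
def hCofibrations (W : MorphismProperty E) : MorphismProperty E := fun _ _ f => IsHCofibration W f

instance (W : MorphismProperty E) : (hCofibrations W).IsStableUnderCobaseChange where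
  of_isPushout sq h _ _ _ _ _ w a b _ w' s s' hw :=
    h _ w a b _ w' (sq.paste_horiz s) s' hw

/-- Weak equivalences are stable under cobase change along `h`-cofibrations. -/
lemma IsHCofibration.of_isPushout {W : MorphismProperty E} {X Y A B : E} {i : X ⟶ Y} {w : X ⟶ A}
    {w' : Y ⟶ B} {j : A ⟶ B} (hi : IsHCofibration W i) (sq : IsPushout i w w' j) (hw : W w) :
    W w' :=
  hi (𝟙 _) w i j (𝟙 _) w' (IsPushout.of_horiz_isIso ⟨by simp⟩) sq.flip hw

/-- The class of morphisms all whose cobase changes belong to `W`. -/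
def universally (W : MorphismProperty E) : MorphismProperty E := fun X Y f =>
  ∀ ⦃X' Y' : E⦄ (a : X ⟶ X') (b : Y ⟶ Y') (f' : X' ⟶ Y'), IsPushout a f f' b → W f'

lemma universally_le (W : MorphismProperty E) : universally W ≤ W :=
  fun _ _ f h => h (𝟙 _) (𝟙 _) f (IsPushout.of_horiz_isIso ⟨by simp⟩)

instance (W : MorphismProperty E) : (universally W).IsStableUnderCobaseChange where
  of_isPushout sq h _ _ _ _ f' s := h _ _ f' (sq.paste_horiz s)

end HCofibrations

section Tensored

variable {E : Type u} [Category.{v} E] [MonoidalCategory E]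

/-- The morphisms isomorphic to the tensor product of a morphism in `K` and an object. -/
def tensored (K : MorphismProperty E) : MorphismProperty E := fun _ _ w =>
  ∃ (A B : E) (c : A ⟶ B) (Z : E), K c ∧ Nonempty (Arrow.mk w ≅ Arrow.mk (c ▷ Z))

lemma tensored_whiskerRight {K : MorphismProperty E} {A B : E} {c : A ⟶ B} (hc : K c) (Z : E) :
    tensored K (c ▷ Z) :=
  ⟨A, B, c, Z, hc, ⟨Iso.refl _⟩⟩

lemma tensored_le {K L : MorphismProperty E} [L.RespectsIso]
    (h : ∀ {A B : E} (c : A ⟶ B) (Z : E), K c → L (c ▷ Z)) : tensored K ≤ L := by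
  rintro _ _ _ ⟨A, B, c, Z, hc, ⟨e⟩⟩
  exact (L.arrow_mk_iso_iff e).2 (h c Z hc)

lemma tensored_whiskerLeft [BraidedCategory E] {K : MorphismProperty E} (R : E) {A B : E}
    {w : A ⟶ B} (hw : tensored K w) : tensored K (R ◁ w) := by
  obtain ⟨A', B', c, Z, hc, ⟨e⟩⟩ := hw
  refine ⟨A', B', c, Z ⊗ R, hc, ⟨?_⟩⟩
  have e₁ : Arrow.mk (R ◁ w) ≅ Arrow.mk (w ▷ R) := Arrow.isoMk (β_ _ _) (β_ _ _) (by simp)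
  have e₂ : Arrow.mk (w ▷ R) ≅ Arrow.mk (c ▷ Z ▷ R) := (tensorRight R).mapArrow.mapIso e
  have e₃ : Arrow.mk (c ▷ Z ▷ R) ≅ Arrow.mk (c ▷ (Z ⊗ R)) :=
    Arrow.isoMk (α_ _ _ _) (α_ _ _ _) (by simp)
  exact e₁ ≪≫ e₂ ≪≫ e₃

/-- The pushout-product of `u` with `c ▷ Z` is that of `u` with `c`, tensored with `Z`. -/
lemma tensored_pprod [HasPushouts E] [TensorPreservesColimits WalkingSpan E]
    {K : MorphismProperty E} {X Y : E} {u : X ⟶ Y}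
    (hK : ∀ {A B : E} (c : A ⟶ B), K c → K (pprod u c).hom) {A B : E}
    {w : A ⟶ B} (hw : tensored K w) : tensored K (pprod u w).hom := by
  obtain ⟨A', B', c, Z, hc, ⟨e⟩⟩ := hw
  refine ⟨_, _, (pprod u c).hom, Z, hK c hc, ⟨?_⟩⟩
  have e₁ : pprod u w ≅ pprod u (c ▷ Z) := (Arrow.pushoutProduct.obj (Arrow.mk u)).mapIso e
  have e₂ := ((IsPushoutProduct.pprod u c).whiskerRight Z).arrowIso.some
  have e₃ : Arrow.mk ((pprod u c).hom ▷ Z) ≅ Arrow.mk ((pprod u c).hom ▷ Z ≫ (α_ _ _ _).hom) :=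
    Arrow.isoMk (Iso.refl _) (α_ _ _ _) (by simp)
  exact e₁ ≪≫ e₂.symm ≪≫ e₃.symm

lemma le_monoidalSaturation (K : MorphismProperty E) : K ≤ monoidalSaturation K :=
  le_sInf fun _ hL => hL.1

lemma monoidalSaturation_le {K L : MorphismProperty E} (h : K ≤ L) (hL : IsMonoidallySaturated L) :
    monoidalSaturation K ≤ L :=
  sInf_le ⟨h, hL⟩

lemma monoidalSaturation_iff {K : MorphismProperty E} {X Y : E} (f : X ⟶ Y) :
    monoidalSaturation K f ↔ ∀ L, K ≤ L → IsMonoidallySaturated L → L f :=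
  ⟨fun h _ h₁ h₂ => monoidalSaturation_le h₁ h₂ _ h, fun h => by
    simp only [monoidalSaturation, MorphismProperty.sInf_iff]
    exact fun L hL => h L hL.1 hL.2⟩

lemma isMonoidallySaturated_monoidalSaturation (K : MorphismProperty E) :
    IsMonoidallySaturated (monoidalSaturation K) where
  cobaseChange :=
    { of_isPushout sq h := (monoidalSaturation_iff _).2 fun L h₁ h₂ =>
        h₂.cobaseChange.of_isPushout sq ((monoidalSaturation_iff _).1 h L h₁ h₂) }
  transfinite := ⟨fun J _ _ _ _ => ⟨fun _ _ f hf => by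
    refine (monoidalSaturation_iff _).2 fun L h₁ h₂ => ?_
    have := h₂.transfinite
    exact L.transfiniteCompositionsOfShape_le J _
      (MorphismProperty.transfiniteCompositionsOfShape_monotone J
        (monoidalSaturation_le h₁ h₂) _ hf)⟩⟩
  retracts :=
    { of_retract r h := (monoidalSaturation_iff _).2 fun L h₁ h₂ =>
        h₂.retracts.of_retract r ((monoidalSaturation_iff _).1 h L h₁ h₂) }
  tensor f Z h := (monoidalSaturation_iff _).2 fun L h₁ h₂ =>
    h₂.tensor f Z ((monoidalSaturation_iff _).1 h L h₁ h₂)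

instance (K : MorphismProperty E) : (monoidalSaturation K).IsStableUnderCobaseChange :=
  (isMonoidallySaturated_monoidalSaturation K).cobaseChange

instance (K : MorphismProperty E) :
    MorphismProperty.IsStableUnderTransfiniteComposition.{v} (monoidalSaturation K) :=
  (isMonoidallySaturated_monoidalSaturation K).transfinite

end Tensored

section Model

variable {E : Type u} [Category.{v} E] [HasColimits E] [MonoidalCategory E] [SymmetricCategory E]
  [MonoidalClosed E] [ModelCategory E]

instance : (tensorCofibrations E).IsStableUnderCobaseChange :=
  inferInstanceAs (monoidalSaturation _).IsStableUnderCobaseChange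

instance : MorphismProperty.IsStableUnderTransfiniteComposition.{v} (tensorCofibrations E) :=
  inferInstanceAs (MorphismProperty.IsStableUnderTransfiniteComposition.{v} (monoidalSaturation _))

namespace IsHMonoidal

variable (h : IsHMonoidal E)

include h

lemma isHCofibration {X Y : E} (f : X ⟶ Y) (hf : Cofibration f) :
    IsHCofibration (weakEquivalences E) f := by
  have e : Arrow.mk (f ▷ 𝟙_ E) ≅ Arrow.mk f := Arrow.isoMk (ρ_ _) (ρ_ _) (by simp)
  exact ((hCofibrations (weakEquivalences E)).arrow_mk_iso_iff e).1 (h.hCofibration f _ hf)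

/-- Factor the map along which `f` is pushed out as a cofibration followed by a trivial fibration.
Over the cofibration, which is an `h`-cofibration, the weak equivalence `f` yields a weak
equivalence; over the trivial fibration, use that `f` is an `h`-cofibration. Conclude by
two-out-of-three. -/
lemma universally_weakEquivalences {X Y : E} (f : X ⟶ Y)
    (hf : IsHCofibration (weakEquivalences E) f) (hf' : weakEquivalences E f) :
    universally (weakEquivalences E) f := by
  intro A B a b f' sq
  let F := MorphismProperty.factorizationData (cofibrations E) (trivialFibrations E) a
  have sq₁ : IsPushout F.i f (pushout.inl F.i f) (pushout.inr F.i f) := IsPushout.of_hasPushout _ _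
  have h₁ : weakEquivalences E (pushout.inl F.i f) :=
    (h.isHCofibration _ ⟨F.hi⟩).of_isPushout sq₁ hf'
  have sq' : IsPushout (F.i ≫ F.p) f f' b := by rw [F.fac]; exact sq
  have sq₂ := IsPushout.of_left' sq' sq₁
  have h₂ := hf F.i F.p _ _ _ _ sq₁ sq₂ F.hp.2
  have h₃ : weakEquivalences E (F.p ≫ f') := by
    rw [sq₂.w]
    exact (weakEquivalences E).comp_mem _ _ h₁ h₂
  exact (weakEquivalences E).of_precomp _ _ F.hp.2 h₃

end IsHMonoidal

namespace MonoidExtension.Tower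

variable {R X Y : E} [MonObj R] {u : X ⟶ Y} {α : X ⟶ R} (t : Tower u α)
  (hE : IsMonoidalModelCategory E)

include hE

lemma _root_.IsMonoidalModelCategory.cofibrations_pprod {A B C D : E} {f : A ⟶ B} {g : C ⟶ D}
    (hf : cofibrations E f) (hg : cofibrations E g) : cofibrations E (pprod f g).hom :=
  (hE.cofibration f g (.ofHasPushout _ _ _) ⟨hf⟩ ⟨hg⟩).mem

lemma _root_.IsMonoidalModelCategory.trivialCofibrations_pprod {A B C D : E} {f : A ⟶ B}
    {g : C ⟶ D} (hf : cofibrations E f) (hg : trivialCofibrations E g) :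
    trivialCofibrations E (pprod f g).hom :=
  ⟨hE.cofibrations_pprod hf hg.1,
    (hE.weakEquivalence_right f g (.ofHasPushout _ _ _) ⟨hf⟩ ⟨hg.1⟩ ⟨hg.2⟩).mem⟩

/-- Extensions along cofibrations. -/
lemma mem_of_cofibrations {L : MorphismProperty E} [L.IsStableUnderCobaseChange]
    (hL : ∀ {A B : E} (c : A ⟶ B) (Z : E), cofibrations E c → L (c ▷ Z))
    (hu : cofibrations E u) (n : ℕ) : L (t.q n ▷ R) ∧ L (t.i (n + 1)) :=
  t.i_mem (C := tensored (cofibrations E)) (tensored_le hL)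
    (fun _ hw => tensored_whiskerLeft R hw)
    (fun _ hw => tensored_pprod (fun _ hc => hE.cofibrations_pprod hu hc) hw)
    (tensored_whiskerRight hu R) n

/-- Extensions along trivial cofibrations. -/
lemma mem_of_trivialCofibrations {L : MorphismProperty E} [L.IsStableUnderCobaseChange]
    (hL : ∀ {A B : E} (c : A ⟶ B) (Z : E), trivialCofibrations E c → L (c ▷ Z))
    (hu : trivialCofibrations E u) (n : ℕ) : L (t.q n ▷ R) ∧ L (t.i (n + 1)) :=
  t.i_mem (C := tensored (trivialCofibrations E)) (tensored_le hL)
    (fun _ hw => tensored_whiskerLeft R hw)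
    (fun _ hw => tensored_pprod (fun _ hc => hE.trivialCofibrations_pprod hu.1 hc) hw)
    (tensored_whiskerRight hu R) n

/-- `Z ◁ w` is the pushout-product of `∅ ⟶ Z` with `w`. -/
lemma _root_.IsMonoidalModelCategory.cofibrations_whiskerLeft (Z : E) (hZ : IsCofibrant Z)
    {A B : E} {w : A ⟶ B} (hw : cofibrations E w) : cofibrations E (Z ◁ w) :=
  ((cofibrations E).arrow_mk_iso_iff
    (IsPushoutProduct.of_isInitial initialIsInitial (initial.to Z) w).arrowIso.some).2
    (hE.cofibrations_pprod hZ.mem hw)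

lemma _root_.IsMonoidalModelCategory.trivialCofibrations_whiskerLeft (Z : E) (hZ : IsCofibrant Z)
    {A B : E} {w : A ⟶ B} (hw : trivialCofibrations E w) : trivialCofibrations E (Z ◁ w) :=
  ((trivialCofibrations E).arrow_mk_iso_iff
    (IsPushoutProduct.of_isInitial initialIsInitial (initial.to Z) w).arrowIso.some).2
    (hE.trivialCofibrations_pprod hZ.mem hw)

lemma _root_.IsMonoidalModelCategory.cofibrations_whiskerRight (Z : E) (hZ : IsCofibrant Z)
    {A B : E} {w : A ⟶ B} (hw : cofibrations E w) : cofibrations E (w ▷ Z) :=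
  ((cofibrations E).arrow_mk_iso_iff (Arrow.isoMk (β_ _ _) (β_ _ _) (by simp))).2
    (hE.cofibrations_whiskerLeft Z hZ hw)

/-- Extensions of monoids with cofibrant underlying objects along cofibrations. -/
lemma cofibrations_of_isCofibrant (hR : IsCofibrant R) (hu : cofibrations E u) (n : ℕ) :
    cofibrations E (t.q n ▷ R) ∧ cofibrations E (t.i (n + 1)) :=
  t.i_mem (C := cofibrations E) le_rfl (fun _ hw => hE.cofibrations_whiskerLeft R hR hw)
    (fun _ hw => hE.cofibrations_pprod hu hw) (hE.cofibrations_whiskerRight R hR hu) n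

end MonoidExtension.Tower

end Model

end

noncomputable section

/-! ### Gluing -/

lemma exists_isPushout {C : Type*} [Category* C] [HasPushouts C] {X Y Z : C} (f : X ⟶ Y)
    (g : X ⟶ Z) : ∃ (P : C) (inl : Y ⟶ P) (inr : Z ⟶ P), IsPushout f g inl inr :=
  ⟨_, _, _, IsPushout.of_hasPushout f g⟩

section Gluing

variable {E : Type u} [Category.{v} E] [ModelCategory E]

/-- Weak equivalences between objects which are cofibrant under `A` are preserved by cobase
change. -/
lemma weakEquivalences_cobaseChange_under {A A' C C' D D' : E} {i : A ⟶ C} {i' : A ⟶ C'}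
    {a : A ⟶ A'} {c : C ⟶ D} {d : A' ⟶ D} {c' : C' ⟶ D'} {d' : A' ⟶ D'}
    (sq : IsPushout i a c d) (sq' : IsPushout i' a c' d') (hi : cofibrations E i)
    (hi' : cofibrations E i') (h : C ⟶ C') (fac : i ≫ h = i') (hh : weakEquivalences E h)
    (k : D ⟶ D') (hk : c ≫ k = h ≫ c') (hk' : d ≫ k = d') : weakEquivalences E k := by
  -- A mapping cylinder of `h` relative to `A`: factoring `C ⊔_A C' ⟶ C'` makes `h` a trivial
  -- cofibration `j` followed by a retraction of a trivial cofibration `s`, all under `A`. Such a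
  -- factorisation survives cobase change along `a`.
  obtain ⟨P, x, y, sq₀⟩ := exists_isPushout i i'
  obtain ⟨r, hr₁, hr₂⟩ := sq₀.exists_desc h (𝟙 C') (by simpa using fac)
  let F := MorphismProperty.factorizationData (cofibrations E) (trivialFibrations E) r
  let j : C ⟶ F.Z := x ≫ F.i
  let s : C' ⟶ F.Z := y ≫ F.i
  have hj : cofibrations E j := (cofibrations E).comp_mem _ _
    (MorphismProperty.of_isPushout sq₀ hi') F.hi
  have hs : cofibrations E s := (cofibrations E).comp_mem _ _
    (MorphismProperty.of_isPushout sq₀.flip hi) F.hi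
  have jp : j ≫ F.p = h := by simp [j, hr₁]
  have sp : s ≫ F.p = 𝟙 _ := by simp [s, hr₂]
  have hj' : trivialCofibrations E j := ⟨hj, (weakEquivalences E).of_postcomp _ _ F.hp.2
    (by rw [jp]; exact hh)⟩
  have hs' : trivialCofibrations E s := ⟨hs, (weakEquivalences E).of_postcomp _ _ F.hp.2
    (by rw [sp]; exact MorphismProperty.id_mem _ _)⟩
  have ij : i ≫ j = i' ≫ s := by simp only [j, s, ← Category.assoc, sq₀.w]
  obtain ⟨Z, z, z', sqZ⟩ := exists_isPushout (i ≫ j) a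
  have sqZ' : IsPushout (i' ≫ s) a z z' := by rw [← ij]; exact sqZ
  obtain ⟨j', hj₁, hj₂⟩ := sq.exists_desc (j ≫ z) z' (by rw [← Category.assoc, sqZ.w])
  obtain ⟨s', hs₁, hs₂⟩ := sq'.exists_desc (s ≫ z) z' (by rw [← Category.assoc, sqZ'.w])
  have hjsq : IsPushout j c z j' :=
    IsPushout.of_left (by rw [hj₂]; exact sqZ) hj₁.symm sq
  have hssq : IsPushout s c' z s' :=
    IsPushout.of_left (by rw [hs₂]; exact sqZ') hs₁.symm sq'
  have hjw := (MorphismProperty.of_isPushout (P := trivialCofibrations E) hjsq.flip hj').2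
  have hsw := (MorphismProperty.of_isPushout (P := trivialCofibrations E) hssq.flip hs').2
  obtain ⟨p', hp₁, hp₂⟩ := sqZ.exists_desc (F.p ≫ c') d' (by
    rw [Category.assoc, reassoc_of% jp, reassoc_of% fac, sq'.w])
  have hsp : s' ≫ p' = 𝟙 _ := sq'.hom_ext
    (by rw [reassoc_of% hs₁, hp₁, reassoc_of% sp, Category.comp_id])
    (by rw [reassoc_of% hs₂, hp₂, Category.comp_id])
  have hpw : weakEquivalences E p' := (weakEquivalences E).of_precomp _ _ hsw
    (by rw [hsp]; exact MorphismProperty.id_mem _ _)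
  have hjk : j' ≫ p' = k := sq.hom_ext
    (by rw [reassoc_of% hj₁, hp₁, reassoc_of% jp, hk])
    (by rw [reassoc_of% hj₂, hp₂, hk'])
  rw [← hjk]
  exact (weakEquivalences E).comp_mem _ _ hjw hpw

/-- Weak equivalences between cofibrant objects are stable under cobase change along
cofibrations. -/
lemma weakEquivalences_of_isPushout_of_isCofibrant {X Y A B : E} {i : X ⟶ Y} {w : X ⟶ A}
    {w' : Y ⟶ B} {j : A ⟶ B} (sq : IsPushout i w w' j) (hi : cofibrations E i)
    (hw : weakEquivalences E w) (hX : IsCofibrant X) (hA : IsCofibrant A) :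
    weakEquivalences E w' := by
  -- Trivial cofibrations pose no problem, so only the cobase change `d` of `F.p`, a retraction of
  -- the trivial cofibration `F.s`, remains to be treated.
  have F : CofibrantBrownFactorization w := Classical.choice inferInstance
  have : WeakEquivalence w := ⟨hw⟩
  have hFi : trivialCofibrations E F.i := ⟨F.hi, (inferInstance : WeakEquivalence F.i).mem⟩
  have hFs : trivialCofibrations E F.s :=
    ⟨F.cofibration_s.mem, (inferInstance : WeakEquivalence F.s).mem⟩
  obtain ⟨C, c, i', sq₁⟩ := exists_isPushout i F.i
  have hc : weakEquivalences E c :=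
    (MorphismProperty.of_isPushout (P := trivialCofibrations E) sq₁ hFi).2
  have hi' : cofibrations E i' := MorphismProperty.of_isPushout sq₁.flip hi
  obtain ⟨d, hd₁, hd₂⟩ := sq₁.exists_desc w' (F.p ≫ j) (by rw [sq.w, F.fac_assoc])
  have sq₂ : IsPushout i' F.p d j :=
    (IsPushout.of_left (by rw [F.fac, hd₁]; exact sq.flip) hd₂.symm sq₁.flip).flip
  -- Restrict `C` along `F.s` and push it out again: this gives a weak equivalence `r : K ⟶ C` of
  -- objects cofibrant under `F.Z`. Cobase change of `r` along `F.p` is exactly `d`, since `F.s ≫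
  -- F.p` is the identity.
  obtain ⟨K, k, l, sqK⟩ := exists_isPushout (F.s ≫ i') F.s
  have hk : weakEquivalences E k :=
    (MorphismProperty.of_isPushout (P := trivialCofibrations E) sqK hFs).2
  have hl : cofibrations E l := MorphismProperty.of_isPushout sqK.flip
    ((cofibrations E).comp_mem _ _ hFs.1 hi')
  obtain ⟨r, hr₁, hr₂⟩ := sqK.exists_desc (𝟙 C) i' (by simp)
  have hr : weakEquivalences E r := (weakEquivalences E).of_precomp _ _ hk
    (by rw [hr₁]; exact MorphismProperty.id_mem _ _)
  obtain ⟨q, hq₁, hq₂⟩ := sqK.exists_desc (𝟙 C) (F.p ≫ F.s ≫ i') (by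
    rw [Category.comp_id, F.s_p_assoc])
  have sqL : IsPushout l F.p q (F.s ≫ i') := by
    refine (IsPushout.of_left (h₁₁ := F.s) (v₁₁ := F.s ≫ i') (h₂₁ := k) ?_ hq₂.symm sqK.flip).flip
    rw [F.s_p, hq₁]
    exact IsPushout.of_horiz_isIso ⟨by simp⟩
  have hd : weakEquivalences E d := by
    refine weakEquivalences_cobaseChange_under sqL sq₂ hl hi' r hr₂ hr d
      (sqK.hom_ext ?_ ?_) ?_
    · rw [reassoc_of% hq₁, reassoc_of% hr₁]
    · rw [reassoc_of% hq₂, reassoc_of% hr₂, sq₂.w, F.s_p_assoc]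
    · rw [Category.assoc, sq₂.w, F.s_p_assoc]
  rw [← hd₁]
  exact (weakEquivalences E).comp_mem _ _ hc hd

/-- A class `Q` of objects and a class `H` of morphisms which behave like the cofibrant objects
and the cofibrations. -/
structure GluingContext (Q : ObjectProperty E) (H : MorphismProperty E) : Prop where
  cobaseChange : H.IsStableUnderCobaseChange
  cofibrations_le : cofibrations E ≤ H
  target {A B : E} (f : A ⟶ B) : H f → Q A → Q B
  initial : Q (⊥_ E)
  proper {X Y A B : E} {i : X ⟶ Y} {w : X ⟶ A} {w' : Y ⟶ B} {j : A ⟶ B} :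
    IsPushout i w w' j → H i → weakEquivalences E w → Q X → Q A → weakEquivalences E w'

namespace GluingContext

variable {Q : ObjectProperty E} {H : MorphismProperty E} (h : GluingContext Q H)

include h

lemma target_iso {A B : E} (e : A ≅ B) (hA : Q A) : Q B :=
  h.target e.hom (h.cofibrations_le _ (inferInstance : Cofibration e.hom).mem) hA

lemma of_isInitial {I : E} (hI : IsInitial I) : Q I :=
  h.target_iso (initialIsInitial.uniqueUpToIso hI) h.initial

/-- The gluing lemma. -/
lemma gluing {A B C P A' B' C' P' : E} {f : A ⟶ B} {g : A ⟶ C} {inl : B ⟶ P} {inr : C ⟶ P}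
    {f' : A' ⟶ B'} {g' : A' ⟶ C'} {inl' : B' ⟶ P'} {inr' : C' ⟶ P'}
    (sq : IsPushout f g inl inr) (sq' : IsPushout f' g' inl' inr') {a : A ⟶ A'} {b : B ⟶ B'}
    {c : C ⟶ C'} {p : P ⟶ P'} (hf : f ≫ b = a ≫ f') (hg : g ≫ c = a ≫ g')
    (hl : inl ≫ p = b ≫ inl') (hr : inr ≫ p = c ≫ inr') (Hf : H f) (Hf' : H f')
    (QA : Q A) (QA' : Q A') (QC : Q C) (QC' : Q C') (wa : weakEquivalences E a)
    (wb : weakEquivalences E b) (wc : weakEquivalences E c) : weakEquivalences E p := by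
  have := h.cobaseChange
  -- Replacing `g` by the cofibration `F.i` reduces to spans whose second leg is a cofibration, with
  -- `D'` the cobase change of `F.Z` along `a`. Then `P` and `P'` are compared with `S` and `S'` by
  -- `m` and `m'`, and `S ⟶ S'` is a cobase change of `b`.
  let F := MorphismProperty.factorizationData (cofibrations E) (trivialFibrations E) g
  have Hj := h.cofibrations_le _ F.hi
  obtain ⟨D', d, j', sqD⟩ := exists_isPushout F.i a
  have hj' : cofibrations E j' := MorphismProperty.of_isPushout sqD.flip F.hi
  have wd : weakEquivalences E d := h.proper sqD Hj wa QA QA'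
  obtain ⟨r, hr₁, hr₂⟩ := sqD.exists_desc (F.p ≫ c) g' (by rw [F.fac_assoc, hg])
  have wr : weakEquivalences E r := (weakEquivalences E).of_precomp _ _ wd
    (by rw [hr₁]; exact (weakEquivalences E).comp_mem _ _ F.hp.2 wc)
  have QD : Q F.Z := h.target _ Hj QA
  have QD' : Q D' := h.target _ (h.cofibrations_le _ hj') QA'
  obtain ⟨S, x, y, sqS⟩ := exists_isPushout f F.i
  obtain ⟨S', x', y', sqS'⟩ := exists_isPushout f' j'
  obtain ⟨m, hm₁, hm₂⟩ := sqS.exists_desc inl (F.p ≫ inr) (by rw [F.fac_assoc, sq.w])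
  obtain ⟨m', hm₁', hm₂'⟩ := sqS'.exists_desc inl' (r ≫ inr') (by rw [reassoc_of% hr₂, sq'.w])
  have sqm : IsPushout y F.p m inr :=
    (IsPushout.of_left (by rw [F.fac, hm₁]; exact sq.flip) hm₂.symm sqS.flip).flip
  have sqm' : IsPushout y' r m' inr' :=
    (IsPushout.of_left (by rw [hr₂, hm₁']; exact sq'.flip) hm₂'.symm sqS'.flip).flip
  have wm : weakEquivalences E m := h.proper sqm
    (MorphismProperty.of_isPushout sqS.flip Hf) F.hp.2 QD QC
  have wm' : weakEquivalences E m' := h.proper sqm'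
    (MorphismProperty.of_isPushout sqS'.flip Hf') wr QD' QC'
  obtain ⟨n, hn₁, hn₂⟩ := sqS.exists_desc (b ≫ x') (d ≫ y') (by
    rw [reassoc_of% hf, sqS'.w, reassoc_of% sqD.w])
  have sqn : IsPushout x b n x' :=
    (IsPushout.of_left (by rw [hf, hn₂]; exact sqD.flip.paste_horiz sqS') hn₁.symm sqS).flip
  have wn : weakEquivalences E n := h.proper sqn
    (h.cofibrations_le _ (MorphismProperty.of_isPushout sqS F.hi)) wb (h.target _ Hf QA)
    (h.target _ Hf' QA')
  have e : m ≫ p = n ≫ m' := sqS.hom_ext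
    (by rw [reassoc_of% hm₁, hl, reassoc_of% hn₁, hm₁'])
    (by rw [reassoc_of% hm₂, hr, reassoc_of% hn₂, hm₂', reassoc_of% hr₁])
  refine (weakEquivalences E).of_precomp _ _ wm ?_
  rw [e]
  exact (weakEquivalences E).comp_mem _ _ wn wm'

end GluingContext

end Gluing

/-! ### Comparison of towers in the two monoidal contexts -/

section Contexts

set_option linter.unusedSectionVars false

variable {E : Type u} [Category.{v} E] [HasColimits E] [MonoidalCategory E] [SymmetricCategory E]
  [MonoidalClosed E] [ModelCategory E]

open MonoidExtension

/-- A gluing context which is compatible with the monoidal structure. -/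
structure MonoidalContext (Q : ObjectProperty E) (H : MorphismProperty E) : Prop
    extends GluingContext Q H where
  tensorObj {A B : E} : Q A → Q B → Q (A ⊗ B)
  tensorHom {A B A' B' : E} {f : A ⟶ B} {g : A' ⟶ B'} : Q A → Q B → Q A' → Q B' →
    weakEquivalences E f → weakEquivalences E g → weakEquivalences E (f ⊗ₘ g)
  whiskerLeft {A B : E} {w : A ⟶ B} (Z : E) : cofibrations E w → Q Z → H (Z ◁ w)
  tower {R X Y : E} [MonObj R] {u : X ⟶ Y} {α : X ⟶ R} (t : Tower u α) (n : ℕ) : Q R →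
    cofibrations E u → H (t.q n ▷ R) ∧ H (t.i (n + 1))

/-- Ken Brown's argument: `w` is a trivial cofibration followed by a retraction of a trivial
cofibration, and tensoring with the cofibrant `Z` preserves trivial cofibrations. -/
lemma IsMonoidalModelCategory.weakEquivalences_whiskerLeft (hE : IsMonoidalModelCategory E) {Z : E}
    (hZ : IsCofibrant Z) {A B : E} {w : A ⟶ B} (hA : IsCofibrant A) (hB : IsCofibrant B)
    (hw : weakEquivalences E w) : weakEquivalences E (Z ◁ w) := by
  have F : CofibrantBrownFactorization w := Classical.choice inferInstance
  have : WeakEquivalence w := ⟨hw⟩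
  have hFi : trivialCofibrations E F.i := ⟨F.hi, (inferInstance : WeakEquivalence F.i).mem⟩
  have hFs : trivialCofibrations E F.s :=
    ⟨F.cofibration_s.mem, (inferInstance : WeakEquivalence F.s).mem⟩
  have h₁ := (hE.trivialCofibrations_whiskerLeft Z hZ hFi).2
  have h₂ := (hE.trivialCofibrations_whiskerLeft Z hZ hFs).2
  have h₃ : weakEquivalences E (Z ◁ F.p) := (weakEquivalences E).of_precomp _ _ h₂ (by
    rw [← MonoidalCategory.whiskerLeft_comp, F.s_p, MonoidalCategory.whiskerLeft_id]
    exact MorphismProperty.id_mem _ _)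
  rw [← F.fac, MonoidalCategory.whiskerLeft_comp]
  exact (weakEquivalences E).comp_mem _ _ h₁ h₃

lemma isCofibrant_of_cofibrations {A B : E} (f : A ⟶ B) (hf : cofibrations E f)
    (hA : IsCofibrant A) : IsCofibrant B := by
  have : Cofibration f := ⟨hf⟩
  exact isCofibrant_of_cofibration f

lemma IsMonoidalModelCategory.isCofibrant_tensor (hE : IsMonoidalModelCategory E) {A B : E}
    (hA : IsCofibrant A) (hB : IsCofibrant B) : IsCofibrant (A ⊗ B) :=
  (isCofibrant_iff_of_isInitial ((A ◁ initial.to B)) (isInitialTensorLeft initialIsInitial A)).2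
    ⟨(hE.cofibrations_whiskerLeft A hA hB.mem)⟩

/-- Cofibrant objects and cofibrations. -/
lemma IsMonoidalModelCategory.context (hE : IsMonoidalModelCategory E) :
    MonoidalContext (E := E) IsCofibrant (cofibrations E) where
  cobaseChange := inferInstance
  cofibrations_le := le_rfl
  target := isCofibrant_of_cofibrations
  initial := (isCofibrant_iff_of_isInitial (𝟙 _) initialIsInitial).2 inferInstance
  proper sq hi hw hX hA := weakEquivalences_of_isPushout_of_isCofibrant sq hi hw hX hA
  tensorObj := hE.isCofibrant_tensor
  tensorHom {A B A' B' f g} hA hB hA' hB' hf hg := by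
    rw [MonoidalCategory.tensorHom_def]
    refine (weakEquivalences E).comp_mem _ _ ?_ (hE.weakEquivalences_whiskerLeft hB hA' hB' hg)
    exact ((weakEquivalences E).arrow_mk_iso_iff (Arrow.isoMk (β_ _ _) (β_ _ _) (by simp))).2
      (hE.weakEquivalences_whiskerLeft hA' hA hB hf)
  whiskerLeft Z hw hZ := hE.cofibrations_whiskerLeft Z hZ hw
  tower t n hR hu := t.cofibrations_of_isCofibrant hE hR hu n

/-- All objects and `h`-cofibrations. -/
lemma IsStronglyHMonoidal.context (hE : IsMonoidalModelCategory E) (h : IsStronglyHMonoidal E) :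
    MonoidalContext (E := E) ⊤ (hCofibrations (weakEquivalences E)) where
  cobaseChange := inferInstance
  cofibrations_le _ _ _ hf := h.isHCofibration _ ⟨hf⟩
  target _ _ _ := trivial
  initial := trivial
  proper sq hi hw _ _ := hi.of_isPushout sq hw
  tensorObj _ _ := trivial
  tensorHom _ _ _ _ hf hg := (h.tensor _ _ ⟨hf⟩ ⟨hg⟩).mem
  whiskerLeft Z hw _ :=
    ((hCofibrations (weakEquivalences E)).arrow_mk_iso_iff
      (Arrow.isoMk (β_ _ _) (β_ _ _) (by simp))).2 (h.hCofibration _ Z ⟨hw⟩)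
  tower t n _ hu := t.mem_of_cofibrations hE
    (L := hCofibrations (weakEquivalences E)) (fun c Z hc => h.hCofibration c Z ⟨hc⟩) hu n

namespace MonoidExtension.Tower

variable {Q : ObjectProperty E} {H : MorphismProperty E} {R S X Y : E} [MonObj R] [MonObj S]
  {u : X ⟶ Y} {α : X ⟶ R} {β : X ⟶ S}

lemma obj_mem (h : MonoidalContext Q H) (t : Tower u α) (hR : Q R) (hu : cofibrations E u)
    (n : ℕ) : Q (t.obj n) := by
  match n with
  | 0 => exact h.of_isInitial t.isInitial
  | 1 => exact h.target_iso t.e hR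
  | n + 2 => exact h.target _ (h.tower t n hR hu).2 (obj_mem h t hR hu (n + 1))

/-- `t.Q n` is the target of a cobase change of `obj n ◁ u`, which is in `H`, with source `obj (n +
1) ⊗ X`. -/
lemma Q_mem (h : MonoidalContext Q H) (t : Tower u α) (hR : Q R) (hX : Q X)
    (hu : cofibrations E u) (n : ℕ) : Q (t.Q n) := by
  have := h.cobaseChange
  have hobj := t.obj_mem h hR hu
  exact h.target _ (MorphismProperty.of_isPushout (t.isPushoutQ n).flip
    (h.whiskerLeft _ hu (hobj n))) (h.tensorObj (hobj (n + 1)) hX)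

/-- Morphisms of towers over weak equivalences are weak equivalences. -/
lemma Hom.weakEquivalences (h : MonoidalContext Q H) {t : Tower u α} {t' : Tower u β} {f : R ⟶ S}
    (g : Tower.Hom t t' f) (hR : Q R) (hS : Q S) (hX : Q X) (hu : cofibrations E u)
    (hf : weakEquivalences E f) (n : ℕ) : weakEquivalences E (g.φ n) := by
  have ho := t.obj_mem h hR hu
  have ho' := t'.obj_mem h hS hu
  have hY : Q Y := h.target _ (h.cofibrations_le _ hu) hX
  match n with
  | 0 =>
    have : IsIso (g.φ 0) := isIso_of_isInitial t.isInitial t'.isInitial _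
    exact (inferInstance : WeakEquivalence (g.φ 0)).mem
  | 1 =>
    have : g.φ 1 = t.e.inv ≫ f ≫ t'.e.hom := by rw [← g.e_φ, Iso.inv_hom_id_assoc]
    rw [this]
    exact (MorphismProperty.cancel_left_of_respectsIso _ _ _).2
      ((MorphismProperty.cancel_right_of_respectsIso _ _ _).2 hf)
  | n + 2 =>
    have w₀ := g.weakEquivalences h hR hS hX hu hf n
    have w₁ := g.weakEquivalences h hR hS hX hu hf (n + 1)
    have wr {A B Z : E} {w : A ⟶ B} (hA : Q A) (hB : Q B) (hZ : Q Z)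
        (hw : HomotopicalAlgebra.weakEquivalences E w) :
        HomotopicalAlgebra.weakEquivalences E (w ▷ Z) := by
      rw [← tensorHom_id]
      exact h.tensorHom hA hB hZ hZ hw (MorphismProperty.id_mem _ _)
    obtain ⟨r, hr₁, hr₂⟩ := (t.isPushoutQ n).exists_desc (g.φ n ▷ Y ≫ t'.Qinl n)
      (g.φ (n + 1) ▷ X ≫ t'.Qinr n) (by
        rw [whisker_exchange_assoc, (t'.isPushoutQ n).w, ← comp_whiskerRight_assoc,
          ← comp_whiskerRight_assoc, g.i_φ])
    -- First gluing: the domains of the pushout-products.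
    have wr' : HomotopicalAlgebra.weakEquivalences E r :=
      h.gluing (t.isPushoutQ n) (t'.isPushoutQ n) (a := g.φ n ▷ X) (b := g.φ n ▷ Y)
        (c := g.φ (n + 1) ▷ X) (whisker_exchange _ _)
        (by rw [← comp_whiskerRight, ← comp_whiskerRight, g.i_φ]) hr₁ hr₂
        (h.whiskerLeft _ hu (ho n)) (h.whiskerLeft _ hu (ho' n))
        (h.tensorObj (ho n) hX) (h.tensorObj (ho' n) hX) (h.tensorObj (ho (n + 1)) hX)
        (h.tensorObj (ho' (n + 1)) hX) (wr (ho n) (ho' n) hX w₀) (wr (ho n) (ho' n) hY w₀)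
        (wr (ho (n + 1)) (ho' (n + 1)) hX w₁)
    have hq : t.q n ≫ g.φ (n + 1) ▷ Y = r ≫ t'.q n := by
      refine (t.isPushoutQ n).hom_ext ?_ ?_
      · rw [reassoc_of% t.Qinl_q, reassoc_of% hr₁, t'.Qinl_q, ← comp_whiskerRight,
          ← comp_whiskerRight, g.i_φ]
      · rw [reassoc_of% t.Qinr_q, reassoc_of% hr₂, t'.Qinr_q, whisker_exchange]
    have hk : t.k n ≫ g.φ (n + 1) = r ≫ t'.k n := by
      refine (t.isPushoutQ n).hom_ext ?_ ?_
      · rw [reassoc_of% t.Qinl_k, reassoc_of% hr₁, t'.Qinl_k, g.m_φ]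
      · rw [reassoc_of% t.Qinr_k, reassoc_of% hr₂, t'.Qinr_k, g.act_φ,
          MonoidalCategory.tensorHom_def, Category.assoc, whisker_exchange_assoc,
          ← MonoidalCategory.whiskerLeft_comp_assoc, g.α_f]
    have hm : (t.m (n + 1) ▷ R ≫ t.act (n + 1)) ≫ g.φ (n + 2) =
        (g.φ (n + 1) ▷ Y ⊗ₘ f) ≫ t'.m (n + 1) ▷ S ≫ t'.act (n + 1) := by
      rw [Category.assoc, g.act_φ, MonoidalCategory.tensorHom_def, MonoidalCategory.tensorHom_def,
        Category.assoc, ← comp_whiskerRight_assoc, g.m_φ]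
      simp only [Category.assoc, comp_whiskerRight, whisker_exchange_assoc]
    -- Second gluing: the pushouts which define the new objects of the two towers.
    refine h.gluing (t.isPushout n) (t'.isPushout n) (a := r ⊗ₘ f) (b := g.φ (n + 1) ▷ Y ⊗ₘ f)
      (c := g.φ (n + 1)) ?_ ?_ hm (g.i_φ (n + 1)) (h.tower t n hR hu).1 (h.tower t' n hS hu).1
      (h.tensorObj (t.Q_mem h hR hX hu n) hR) (h.tensorObj (t'.Q_mem h hS hX hu n) hS)
      (ho (n + 1)) (ho' (n + 1)) (h.tensorHom (t.Q_mem h hR hX hu n) (t'.Q_mem h hS hX hu n) hR hS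
        wr' hf) (h.tensorHom (h.tensorObj (ho _) hY) (h.tensorObj (ho' _) hY) hR hS
        (wr (ho _) (ho' _) hY w₁) hf) w₁
    · rw [MonoidalCategory.tensorHom_def, MonoidalCategory.tensorHom_def,
        ← comp_whiskerRight_assoc, hq]
      simp [whisker_exchange]
    · rw [Category.assoc, g.act_φ, MonoidalCategory.tensorHom_def, MonoidalCategory.tensorHom_def,
        Category.assoc, ← comp_whiskerRight_assoc, hk]
      simp [whisker_exchange_assoc]

end MonoidExtension.Tower

end Contexts

end

noncomputable section

/-! ### Adequacy -/

section Adequacy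

set_option linter.unusedSectionVars false

variable {E : Type u} [Category.{v} E] [HasColimits E] [MonoidalCategory E] [SymmetricCategory E]
  [MonoidalClosed E] [ModelCategory E]

open MonoidExtension

/-- The class of trivial cofibrations, tensored with objects and pushed out, consists of weak
equivalences. -/
def HasTrivialTensors (E : Type u) [Category.{v} E] [MonoidalCategory E] [ModelCategory E] : Prop :=
  ∀ {A B : E} (c : A ⟶ B) (Z : E), trivialCofibrations E c →
    universally (weakEquivalences E) (c ▷ Z)

lemma MonoidAxiom.hasTrivialTensors (h : MonoidAxiom E) : HasTrivialTensors E :=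
  fun c Z hc _ _ _ _ _ sq => h _ (MorphismProperty.of_isPushout sq
    ((isMonoidallySaturated_monoidalSaturation _).tensor c Z (le_monoidalSaturation _ _ hc)))

lemma IsHMonoidal.hasTrivialTensors (h : IsHMonoidal E) : HasTrivialTensors E :=
  fun c Z hc => h.universally_weakEquivalences _ (h.hCofibration c Z ⟨hc.1⟩)
    (h.weakEquivalence c Z ⟨hc.1⟩ ⟨hc.2⟩).mem

namespace MonoidExtension.Tower

variable {R X Y : E} [MonObj R] {u : X ⟶ Y} {α : X ⟶ R} (t : Tower u α)
  (hE : IsMonoidalModelCategory E)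

include hE

lemma tensorCofibrations_i (hu : cofibrations E u) (n : ℕ) :
    tensorCofibrations E (t.i (n + 1)) :=
  (t.mem_of_cofibrations hE (L := tensorCofibrations E)
    (fun c Z hc => (isMonoidallySaturated_monoidalSaturation _).tensor c Z
      (le_monoidalSaturation _ _ hc)) hu n).2

lemma weakEquivalences_i (h : HasTrivialTensors E) (hu : trivialCofibrations E u) (n : ℕ) :
    weakEquivalences E (t.i (n + 1)) :=
  universally_le _ _ (t.mem_of_trivialCofibrations hE h hu n).2

end MonoidExtension.Tower

lemma stepsIn_filtration (hE : IsMonoidalModelCategory E) (h : HasTrivialTensors E) :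
    (filtration E).StepsIn (tensorCofibrations E) where
  cofibration d n hu := by
    rw [filtration_step]
    exact (towerAt d).tensorCofibrations_i hE hu.mem n
  trivialCofibration d n hu hu' := by
    rw [filtration_step]
    exact ⟨(towerAt d).tensorCofibrations_i hE hu.mem n,
      ⟨(towerAt d).weakEquivalences_i hE h ⟨hu.mem, hu'.mem⟩ n⟩⟩

lemma weakEquivalence_induced {Q : ObjectProperty E} {H : MorphismProperty E}
    (h : MonoidalContext Q H) (d : Data E) {S : (freeMonoidMonad E).Algebra} (f : d.right ⟶ S)
    (hu : Cofibration d.left.hom) (hf : WeakEquivalence ((freeMonoidMonad E).forget.map f))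
    (hX : Q d.left.left) (hR : Q ((freeMonoidMonad E).forget.obj d.right))
    (hS : Q ((freeMonoidMonad E).forget.obj S)) (n : ℕ) :
    WeakEquivalence ((filtration E).induced d f n) := by
  rw [filtration_induced]
  refine ⟨(towerHom d f).weakEquivalences h (h.target_iso (underlyingIso _) hR)
    (h.target_iso (underlyingIso S) hS) hX hu.mem ?_ _⟩
  exact ((weakEquivalences E).arrow_mk_iso_iff (Arrow.isoMk (underlyingIso d.right)
    (underlyingIso S) (underlyingIso_naturality f).symm)).1 hf.mem

theorem isRelativelyAdequate_freeMonoidMonad (hE : IsMonoidalModelCategory E)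
    (h : MonoidAxiom E) :
    IsRelativelyAdequate (tensorCofibrations E) (freeMonoidMonad E) :=
  ⟨filtration E, stepsIn_filtration hE h.hasTrivialTensors,
    fun d _ f hu hX hf hR hS n => weakEquivalence_induced hE.context d f hu hf hX hR hS n⟩

theorem isAdequate_freeMonoidMonad (hE : IsMonoidalModelCategory E) (h : IsStronglyHMonoidal E) :
    IsAdequate (tensorCofibrations E) (freeMonoidMonad E) :=
  ⟨filtration E, stepsIn_filtration hE h.toIsHMonoidal.hasTrivialTensors,
    fun d _ f hu hf n => weakEquivalence_induced (h.context hE) d f hu hf trivial trivial trivial n⟩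

end Adequacy

end

noncomputable section

/-! ### Transfinite compositions and perfect classes of weak equivalences -/

section Transfinite

section Perfect

variable {E : Type u} [Category.{v} E] {K W : MorphismProperty E}

/-- Transfinite induction: at a limit index both functors are colimits of their restrictions, and
perfectness applies. -/
lemma IsPerfect.app_mem (h : IsPerfect K W) {J : Type v} [LinearOrder J] [SuccOrder J]
    [OrderBot J] [WellFoundedLT J] {F G : J ⥤ E} [F.IsWellOrderContinuous]
    [G.IsWellOrderContinuous] (τ : F ⟶ G) (hF : ∀ ⦃i j : J⦄ (φ : i ⟶ j), K (F.map φ))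
    (hG : ∀ ⦃i j : J⦄ (φ : i ⟶ j), K (G.map φ)) (h₀ : W (τ.app ⊥))
    (hs : ∀ j, ¬ IsMax j → W (τ.app j) → W (τ.app (Order.succ j))) (j : J) : W (τ.app j) := by
  induction j using SuccOrder.limitRecOn with
  | isMin j hj =>
    obtain rfl := hj.eq_bot
    exact h₀
  | succ j hj hj' => exact hs j hj hj'
  | isSuccLimit j hj hj' =>
    have : Nonempty (Set.Iio j) := ⟨⟨⊥, hj.bot_lt⟩⟩
    exact h (Set.Iio j) _ _ (Functor.whiskerLeft (Set.principalSegIio j).monotone.functor τ) _ _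
      (F.isColimitOfIsWellOrderContinuous j hj) (G.isColimitOfIsWellOrderContinuous j hj) _
      (fun _ _ _ => hF _) (fun _ _ _ => hG _) (fun k => hj' k.1 k.2) (fun k => τ.naturality _)

instance {J : Type*} [PartialOrder J] [OrderBot J] (X : E) :
    ((Functor.const J).obj X).IsWellOrderContinuous where
  nonempty_isColimit m hm := ⟨{
    desc s := s.ι.app ⟨⊥, hm.bot_lt⟩
    fac s j := (Category.id_comp _).trans
      ((s.w (homOfLE bot_le : (⟨⊥, hm.bot_lt⟩ : Set.Iio m) ⟶ j)).symm.trans (Category.id_comp _))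
    uniq _ _ hf := (Category.id_comp _).symm.trans (hf ⟨⊥, hm.bot_lt⟩) }⟩

/-- Compare the constant diagram at the first object with the given sequence. The comparison is
levelwise in `W` by `app_mem`, and one more use of perfectness treats the colimit. -/
lemma IsPerfect.isStableUnderTransfiniteComposition (h : IsPerfect K W)
    [MorphismProperty.IsStableUnderTransfiniteComposition.{v} K] [W.IsMultiplicative]
    [W.RespectsIso] : MorphismProperty.IsStableUnderTransfiniteComposition.{v} (K ⊓ W) where
  isStableUnderTransfiniteCompositionOfShape J _ _ _ _ := ⟨by
    rintro X Y f ⟨t⟩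
    refine ⟨K.transfiniteCompositionsOfShape_le J _ ⟨t.ofLE inf_le_left⟩, ?_⟩
    have hK ⦃i j : J⦄ (φ : i ⟶ j) : K (t.F.map φ) :=
      (t.ofLE (inf_le_left : K ⊓ W ≤ K)).mem_map φ
    have hK' ⦃i j : J⦄ (φ : i ⟶ j) : K (((Functor.const J).obj (t.F.obj ⊥)).map φ) := K.id_mem _
    let τ : (Functor.const J).obj (t.F.obj ⊥) ⟶ t.F :=
      { app k := t.F.map (homOfLE bot_le)
        naturality _ _ φ := by
          refine (Category.id_comp _).trans ?_
          exact (congrArg t.F.map (Subsingleton.elim _ _)).trans (t.F.map_comp _ _) }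
    have hτ := h.app_mem τ hK' hK (by
      have : τ.app ⊥ = 𝟙 _ := t.F.map_id _
      rw [this]
      exact W.id_mem _) (fun j hj hj' => by
      have : τ.app (Order.succ j) = τ.app j ≫ t.F.map (homOfLE (Order.le_succ j)) :=
        t.F.map_comp _ _
      rw [this]
      exact W.comp_mem _ _ hj' (t.map_mem j hj).2)
    have : W (t.incl.app ⊥) := h J _ t.F τ { pt := t.F.obj ⊥, ι := 𝟙 _ } _
      (isColimitConstCocone J (t.F.obj ⊥)) t.isColimit _ hK' hK hτ
      (fun k => (Category.id_comp _).trans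
        ((t.incl.naturality (homOfLE (bot_le : ⊥ ≤ k))).trans (Category.comp_id _)).symm)
    rw [← t.fac]
    exact (W.cancel_left_of_respectsIso _ _).2 this⟩

end Perfect

variable {D : Type u'} [Category.{v} D]

/-- A cocone is a colimit if it is obtained by cobase change from a colimit cocone. -/
def isColimitOfIsPushout {J : Type*} [Category* J] {F G : J ⥤ D} (τ : F ⟶ G) {j₀ : J}
    (hj₀ : ∀ j, j₀ ⟶ j) {c : Cocone F} {d : Cocone G} (hc : IsColimit c) {f : c.pt ⟶ d.pt}
    (hf : ∀ j, c.ι.app j ≫ f = τ.app j ≫ d.ι.app j)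
    (sq : IsPushout (c.ι.app j₀) (τ.app j₀) f (d.ι.app j₀))
    (sqs : ∀ j, IsPushout (F.map (hj₀ j)) (τ.app j₀) (τ.app j) (G.map (hj₀ j))) :
    IsColimit d where
  desc s := sq.desc (hc.desc ((Cocone.precompose τ).obj s)) (s.ι.app j₀) (by simp)
  fac s j := by
    refine (sqs j).hom_ext ?_ ?_
    · rw [← reassoc_of% hf, sq.inl_desc, hc.fac]
      rfl
    · rw [d.w_assoc, sq.inr_desc, s.w]
  uniq s m hm := by
    refine sq.hom_ext (hc.hom_ext fun j => ?_) ?_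
    · rw [sq.inl_desc, hc.fac, reassoc_of% hf, hm]
      rfl
    · rw [sq.inr_desc, hm]

section CobaseChange

variable [HasPushouts D] {J : Type*} [PartialOrder J] [OrderBot J] (F : J ⥤ D) {A : D}
  (a : F.obj ⊥ ⟶ A)

/-- The cobase change of a diagram along a morphism out of its value at the least element. -/
def cobaseChange : J ⥤ D where
  obj j := pushout (F.map (homOfLE bot_le : ⊥ ⟶ j)) a
  map φ := pushout.desc (F.map φ ≫ pushout.inl _ _) (pushout.inr _ _) (by
    rw [← F.map_comp_assoc]
    exact pushout.condition)
  map_id j := by ext <;> simp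
  map_comp φ ψ := by
    ext
    · rw [pushout.inl_desc, pushout.inl_desc_assoc, Category.assoc, pushout.inl_desc, F.map_comp,
        Category.assoc]
    · rw [pushout.inr_desc, pushout.inr_desc_assoc, pushout.inr_desc]

namespace cobaseChange

/-- The canonical morphism to the cobase change. -/
def inl : F ⟶ cobaseChange F a where
  app _ := pushout.inl _ _
  naturality _ _ _ := (pushout.inl_desc _ _ _).symm

/-- The new base object maps to the cobase change. -/
def inr (j : J) : A ⟶ (cobaseChange F a).obj j := pushout.inr _ _

lemma inr_map {i j : J} (φ : i ⟶ j) : inr F a i ≫ (cobaseChange F a).map φ = inr F a j :=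
  pushout.inr_desc _ _ _

lemma isPushout_inr (j : J) :
    IsPushout (F.map (homOfLE bot_le : ⊥ ⟶ j)) a ((inl F a).app j) (inr F a j) :=
  IsPushout.of_hasPushout _ _

lemma isPushout {i j : J} (φ : i ⟶ j) :
    IsPushout (F.map φ) ((inl F a).app i) ((inl F a).app j) ((cobaseChange F a).map φ) := by
  refine IsPushout.of_left ?_ ((inl F a).naturality φ) (isPushout_inr F a i)
  rw [← F.map_comp, inr_map]
  exact isPushout_inr F a j

instance : IsIso (inr F a ⊥) := by
  have : IsIso (F.map (homOfLE bot_le : (⊥ : J) ⟶ ⊥)) :=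
    inferInstanceAs (IsIso (F.map (𝟙 _)))
  exact (isPushout_inr F a ⊥).isIso_inr_of_isIso

lemma inl_bot : (inl F a).app ⊥ = a ≫ inr F a ⊥ := by
  rw [← (isPushout_inr F a ⊥).w]
  exact ((congrArg (· ≫ _) (F.map_id ⊥)).trans (Category.id_comp _)).symm

instance [F.IsWellOrderContinuous] : (cobaseChange F a).IsWellOrderContinuous where
  nonempty_isColimit m hm := ⟨by
    refine isColimitOfIsPushout
      (Functor.whiskerLeft (Set.principalSegIio m).monotone.functor (inl F a))
      (j₀ := (⟨⊥, hm.bot_lt⟩ : Set.Iio m)) (fun j => homOfLE bot_le)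
      (F.isColimitOfIsWellOrderContinuous m hm) (f := (inl F a).app m)
      (fun j => (inl F a).naturality _) ?_ ?_
    · exact isPushout F a _
    · exact fun j => isPushout F a _⟩

variable {F a} {c : Cocone F} {B : D} {f : c.pt ⟶ B} {b : A ⟶ B}
  (sq : IsPushout (c.ι.app ⊥) a f b)

/-- The cobase change of a cocone. -/
def cocone : Cocone (cobaseChange F a) where
  pt := B
  ι :=
    { app j := (isPushout_inr F a j).desc (c.ι.app j ≫ f) b (by rw [c.w_assoc, sq.w])
      naturality i j φ := by
        refine ((isPushout_inr F a i).hom_ext ?_ ?_).trans (Category.comp_id _).symm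
        · rw [← reassoc_of% (inl F a).naturality φ, IsPushout.inl_desc, IsPushout.inl_desc,
            c.w_assoc]
        · rw [reassoc_of% inr_map, IsPushout.inr_desc, IsPushout.inr_desc] }

lemma inl_cocone_ι (j : J) : (inl F a).app j ≫ (cocone sq).ι.app j = c.ι.app j ≫ f :=
  (isPushout_inr F a j).inl_desc _ _ _

lemma inr_cocone_ι (j : J) : inr F a j ≫ (cocone sq).ι.app j = b :=
  (isPushout_inr F a j).inr_desc _ _ _

/-- The cobase change of a colimit cocone is a colimit. -/
def isColimitCocone (hc : IsColimit c) : IsColimit (cocone sq) :=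
  isColimitOfIsPushout (inl F a) (j₀ := ⊥) (fun j => homOfLE bot_le) hc (f := f)
    (fun j => (inl_cocone_ι sq j).symm) (by
      refine IsPushout.of_iso sq (Iso.refl _) (Iso.refl _) (asIso (inr F a ⊥)) (Iso.refl _)
        ?_ ?_ ?_ ?_
      · simp
      · simp [inl_bot]
      · exact (Category.comp_id _).trans (Category.id_comp _).symm
      · exact (Category.comp_id _).trans (inr_cocone_ι sq ⊥).symm)
    (fun j => isPushout F a _)

end cobaseChange

end CobaseChange

variable {J : Type*} [LinearOrder J] [SuccOrder J] [OrderBot J] [WellFoundedLT J]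

/-- The cobase change of a transfinite composition. -/
def CategoryTheory.MorphismProperty.TransfiniteCompositionOfShape.cobaseChange [HasPushouts D]
    {M : MorphismProperty D} [M.IsStableUnderCobaseChange] {X Y X' Y' : D} {f : X ⟶ Y}
    (t : M.TransfiniteCompositionOfShape J f) {a : X ⟶ X'} {b : Y ⟶ Y'} {f' : X' ⟶ Y'}
    (sq : IsPushout f a b f') : M.TransfiniteCompositionOfShape J f' :=
  have sq' : IsPushout ((Cocone.mk Y t.incl).ι.app ⊥) (t.isoBot.hom ≫ a) b f' :=
    IsPushout.of_iso sq t.isoBot.symm (Iso.refl _) (Iso.refl _) (Iso.refl _)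
      ((Category.comp_id _).trans t.fac.symm) (by simp) (by simp) (by simp)
  { F := _root_.cobaseChange t.F (t.isoBot.hom ≫ a)
    isoBot := (asIso (cobaseChange.inr t.F (t.isoBot.hom ≫ a) ⊥)).symm
    incl := (cobaseChange.cocone sq').ι
    isColimit := cobaseChange.isColimitCocone sq' t.isColimit
    fac := cobaseChange.inr_cocone_ι sq' ⊥
    map_mem j hj := M.of_isPushout (cobaseChange.isPushout t.F _ _).flip (t.map_mem j hj) }

end Transfinite

end

noncomputable section

/-! ### Transfer of model structures along right adjoints -/

section Transfer

variable {E : Type u} [Category.{v} E] {D : Type u'} [Category.{v} D] {F : E ⥤ D} {U : D ⥤ E}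

lemma coproducts_map_le [HasCoproducts.{v} E] [PreservesColimitsOfSize.{v, v} F]
    (P : MorphismProperty E)
    [MorphismProperty.IsStableUnderCoproducts.{v} P] :
    MorphismProperty.coproducts.{v} (P.map F) ≤ P.map F := by
  intro X Y f hf
  obtain ⟨J, hf⟩ := (MorphismProperty.coproducts_iff _ _).1 hf
  obtain ⟨X₁, X₂, c₁, c₂, h₁, h₂, τ, hτ⟩ := hf
  choose A B x hx e using hτ
  let G₁ : Discrete J ⥤ E := Discrete.functor (fun j => A ⟨j⟩)
  let G₂ : Discrete J ⥤ E := Discrete.functor (fun j => B ⟨j⟩)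
  let α : G₁ ⟶ G₂ := Discrete.natTrans (fun j => x j)
  let e₁ : G₁ ⋙ F ≅ X₁ := Discrete.natIso (fun j => Arrow.leftFunc.mapIso (e j).some)
  let e₂ : G₂ ⋙ F ≅ X₂ := Discrete.natIso (fun j => Arrow.rightFunc.mapIso (e j).some)
  have hα : P (colimMap α) := MorphismProperty.colimitsOfShape_le _
    (MorphismProperty.colimitsOfShape_colimMap _ (fun j => hx j))
  refine ⟨_, _, colimMap α, hα, ⟨Arrow.isoMk
    (IsColimit.coconePointsIsoOfNatIso (isColimitOfPreserves F (colimit.isColimit G₁)) h₁ e₁)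
    (IsColimit.coconePointsIsoOfNatIso (isColimitOfPreserves F (colimit.isColimit G₂)) h₂ e₂)
    ((isColimitOfPreserves F (colimit.isColimit G₁)).hom_ext fun j => ?_)⟩⟩
  have w : e₁.hom.app j ≫ τ.app j = F.map (α.app j) ≫ e₂.hom.app j := (e j).some.hom.w
  have w₁ := IsColimit.comp_coconePointsIsoOfNatIso_hom
    (isColimitOfPreserves F (colimit.isColimit G₁)) h₁ e₁ j
  have w₂ := IsColimit.comp_coconePointsIsoOfNatIso_hom
    (isColimitOfPreserves F (colimit.isColimit G₂)) h₂ e₂ j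
  have w₃ : F.map (colimit.ι G₁ j) ≫ F.map (colimMap α) =
      F.map (α.app j) ≫ F.map (colimit.ι G₂ j) := by
    rw [← F.map_comp, ι_colimMap, F.map_comp]
  have w₄ : c₁.ι.app j ≫ h₁.desc (Cocone.mk _ (τ ≫ c₂.ι)) = τ.app j ≫ c₂.ι.app j := h₁.fac _ j
  refine ((Category.assoc _ _ _).symm.trans (congrArg (· ≫ _) w₁)).trans ?_
  refine ((Category.assoc _ _ _).trans (congrArg (e₁.hom.app j ≫ ·) w₄)).trans ?_
  refine Eq.trans ?_ ((Category.assoc _ _ _).symm.trans (congrArg (· ≫ _) w₃)).symm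
  refine Eq.trans ?_ ((Category.assoc _ _ _).trans (congrArg (F.map (α.app j) ≫ ·) w₂)).symm
  exact (Category.assoc _ _ _).symm.trans ((congrArg (· ≫ _) w).trans (Category.assoc _ _ _))

lemma preservesWellOrderContinuousOfShape [PreservesFilteredColimitsOfSize.{v, v} U]
    (J : Type v) [LinearOrder J] [OrderBot J] : PreservesWellOrderContinuousOfShape J U where
  preservesColimitsOfShape j hj := by
    have : Nonempty (Set.Iio j) := ⟨⟨⊥, hj.bot_lt⟩⟩
    infer_instance

/-- By adjunction maps out of `F.obj A` are maps from `A` into the underlying objects, so smallness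
of `A` is inherited by `F.obj A` for sequences with underlying maps in `K`. -/
lemma IsSmallWithRespectTo.preservesColimit (adj : F ⊣ U) [PreservesFilteredColimitsOfSize.{v, v} U]
    {J : Type v} [LinearOrder J] [SuccOrder J] [OrderBot J] [WellFoundedLT J] [NoMaxOrder J]
    {K : MorphismProperty E} {A : E} {κ : Cardinal.{v}} [Fact κ.IsRegular]
    (h : IsSmallWithRespectTo K A) (hκ : h.choose ≤ κ) [IsCardinalFiltered J κ]
    (G : J ⥤ D) [G.IsWellOrderContinuous]
    (hG : ∀ j : J, K (U.map (G.map (homOfLE (Order.le_succ j))))) :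
    PreservesColimit G (coyoneda.obj (Opposite.op (F.obj A))) := by
  have := h.choose_spec.choose
  have := IsCardinalFiltered.of_le J hκ
  have := preservesWellOrderContinuousOfShape (U := U) J
  have := h.choose_spec.choose_spec J (G ⋙ U) hG
  have : PreservesColimit G (U ⋙ coyoneda.obj (Opposite.op A)) := inferInstance
  let e : U ⋙ coyoneda.obj (Opposite.op A) ≅ coyoneda.obj (Opposite.op (F.obj A)) :=
    (adj.compCoyonedaIso.app (Opposite.op A)).symm
  exact preservesColimit_of_natIso G e

/-- The pushouts of free maps on (trivial) cofibrations are mapped to morphisms in `K`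
(resp. to weak equivalences in `K`). -/
structure HasFreeExtensionsIn [ModelCategory E] (F : E ⥤ D) (U : D ⥤ E)
    (K : MorphismProperty E) : Prop where
  cofibrations : ((cofibrations E).map F).pushouts ≤ K.inverseImage U
  trivialCofibrations :
    ((trivialCofibrations E).map F).pushouts ≤ (K ⊓ weakEquivalences E).inverseImage U

lemma pushouts_coproducts_ofHoms_le [HasCoproducts.{v} E] [PreservesColimitsOfSize.{v, v} F]
    (P : MorphismProperty E) [MorphismProperty.IsStableUnderCoproducts.{v} P] {ι : Type v}
    {A B : ι → E} (f : ∀ i, A i ⟶ B i) (hf : ∀ i, P (f i)) :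
    (MorphismProperty.coproducts.{v}
      (MorphismProperty.ofHoms (fun i => F.map (f i)))).pushouts ≤ (P.map F).pushouts := by
  refine MorphismProperty.pushouts_monotone
    ((MorphismProperty.coproducts_monotone ?_).trans (coproducts_map_le P))
  rintro _ _ _ ⟨i⟩
  exact P.map_mem_map _ _ (hf i)

lemma hasSmallObjectArgument_ofHoms [HasColimits E] [HasColimits D] (adj : F ⊣ U)
    [PreservesFilteredColimitsOfSize.{v, v} U] {P K : MorphismProperty E}
    [MorphismProperty.IsStableUnderCoproducts.{v} P] (hP : (P.map F).pushouts ≤ K.inverseImage U)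
    (hK : ∀ A, IsSmallWithRespectTo K A) {ι : Type v} {A B : ι → E} (f : ∀ i, A i ⟶ B i)
    (hf : ∀ i, P (f i)) :
    MorphismProperty.HasSmallObjectArgument.{v}
      (MorphismProperty.ofHoms (fun i => F.map (f i))) := by
  have := adj.leftAdjoint_preservesColimits
  -- An infinite cardinal bounding all the smallness ranks; its successor is regular and serves
  -- every domain at once.
  let μ : Cardinal.{v} := (⨆ i, (hK (A i)).choose) ⊔ Cardinal.aleph0
  let κ := Order.succ μ
  have : Fact κ.IsRegular := ⟨Cardinal.isRegular_succ le_sup_right⟩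
  have hκ (i : ι) : (hK (A i)).choose ≤ κ :=
    ((le_ciSup Cardinal.bddAbove_of_small i).trans le_sup_left).trans (Order.le_succ μ)
  have := Cardinal.noMaxOrder (Fact.out : κ.IsRegular).aleph0_le
  have : Nonempty κ.ord.ToType := Cardinal.nonempty_ord_toType (Fact.out : κ.IsRegular).pos.ne'
  let : OrderBot κ.ord.ToType := WellFoundedLT.toOrderBot _
  refine ⟨κ, inferInstance, inferInstance, { preservesColimit := ?_ }⟩
  rintro X Y X' Y' _ ⟨i⟩ g t
  refine (hK (A i)).preservesColimit adj (hκ i) t.F (fun j => ?_)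
  refine hP _ (pushouts_coproducts_ofHoms_le P f hf _ ?_)
  have := (t.attachCells j (not_isMax j)).pushouts_coproducts
  rwa [MorphismProperty.ofHoms_homFamily] at this

lemma rlp_ofHoms_map (adj : F ⊣ U) {ι : Type v} {A B : ι → E} (f : ∀ i, A i ⟶ B i) :
    (MorphismProperty.ofHoms (fun i => F.map (f i))).rlp =
      (MorphismProperty.ofHoms f).rlp.inverseImage U := by
  ext X Y p
  constructor
  · rintro h _ _ _ ⟨i⟩
    exact (adj.hasLiftingProperty_iff _ _).1 (h _ ⟨i⟩)
  · rintro h _ _ _ ⟨i⟩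
    exact (adj.hasLiftingProperty_iff _ _).2 (h _ ⟨i⟩)

variable [ModelCategory E] {K : MorphismProperty E}

instance : MorphismProperty.IsStableUnderCoproducts.{v} (cofibrations E) := by
  rw [← MorphismProperty.llp_eq_of_wfs (cofibrations E) (trivialFibrations E)]
  infer_instance

instance : MorphismProperty.IsStableUnderCoproducts.{v} (trivialCofibrations E) := by
  rw [← MorphismProperty.llp_eq_of_wfs (trivialCofibrations E) (fibrations E)]
  infer_instance

/-- By the small object argument such a map is a retract of a relative cell complex. Its underlying
map is a transfinite composition of maps in `K ⊓ W`, a class closed under this because `W` is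
perfect. -/
lemma rlp_llp_le_weakEquivalences [HasColimits E] [HasColimits D] (adj : F ⊣ U)
    [PreservesFilteredColimitsOfSize.{v, v} U]
    [MorphismProperty.IsStableUnderTransfiniteComposition.{v} K]
    (hF : HasFreeExtensionsIn F U K) (hK : IsCompactlyGeneratedWith E K) {ι : Type v}
    {A B : ι → E} (f : ∀ i, A i ⟶ B i) (hf : ∀ i, trivialCofibrations E (f i)) :
    (MorphismProperty.ofHoms (fun i => F.map (f i))).rlp.llp ≤
      (weakEquivalences E).inverseImage U := by
  have := adj.leftAdjoint_preservesColimits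
  have := hasSmallObjectArgument_ofHoms adj
    (hF.trivialCofibrations.trans (fun _ _ _ h => h.1)) hK.small f hf
  have := hK.perfect.isStableUnderTransfiniteComposition
  rw [MorphismProperty.llp_rlp_of_hasSmallObjectArgument.{v}]
  rintro X Y g ⟨X', Y', g', r, hg'⟩
  refine MorphismProperty.of_retract (P := weakEquivalences E) (r.map U) ?_
  obtain ⟨J, _, _, _, _, h⟩ := (MorphismProperty.transfiniteCompositions_iff _ _).1 hg'
  have := preservesWellOrderContinuousOfShape (U := U) J
  refine (MorphismProperty.transfiniteCompositionsOfShape_le (K ⊓ weakEquivalences E) J _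
    (MorphismProperty.transfiniteCompositionsOfShape_map_of_preserves J U g'
      (MorphismProperty.transfiniteCompositionsOfShape_monotone J ?_ _ h))).2
  exact (pushouts_coproducts_ofHoms_le _ f hf).trans hF.trivialCofibrations

/-- Transfer of a compactly generated model structure along a right adjoint. -/
theorem exists_transferred [HasColimits E] [HasColimits D] [HasLimits D] (adj : F ⊣ U)
    [PreservesFilteredColimitsOfSize.{v, v} U]
    [MorphismProperty.IsStableUnderTransfiniteComposition.{v} K]
    (hF : HasFreeExtensionsIn F U K) (hK : IsCompactlyGeneratedWith E K) :
    ∃ _ : ModelCategory D, IsTransferred U ∧ cofibrations D ≤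
      (MorphismProperty.transfiniteCompositions.{v}
        ((cofibrations E).map F).pushouts).retracts := by
  have := adj.leftAdjoint_preservesColimits
  obtain ⟨I, J, hI, hJ, -, -, hI', hJ'⟩ := hK.cofibrantlyGenerated
  obtain ⟨ι, A, B, f, rfl⟩ := (MorphismProperty.isSmall_iff_eq_ofHoms.{v} I).1 hI
  obtain ⟨ι', A', B', g, rfl⟩ := (MorphismProperty.isSmall_iff_eq_ofHoms.{v} J).1 hJ
  have hf (i : ι) : cofibrations E (f i) := by
    rw [← MorphismProperty.llp_eq_of_wfs (cofibrations E) (trivialFibrations E), ← hI']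
    exact MorphismProperty.le_llp_rlp _ _ ⟨i⟩
  have hg (i : ι') : trivialCofibrations E (g i) := by
    rw [← MorphismProperty.llp_eq_of_wfs (trivialCofibrations E) (fibrations E), ← hJ']
    exact MorphismProperty.le_llp_rlp _ _ ⟨i⟩
  have := hasSmallObjectArgument_ofHoms adj hF.cofibrations hK.small f hf
  have := hasSmallObjectArgument_ofHoms adj
    (hF.trivialCofibrations.trans (fun _ _ _ h => h.1)) hK.small g hg
  let : CategoryWithFibrations D := ⟨(fibrations E).inverseImage U⟩
  let : CategoryWithWeakEquivalences D := ⟨(weakEquivalences E).inverseImage U⟩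
  let : CategoryWithCofibrations D :=
    ⟨(MorphismProperty.ofHoms (fun i => F.map (f i))).rlp.llp⟩
  have hI : (MorphismProperty.ofHoms (fun i => F.map (f i))).rlp = trivialFibrations D := by
    rw [rlp_ofHoms_map adj, hI']
    rfl
  have hJ : (MorphismProperty.ofHoms (fun i => F.map (g i))).rlp = fibrations D := by
    rw [rlp_ofHoms_map adj, hJ']
    rfl
  have hC : (MorphismProperty.ofHoms (fun i => F.map (f i))).rlp.llp = cofibrations D := rfl
  have : (weakEquivalences D).HasTwoOutOfThreeProperty :=
    inferInstanceAs ((weakEquivalences E).inverseImage U).HasTwoOutOfThreeProperty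
  have hTC : (MorphismProperty.ofHoms (fun i => F.map (g i))).rlp.llp = trivialCofibrations D := by
    apply le_antisymm
    · refine le_inf ?_ (rlp_llp_le_weakEquivalences adj hF hK g hg)
      rw [← hC, hI, hJ]
      exact MorphismProperty.antitone_llp inf_le_left
    -- The retract argument: the right factor of `p` is a trivial fibration by two-out-of-three, so
    -- `p` lifts against it and is a retract of its left factor.
    · intro X Y p hp
      let φ := MorphismProperty.factorizationData
        (MorphismProperty.ofHoms (fun i => F.map (g i))).rlp.llp
        (MorphismProperty.ofHoms (fun i => F.map (g i))).rlp p
      have hφ : trivialFibrations D φ.p := by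
        refine ⟨hJ ▸ φ.hp, MorphismProperty.of_precomp (weakEquivalences D) (W' := weakEquivalences D) φ.i φ.p
          (rlp_llp_le_weakEquivalences adj hF hK g hg _ φ.hi) ?_⟩
        rw [φ.fac]
        exact hp.2
      have : HasLiftingProperty p φ.p := by
        have := hp.1
        rw [← hC, hI] at this
        exact this _ hφ
      exact MorphismProperty.of_retract (RetractArrow.ofLeftLiftingProperty φ.fac) φ.hi
  have : MorphismProperty.IsWeakFactorizationSystem (cofibrations D) (trivialFibrations D) := by
    rw [← hC, ← hI]
    exact ⟨MorphismProperty.rlp_llp_rlp _, rfl, inferInstance⟩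
  have : MorphismProperty.IsWeakFactorizationSystem (trivialCofibrations D) (fibrations D) := by
    rw [← hTC, ← hJ]
    exact ⟨MorphismProperty.rlp_llp_rlp _, rfl, inferInstance⟩
  let M := ModelCategory.mk' D
  refine ⟨M, ⟨inferInstance, inferInstance, rfl, rfl⟩, ?_⟩
  change (MorphismProperty.ofHoms (fun i => F.map (f i))).rlp.llp ≤ _
  rw [MorphismProperty.llp_rlp_of_hasSmallObjectArgument.{v}]
  exact MorphismProperty.retracts_monotone (MorphismProperty.transfiniteCompositions_monotone.{v}
    (pushouts_coproducts_ofHoms_le _ f hf))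

end Transfer

end

noncomputable section

/-! ### Relative left properness of transferred model structures -/

section Proper

variable {E : Type u} [Category.{v} E] {D : Type u'} [Category.{v} D]

/-- The class of morphisms of `D` whose cobase changes out of objects with underlying object in
`Q` have underlying morphism in `L`, and along which weak equivalences between such objects are
closed under cobase change. -/
def properExtensions (U : D ⥤ E) (Q : ObjectProperty E) (L W : MorphismProperty E) :
    MorphismProperty D :=
  fun X Y f => ∀ ⦃A B : D⦄ (a : X ⟶ A) (b : Y ⟶ B) (g : A ⟶ B), IsPushout f a b g →
    Q (U.obj A) → L (U.map g) ∧
      ∀ ⦃A' B' : D⦄ (w : A ⟶ A') (w' : B ⟶ B') (g' : A' ⟶ B'), IsPushout g w w' g' →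
        Q (U.obj A') → W (U.map w) → W (U.map w')

namespace properExtensions

variable {U : D ⥤ E} {Q : ObjectProperty E} {L W K : MorphismProperty E}

lemma self {X Y : D} {f : X ⟶ Y} (hf : properExtensions U Q L W f) (hX : Q (U.obj X)) :
    L (U.map f) ∧ ∀ ⦃A B : D⦄ (w : X ⟶ A) (w' : Y ⟶ B) (g : A ⟶ B), IsPushout f w w' g →
        Q (U.obj A) → W (U.map w) → W (U.map w') :=
  hf (𝟙 _) (𝟙 _) f (IsPushout.of_vert_isIso ⟨by simp⟩) hX

instance : (properExtensions U Q L W).IsStableUnderCobaseChange where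
  of_isPushout sq hf _ _ _ _ _ sq' := hf _ _ _ (sq.flip.paste_vert sq')

instance [HasPushouts D] [L.IsStableUnderRetracts] [W.IsStableUnderRetracts] :
    (properExtensions U Q L W).IsStableUnderRetracts where
  of_retract {X Y X' Y' f g} r hg A B a b f' sq hA := by
    -- Pushing out `g` along the retraction composed with `a` makes `f'` a retract of `g'` with `A`
    -- fixed. A further pushout along `w` then makes `w'` a retract of `w''`.
    obtain ⟨C, b', g', sq'⟩ := exists_isPushout g (r.r.left ≫ a)
    obtain ⟨hL, hW⟩ := hg _ _ _ sq' hA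
    have hi : f ≫ r.i.right = r.i.left ≫ g := r.i.w.symm
    have hr : g ≫ r.r.right = r.r.left ≫ f := r.r.w.symm
    obtain ⟨s, hs₁, hs₂⟩ : ∃ s : B ⟶ C, b ≫ s = r.i.right ≫ b' ∧ f' ≫ s = g' :=
      ⟨sq.desc (r.i.right ≫ b') g' (by
        rw [reassoc_of% hi, sq'.w, Category.assoc]
        exact (Category.assoc _ _ _).symm.trans
          ((congrArg (· ≫ a ≫ g') r.retract_left).trans (Category.id_comp _))), sq.inl_desc _ _ _, sq.inr_desc _ _ _⟩
    obtain ⟨t, ht₁, ht₂⟩ : ∃ t : C ⟶ B, b' ≫ t = r.r.right ≫ b ∧ g' ≫ t = f' :=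
      ⟨sq'.desc (r.r.right ≫ b) f' (by
        rw [reassoc_of% hr, sq.w, Category.assoc]), sq'.inl_desc _ _ _, sq'.inr_desc _ _ _⟩
    have hst : s ≫ t = 𝟙 B := sq.hom_ext
      (by rw [reassoc_of% hs₁, ht₁]; simp)
      (by rw [reassoc_of% hs₂, ht₂, Category.comp_id])
    have ρ : RetractArrow f' g' :=
      { i := Arrow.homMk (𝟙 _) s (by simp [hs₂])
        r := Arrow.homMk (𝟙 _) t (by simp [ht₂])
        retract := by ext <;> simp [hst] }
    refine ⟨L.of_retract (ρ.map U) hL, fun A' B' w w' k sqw hA' hw => ?_⟩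
    obtain ⟨C', w'', k', sqw'⟩ := exists_isPushout g' w
    obtain ⟨s', hs'₁, hs'₂⟩ : ∃ s' : B' ⟶ C', w' ≫ s' = s ≫ w'' ∧ k ≫ s' = k' :=
      ⟨sqw.desc (s ≫ w'') k' (by rw [reassoc_of% hs₂, sqw'.w]), sqw.inl_desc _ _ _,
        sqw.inr_desc _ _ _⟩
    obtain ⟨t', ht'₁, ht'₂⟩ : ∃ t' : C' ⟶ B', w'' ≫ t' = t ≫ w' ∧ k' ≫ t' = k :=
      ⟨sqw'.desc (t ≫ w') k (by rw [reassoc_of% ht₂, sqw.w]), sqw'.inl_desc _ _ _,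
        sqw'.inr_desc _ _ _⟩
    have hst' : s' ≫ t' = 𝟙 B' := sqw.hom_ext
      (by rw [reassoc_of% hs'₁, ht'₁, reassoc_of% hst, Category.comp_id])
      (by rw [reassoc_of% hs'₂, ht'₂, Category.comp_id])
    have ρ' : RetractArrow w' w'' :=
      { i := Arrow.homMk s s' hs'₁.symm
        r := Arrow.homMk t t' ht'₁.symm
        retract := by ext <;> simp [hst, hst'] }
    exact W.of_retract (ρ'.map U) (hW _ _ _ sqw' hA' hw)

section

variable [PreservesFilteredColimitsOfSize.{v, v} U]
  [MorphismProperty.IsStableUnderTransfiniteComposition.{v} L] [L.RespectsIso]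
  (hQ : ∀ ⦃X Y : E⦄ (f : X ⟶ Y), L f → Q X → Q Y)
  {J : Type v} [LinearOrder J] [SuccOrder J] [OrderBot J] [WellFoundedLT J] {X Y : D} {f : X ⟶ Y}

include hQ

/-- Well-founded induction: if all earlier objects lie in `Q`, the earlier steps have underlying
maps in `L`, so the map from the first object to the one at `j` is a transfinite composition in `L`.
-/
lemma underlying_mem (t : (properExtensions U Q L W).TransfiniteCompositionOfShape J f)
    (hX : Q (U.obj X)) (j : J) : Q (U.obj (t.F.obj j)) := by
  induction j using WellFoundedLT.induction with
  | _ j ih =>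
    have := preservesWellOrderContinuousOfShape (U := U) (Set.Iic j)
    have t' : (L.inverseImage U).TransfiniteCompositionOfShape (Set.Iic j)
      (t.F.map (homOfLE bot_le : ⊥ ⟶ j)) :=
      { toTransfiniteCompositionOfShape := (t.iic j).toTransfiniteCompositionOfShape
        map_mem i hi := (((t.iic j).map_mem i hi).self (ih i.1 (by
          -- `hi` says that `i` is not maximal in `Set.Iic j`, which excludes `i = j`.
          refine lt_of_le_of_ne i.2 (fun h => hi ?_)
          intro k _
          exact k.2.trans h.ge))).1 }
    refine hQ _ (L.transfiniteCompositionsOfShape_le _ _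
      (MorphismProperty.transfiniteCompositionsOfShape_map_of_preserves _ U _ ⟨t'⟩)) ?_
    have : L (U.map t.isoBot.inv) :=
      MorphismProperty.of_isIso L (U.map t.isoBot.inv)
    exact hQ _ this hX

/-- The underlying transfinite composition. -/
def underlying (t : (properExtensions U Q L W).TransfiniteCompositionOfShape J f)
    (hX : Q (U.obj X)) : L.TransfiniteCompositionOfShape J (U.map f) :=
  have := preservesWellOrderContinuousOfShape (U := U) J
  { toTransfiniteCompositionOfShape := t.toTransfiniteCompositionOfShape.map U
    map_mem j hj := ((t.map_mem j hj).self (underlying_mem hQ t hX j)).1 }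

end

/-- Cobase change along `w` applies to the whole transfinite sequence. At successors the comparison
stays in `W` because every step is a proper extension, and at limits and in the colimit because `W`
is perfect; the underlying transition maps lie in `L ≤ K`. -/
lemma isStableUnderTransfiniteComposition [HasPushouts D]
    [PreservesFilteredColimitsOfSize.{v, v} U]
    [MorphismProperty.IsStableUnderTransfiniteComposition.{v} L] [L.RespectsIso] [W.RespectsIso]
    (hQ : ∀ ⦃X Y : E⦄ (f : X ⟶ Y), L f → Q X → Q Y) (hL : L ≤ K) (hW : IsPerfect K W) :
    MorphismProperty.IsStableUnderTransfiniteComposition.{v} (properExtensions U Q L W) where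
  isStableUnderTransfiniteCompositionOfShape J _ _ _ _ := ⟨by
    rintro X Y f ⟨t₀⟩ A B a b g sq hA
    have := preservesWellOrderContinuousOfShape (U := U) J
    let t := t₀.cobaseChange sq
    refine ⟨L.transfiniteCompositionsOfShape_le _ _ ⟨underlying hQ t hA⟩,
      fun A' B' w w' g' sq' hA' hw => ?_⟩
    have sq₁ : IsPushout ((Cocone.mk B t.incl).ι.app ⊥) (t.isoBot.hom ≫ w) w' g' :=
      IsPushout.of_iso sq' t.isoBot.symm (Iso.refl _) (Iso.refl _) (Iso.refl _)
        ((Category.comp_id _).trans t.fac.symm) (by simp) (by simp) (by simp)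
    let t' := t.cobaseChange sq'
    let τ : t.F ⟶ t'.F := cobaseChange.inl t.F (t.isoBot.hom ≫ w)
    have hF ⦃i j : J⦄ (φ : i ⟶ j) : K ((t.F ⋙ U).map φ) :=
      hL _ ((underlying hQ t hA).mem_map φ)
    have hF' ⦃i j : J⦄ (φ : i ⟶ j) : K ((t'.F ⋙ U).map φ) :=
      hL _ ((underlying hQ t' hA').mem_map φ)
    refine hW J _ _ (Functor.whiskerRight τ U) _ _ (isColimitOfPreserves U t.isColimit)
      (isColimitOfPreserves U t'.isColimit) _ hF hF' (hW.app_mem _ hF hF' ?_ ?_) (fun j => ?_)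
    · have : U.map (τ.app ⊥) = U.map t.isoBot.hom ≫ U.map w ≫
          U.map (cobaseChange.inr t.F (t.isoBot.hom ≫ w) ⊥) := by
        rw [← U.map_comp, ← U.map_comp]
        exact congrArg U.map ((cobaseChange.inl_bot _ _).trans (Category.assoc _ _ _))
      change W (U.map (τ.app ⊥))
      rw [this]
      have : IsIso (cobaseChange.inr t.F (t.isoBot.hom ≫ w) ⊥) := inferInstance
      have : IsIso (U.map (cobaseChange.inr t.F (t.isoBot.hom ≫ w) ⊥)) := Functor.map_isIso U _
      exact MorphismProperty.RespectsIso.precomp _ (U.map t.isoBot.hom) _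
        (MorphismProperty.RespectsIso.postcomp W
          (U.map (cobaseChange.inr t.F (t.isoBot.hom ≫ w) ⊥)) _ hw)
    · exact fun j hj hj' => ((t.map_mem j hj).self (underlying_mem hQ t hA j)).2 _ _ _
        (cobaseChange.isPushout t.F _ _) (underlying_mem hQ t' hA' j) hj'
    · exact ((U.map_comp _ _).symm.trans
        (congrArg U.map (cobaseChange.inl_cocone_ι sq₁ j).symm)).trans (U.map_comp _ _)⟩

end properExtensions

end Proper

end

noncomputable section

/-! ### Free extensions of monoids -/

section Sequences

variable {E : Type u} [Category.{v} E]

/-- A sequential colimit as a transfinite composition. -/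
def transfiniteCompositionOfSequence {P : MorphismProperty E} {S : ℕ ⥤ E} {c : Cocone S}
    (hc : IsColimit c) (h : ∀ n : ℕ, P (S.map (homOfLE (Nat.le_succ n)))) :
    P.TransfiniteCompositionOfShape ℕ (c.ι.app 0) where
  F := S
  isoBot := Iso.refl _
  incl := c.ι
  isColimit := hc
  fac := Category.id_comp _
  map_mem n _ := h n

/-- Stability of `K` under transfinite composition extends membership from single steps to all
transition maps. The index category is lifted to the universe in which perfectness is stated. -/
lemma IsPerfect.of_sequence {K W : MorphismProperty E} (h : IsPerfect K W)
    [MorphismProperty.IsStableUnderTransfiniteComposition.{v} K] {S T : ℕ ⥤ E} (τ : S ⟶ T)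
    {c : Cocone S} {d : Cocone T} (hc : IsColimit c) (hd : IsColimit d) (f : c.pt ⟶ d.pt)
    (hS : ∀ n : ℕ, K (S.map (homOfLE (Nat.le_succ n))))
    (hT : ∀ n : ℕ, K (T.map (homOfLE (Nat.le_succ n)))) (hτ : ∀ n, W (τ.app n))
    (hf : ∀ n, c.ι.app n ≫ f = τ.app n ≫ d.ι.app n) : W f := by
  have := MorphismProperty.IsStableUnderTransfiniteComposition.shrink₀.{v} K
  let e : ULift.{v} ℕ ≌ ℕ := ULift.orderIso.equivalence
  exact h (ULift.{v} ℕ) (e.functor ⋙ S) (e.functor ⋙ T) (Functor.whiskerLeft e.functor τ) _ _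
    (hc.whiskerEquivalence e) (hd.whiskerEquivalence e) f
    (fun _ _ φ => (transfiniteCompositionOfSequence hc hS).mem_map (e.functor.map φ))
    (fun _ _ φ => (transfiniteCompositionOfSequence hd hT).mem_map (e.functor.map φ))
    (fun n => hτ _) (fun n => hf _)

end Sequences

namespace MonoidExtension

variable {E : Type u} [Category.{v} E] [HasColimits E] [MonoidalCategory E] [SymmetricCategory E]
  [MonoidalClosed E]

/-- The extension data given by a morphism of monoids out of a free monoid. -/
def mkData {X Y : E} {R : Mon E} (u : X ⟶ Y) (α : (FreeMonoidObject.free E).obj X ⟶ R) :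
    Data E where
  left := Arrow.mk u
  right := (comparison E).obj R
  hom := (comparison E).map α

/-- A monoid is isomorphic to the one given by the corresponding algebra. -/
def unitIso (R : Mon E) : R ≅ (ofAlgebra E).obj ((comparison E).obj R) :=
  (comparison E).preimageIso (algebraIso ((comparison E).obj R))

lemma comparison_unitIso (R : Mon E) :
    (comparison E).map (unitIso R).hom = (algebraIso ((comparison E).obj R)).hom :=
  (comparison E).map_preimage _

lemma unitIso_naturality {R S : Mon E} (f : R ⟶ S) : f ≫ (unitIso S).hom =
    (unitIso R).hom ≫ (ofAlgebra E).map ((comparison E).map f) := by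
  apply (comparison E).map_injective
  rw [Functor.map_comp, Functor.map_comp, comparison_unitIso, comparison_unitIso,
    algebraIso_naturality]

section

variable {X Y : E} {R : Mon E} (u : X ⟶ Y) (α : (FreeMonoidObject.free E).obj X ⟶ R)

lemma attach_mkData : attach (mkData u α) = α ≫ (unitIso R).hom := by
  apply (comparison E).map_injective
  refine (comparison_attach _).trans (Eq.trans ?_ ((comparison E).map_comp _ _).symm)
  exact congrArg ((comparison E).map α ≫ ·) (comparison_unitIso R).symm

lemma isPushout_mkData : IsPushout α ((FreeMonoidObject.free E).map u)
    ((unitIso R).hom ≫ monInl (mkData u α)) (monInr (mkData u α)) := by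
  refine (isPushout_mon (mkData u α)).of_iso (Iso.refl _) (unitIso R).symm (Iso.refl _)
    (Iso.refl _) ?_ ?_ ?_ ?_
  · refine (congrArg (· ≫ (unitIso R).inv) (attach_mkData u α)).trans
      (Eq.trans ?_ (Category.id_comp _).symm)
    exact (Category.assoc _ _ _).trans
      ((congrArg (α ≫ ·) (unitIso R).hom_inv_id).trans (Category.comp_id _))
  · exact (Category.comp_id _).trans (Category.id_comp _).symm
  · exact (Category.comp_id _).trans ((unitIso R).inv_hom_id_assoc _).symm
  · exact (Category.comp_id _).trans (Category.id_comp _).symm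

end

lemma monInl_naturality {d d' : Data E} (f : d ⟶ d') :
    (ofAlgebra E).map f.right ≫ monInl d' = monInl d ≫ monExtMap f :=
  (family E).inl.naturality f

/-- Both extensions are pushouts of the same free map, along `attach d` and along its composite with
`f`. Cancelling the first square from the second leaves this one. -/
lemma isPushout_monExtMap (d : Data E) {S : (freeMonoidMonad E).Algebra} (f : d.right ⟶ S) :
    IsPushout (monInl d) ((ofAlgebra E).map f) (monExtMap (d.toPush f))
      (monInl (d.push f)) := by
  have h₁ : attach (d.push f) = attach d ≫ (ofAlgebra E).map f := by
    refine Eq.trans ?_ (attach_naturality (d.toPush f))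
    exact ((congrArg (· ≫ attach (d.push f)) ((FreeMonoidObject.free E).map_id _)).trans
      (Category.id_comp _)).symm
  have h₂ : monInr (d.push f) = monInr d ≫ monExtMap (d.toPush f) := by
    refine Eq.trans ?_ (monInr_naturality (d.toPush f))
    exact ((congrArg (· ≫ monInr (d.push f)) ((FreeMonoidObject.free E).map_id _)).trans
      (Category.id_comp _)).symm
  have sq := isPushout_mon (d.push f)
  rw [h₁, h₂] at sq
  exact (IsPushout.of_left sq (monInl_naturality (d.toPush f)) (isPushout_mon d)).flip

/-- The inclusion into an extension of monoids is a sequential colimit of the tower. -/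
lemma monInl_mem (d : Data E) (P : MorphismProperty E) [P.RespectsIso]
    [MorphismProperty.IsStableUnderTransfiniteComposition.{v} P]
    (h : ∀ n, P ((towerAt d).i (n + 1))) : P (monInl d).hom := by
  have := MorphismProperty.IsStableUnderTransfiniteComposition.shrink₀.{v} P
  have hc := transfiniteCompositionOfSequence (P := P) ((family E).isColimitToExt d)
    (fun n => by
      rw [(family E).seq_map]
      exact h n)
  have h' : P (((family E).toExt.app d).app 0) := P.transfiniteCompositionsOfShape_le _ _ ⟨hc⟩
  have := (family E).zeroIso_inv_toExt d
  change P ((family E).inl.app d).hom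
  rw [← this]
  exact MorphismProperty.RespectsIso.precomp _ _ _ h'

lemma exists_iso_monExt {X Y : E} {R S : Mon E} (u : X ⟶ Y)
    {α : (FreeMonoidObject.free E).obj X ⟶ R} {j : R ⟶ S}
    {k : (FreeMonoidObject.free E).obj Y ⟶ S}
    (sq : IsPushout α ((FreeMonoidObject.free E).map u) j k) :
    ∃ e : S ≅ monExt (mkData u α), j ≫ e.hom = (unitIso R).hom ≫ monInl (mkData u α) :=
  ⟨sq.isoIsPushout (h' := isPushout_mkData u α),
    sq.inl_isoIsPushout_hom (h' := isPushout_mkData u α)⟩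

lemma underlying_mem_of_isPushout {X Y : E} {R S : Mon E} (u : X ⟶ Y)
    {α : (FreeMonoidObject.free E).obj X ⟶ R} {j : R ⟶ S}
    {k : (FreeMonoidObject.free E).obj Y ⟶ S}
    (sq : IsPushout α ((FreeMonoidObject.free E).map u) j k)
    (P : MorphismProperty E) [P.RespectsIso]
    [MorphismProperty.IsStableUnderTransfiniteComposition.{v} P]
    (h : ∀ n, P ((towerAt (mkData u α)).i (n + 1))) : P ((Mon.forget E).map j) := by
  obtain ⟨e, he⟩ := exists_iso_monExt u sq
  let ε : Arrow.mk ((Mon.forget E).map j) ≅ Arrow.mk (monInl (mkData u α)).hom :=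
    Arrow.isoMk ((Mon.forget E).mapIso (unitIso R)) ((Mon.forget E).mapIso e)
      (congrArg Mon.Hom.hom he.symm)
  exact (P.arrow_mk_iso_iff ε).2 (monInl_mem _ P h)

end MonoidExtension

end

noncomputable section

/-! ### The model structure on monoids -/

section MonoidModelStructure

open MonoidExtension

variable {E : Type u} [Category.{v} E] [HasColimits E] [MonoidalCategory E] [SymmetricCategory E]
  [MonoidalClosed E] [ModelCategory E]

instance : (tensorCofibrations E).IsStableUnderRetracts :=
  (isMonoidallySaturated_monoidalSaturation _).retracts

instance : MorphismProperty.IsStableUnderTransfiniteComposition.{v} (cofibrations E) := by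
  rw [← MorphismProperty.llp_eq_of_wfs (cofibrations E) (trivialFibrations E)]
  infer_instance

instance : PreservesFilteredColimitsOfSize.{v, v} (Mon.forget E) where
  preserves_filtered_colimits J _ _ := by
    have : IsSifted J := IsFiltered.isSifted
    infer_instance

lemma exists_of_pushouts_map {C D : Type*} [Category* C] [Category* D] {F : C ⥤ D}
    {P : MorphismProperty C} {R S : D} {j : R ⟶ S} (hj : (P.map F).pushouts j) :
    ∃ (X Y : C) (u : X ⟶ Y) (α : F.obj X ⟶ R) (k : F.obj Y ⟶ S),
      P u ∧ IsPushout α (F.map u) j k := by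
  obtain ⟨A, B, p, a, b, ⟨X, Y, u, hu, ⟨e⟩⟩, sq⟩ := hj
  refine ⟨X, Y, u, e.hom.left ≫ a, e.hom.right ≫ b, hu,
    sq.of_iso (Arrow.leftFunc.mapIso e).symm (Iso.refl _) (Arrow.rightFunc.mapIso e).symm
      (Iso.refl _) ?_ ?_ ?_ ?_⟩
  · have : e.inv.left ≫ e.hom.left = 𝟙 _ := (Arrow.leftFunc.mapIso e).inv_hom_id
    exact (Category.comp_id _).trans
      ((Category.assoc _ _ _).symm.trans ((congrArg (· ≫ a) this).trans (Category.id_comp _))).symm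
  · exact e.inv.w.symm
  · simp
  · have : e.inv.right ≫ e.hom.right = 𝟙 _ := (Arrow.rightFunc.mapIso e).inv_hom_id
    exact (Category.comp_id _).trans
      ((Category.assoc _ _ _).symm.trans ((congrArg (· ≫ b) this).trans (Category.id_comp _))).symm

lemma hasFreeExtensionsIn_tensorCofibrations (hE : IsMonoidalModelCategory E)
    (hc : IsCompactlyGeneratedMonoidal E) (h : HasTrivialTensors E) :
    HasFreeExtensionsIn (FreeMonoidObject.free E) (Mon.forget E) (tensorCofibrations E) where
  cofibrations _ _ j hj := by
    obtain ⟨X, Y, u, α, k, hu, sq⟩ := exists_of_pushouts_map hj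
    exact underlying_mem_of_isPushout u sq (tensorCofibrations E)
      (Tower.tensorCofibrations_i _ hE hu)
  trivialCofibrations _ _ j hj := by
    obtain ⟨X, Y, u, α, k, hu, sq⟩ := exists_of_pushouts_map hj
    have := hc.perfect.isStableUnderTransfiniteComposition
    exact underlying_mem_of_isPushout u sq (tensorCofibrations E ⊓ weakEquivalences E)
      (fun n => ⟨Tower.tensorCofibrations_i _ hE hu.1 n, Tower.weakEquivalences_i _ hE h hu n⟩)

/-- Weak equivalences are closed under cobase change along free extensions. -/
lemma weakEquivalences_monExtMap {Q : ObjectProperty E} {H : MorphismProperty E}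
    (hE : IsMonoidalModelCategory E) (hc : IsCompactlyGeneratedMonoidal E)
    (h : MonoidalContext Q H) (d : Data E) {S : (freeMonoidMonad E).Algebra} (f : d.right ⟶ S)
    (hu : Cofibration d.left.hom) (hf : WeakEquivalence ((freeMonoidMonad E).forget.map f))
    (hX : Q d.left.left) (hR : Q ((freeMonoidMonad E).forget.obj d.right))
    (hS : Q ((freeMonoidMonad E).forget.obj S)) :
    weakEquivalences E (monExtMap (d.toPush f)).hom := by
  refine hc.perfect.of_sequence ((family E).seq.map (d.toPush f)) ((family E).isColimitToExt d)
    ((family E).isColimitToExt (d.push f)) _ (fun n => ?_) (fun n => ?_)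
    (fun n => (weakEquivalence_induced h d f hu hf hX hR hS n).mem)
    (fun n => (congr_app ((family E).toExt.naturality (d.toPush f)) n).symm)
  · rw [(family E).seq_map]
    exact (towerAt d).tensorCofibrations_i hE hu.mem n
  · rw [(family E).seq_map]
    exact (towerAt (d.push f)).tensorCofibrations_i hE hu.mem n

lemma weakEquivalences_of_isPushout_free {Q : ObjectProperty E} {H : MorphismProperty E}
    (hE : IsMonoidalModelCategory E) (hc : IsCompactlyGeneratedMonoidal E)
    (h : MonoidalContext Q H) {X Y : E} {u : X ⟶ Y} (hu : cofibrations E u) {R S R' S' : Mon E}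
    {α : (FreeMonoidObject.free E).obj X ⟶ R} {j : R ⟶ S}
    {k : (FreeMonoidObject.free E).obj Y ⟶ S}
    (sq : IsPushout α ((FreeMonoidObject.free E).map u) j k)
    {w : R ⟶ R'} {w' : S ⟶ S'} {j' : R' ⟶ S'} (sq' : IsPushout j w w' j')
    (hX : Q X) (hR : Q R.X) (hR' : Q R'.X) (hw : weakEquivalences E w.hom) :
    weakEquivalences E w'.hom := by
  let d := mkData u α
  let f : d.right ⟶ (comparison E).obj R' := (comparison E).map w
  obtain ⟨e, he⟩ := exists_iso_monExt u sq
  have sq₁ : IsPushout j w (e.hom ≫ monExtMap (d.toPush f))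
      ((unitIso R').hom ≫ monInl (d.push f)) :=
    (isPushout_monExtMap d f).of_iso (unitIso R).symm e.symm (unitIso R').symm (Iso.refl _)
      ((Iso.comp_inv_eq _).2 (((unitIso R).inv_hom_id_assoc _).symm.trans
        ((congrArg ((unitIso R).inv ≫ ·) he.symm).trans (Category.assoc _ _ _).symm)))
      ((Iso.comp_inv_eq _).2 (((unitIso R).inv_hom_id_assoc _).symm.trans
        ((congrArg ((unitIso R).inv ≫ ·) (unitIso_naturality w).symm).trans
          (Category.assoc _ _ _).symm)))
      ((Category.comp_id _).trans (e.inv_hom_id_assoc _).symm)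
      ((Category.comp_id _).trans ((unitIso R').inv_hom_id_assoc _).symm)
  have : w' = (e.hom ≫ monExtMap (d.toPush f)) ≫ (sq'.isoIsPushout (h' := sq₁)).inv :=
    (sq'.inl_isoIsPushout_inv (h' := sq₁)).symm
  rw [this]
  have hW := weakEquivalences_monExtMap hE hc h d f ⟨hu⟩ ⟨hw⟩ hX hR hR'
  exact MorphismProperty.RespectsIso.postcomp (weakEquivalences E)
    ((Mon.forget E).map (sq'.isoIsPushout (h' := sq₁)).inv) _
    (MorphismProperty.RespectsIso.precomp _ ((Mon.forget E).map e.hom) _ hW)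

section Proper

variable {Q : ObjectProperty E} {H L : MorphismProperty E}

/-- The domain of `u` need not be in `Q`, as the comparison of towers would require. But extending
`A` along `u` is the same as extending it along the cobase change `u'` of `u` to the underlying
object of `A`, attached by the counit; and this object is in `Q`. -/
lemma properExtensions_free_map (hE : IsMonoidalModelCategory E)
    (hc : IsCompactlyGeneratedMonoidal E) (h : MonoidalContext Q H)
    [MorphismProperty.IsStableUnderTransfiniteComposition.{v} L] [L.RespectsIso]
    (hL : ∀ {R X Y : E} [MonObj R] {u : X ⟶ Y} {α : X ⟶ R} (t : Tower u α), Q R →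
      cofibrations E u → ∀ n, L (t.i (n + 1))) {X Y : E} {u : X ⟶ Y} (hu : cofibrations E u) :
    properExtensions (Mon.forget E) Q L (weakEquivalences E)
      ((FreeMonoidObject.free E).map u) := by
  intro A B a b g sq hA
  have : PreservesColimitsOfSize.{0, 0} (FreeMonoidObject.free E) :=
    (FreeMonoidObject.adj E).leftAdjoint_preservesColimits
  let ε : (FreeMonoidObject.free E).obj ((Mon.forget E).obj A) ⟶ A :=
    (FreeMonoidObject.adj E).counit.app A
  obtain ⟨Z, y, u', sq₁⟩ := exists_isPushout u ((FreeMonoidObject.adj E).homEquiv X A a)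
  have hu' : cofibrations E u' := MorphismProperty.of_isPushout sq₁.flip hu
  have ha : a = (FreeMonoidObject.free E).map ((FreeMonoidObject.adj E).homEquiv X A a) ≫ ε :=
    (((FreeMonoidObject.adj E).homEquiv X A).symm_apply_apply a).symm.trans
      ((FreeMonoidObject.adj E).homEquiv_counit ..)
  have sqF := sq₁.map (FreeMonoidObject.free E)
  obtain ⟨b', hb'₁, hb'₂⟩ : ∃ b' : (FreeMonoidObject.free E).obj Z ⟶ B,
      (FreeMonoidObject.free E).map y ≫ b' = b ∧
      (FreeMonoidObject.free E).map u' ≫ b' = ε ≫ g :=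
    ⟨sqF.desc b (ε ≫ g) (by rw [← reassoc_of% ha, sq.w]), sqF.inl_desc _ _ _, sqF.inr_desc _ _ _⟩
  have sq₂ : IsPushout ε ((FreeMonoidObject.free E).map u') g b' :=
    IsPushout.of_left (by rw [← ha, hb'₁]; exact sq.flip) hb'₂.symm sqF.flip
  have hA' : Q (((ofAlgebra E).obj ((comparison E).obj A)).X) :=
    h.target_iso ((Mon.forget E).mapIso (unitIso A)) hA
  exact ⟨underlying_mem_of_isPushout u' sq₂ L (hL _ hA' hu'), fun A' B' w w' g' sq' hA'' hw =>
    weakEquivalences_of_isPushout_free hE hc h hu' sq₂ sq' hA hA hA'' hw⟩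

/-- In a transferred model structure on monoids, the weak equivalences between monoids with
underlying object in `Q` are closed under cobase change along cofibrations. -/
lemma exists_transferred_mon [HasLimits E] (hE : IsMonoidalModelCategory E)
    (hc : IsCompactlyGeneratedMonoidal E) (hT : HasTrivialTensors E) (h : MonoidalContext Q H)
    [MorphismProperty.IsStableUnderTransfiniteComposition.{v} L] [L.IsStableUnderRetracts]
    (hLK : L ≤ tensorCofibrations E) (hQ : ∀ ⦃X Y : E⦄ (f : X ⟶ Y), L f → Q X → Q Y)
    (hL : ∀ {R X Y : E} [MonObj R] {u : X ⟶ Y} {α : X ⟶ R} (t : Tower u α), Q R →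
      cofibrations E u → ∀ n, L (t.i (n + 1))) :
    ∃ _ : ModelCategory (Mon E), IsTransferred (Mon.forget E) ∧
      ∀ ⦃X Y A B : Mon E⦄ (i : X ⟶ Y) (w : X ⟶ A) (w' : Y ⟶ B) (j : A ⟶ B),
        IsPushout i w w' j → Cofibration i → WeakEquivalence w →
          Q ((Mon.forget E).obj X) → Q ((Mon.forget E).obj A) → WeakEquivalence w' := by
  have : HasLimits (Mon E) := ⟨fun _ _ => inferInstance⟩
  obtain ⟨M, hM, hcof⟩ := exists_transferred (FreeMonoidObject.adj E)
    (hasFreeExtensionsIn_tensorCofibrations hE hc hT) hc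
  refine ⟨M, hM, fun X Y A B i w w' j sq hi hw hX hA => ⟨?_⟩⟩
  have := properExtensions.isStableUnderTransfiniteComposition (U := Mon.forget E)
    hQ hLK hc.perfect
  -- By `hcof` a cofibration of monoids is a retract of a transfinite composition of free
  -- extensions, and the class is closed under all of these operations.
  have hi' : properExtensions (Mon.forget E) Q L (weakEquivalences E) i := by
    refine (hcof.trans ?_) _ hi.mem
    refine MorphismProperty.retracts_le_iff.2 (MorphismProperty.transfiniteCompositions_le_iff.2 ?_)
    intro _ _ k hk
    obtain ⟨_, _, u, _, _, hu, sq⟩ := exists_of_pushouts_map hk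
    exact MorphismProperty.of_isPushout sq (properExtensions_free_map hE hc h hL hu)
  rw [hM.weakEquivalences_eq]
  refine (hi'.self hX).2 w w' j sq hA ?_
  have := hw.mem
  rwa [hM.weakEquivalences_eq] at this

end Proper

/-- Monoids in a monoidal model category satisfying the monoid axiom form a relatively left proper
model category. -/
theorem MonoidAxiom.exists_modelCategory_mon [HasLimits E] (hE : IsMonoidalModelCategory E)
    (hc : IsCompactlyGeneratedMonoidal E) (h : MonoidAxiom E) :
    ∃ _ : ModelCategory (Mon E),
      IsTransferred (Mon.forget E) ∧ IsRelativelyLeftProper (Mon.forget E) :=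
  -- Here `L` has to preserve cofibrancy of underlying objects. It may consist of cofibrations
  -- because extensions of underlying cofibrant monoids are built from these.
  exists_transferred_mon (Q := IsCofibrant) (L := cofibrations E) hE hc h.hasTrivialTensors
    hE.context (le_monoidalSaturation _) (fun _ _ f hf hX => isCofibrant_of_cofibrations f hf hX)
    (fun t hR hu n => (t.cofibrations_of_isCofibrant hE hR hu n).2)

/-- Monoids in a strongly `h`-monoidal model category form a left proper model category. -/
theorem IsStronglyHMonoidal.exists_modelCategory_mon [HasLimits E]
    (hE : IsMonoidalModelCategory E) (hc : IsCompactlyGeneratedMonoidal E)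
    (h : IsStronglyHMonoidal E) :
    ∃ _ : ModelCategory (Mon E), IsTransferred (Mon.forget E) ∧ IsLeftProper (Mon E) := by
  -- With `Q` the class of all objects there is nothing to preserve, so the larger class of
  -- `⊗`-cofibrations can be used.
  obtain ⟨M, hM, hM'⟩ := exists_transferred_mon (L := tensorCofibrations E) hE hc
    h.toIsHMonoidal.hasTrivialTensors (h.context hE) le_rfl (fun _ _ _ _ _ => trivial)
    (fun t _ hu n => t.tensorCofibrations_i hE hu n)
  exact ⟨M, hM, fun X Y A B i w w' j sq hi hw => hM' i w w' j sq hi hw trivial trivial⟩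

end MonoidModelStructure

end

theorem theorem3p1 (E : Type u) [Category.{v} E] [HasLimits E] [HasColimits E]
    [MonoidalCategory E] [SymmetricCategory E] [MonoidalClosed E] [ModelCategory E]
    (hE : IsMonoidalModelCategory E) (hc : IsCompactlyGeneratedMonoidal E) :
    (MonoidAxiom E → IsRelativelyAdequate (tensorCofibrations E) (freeMonoidMonad E)) ∧
    (IsStronglyHMonoidal E → IsAdequate (tensorCofibrations E) (freeMonoidMonad E)) ∧
    (MonoidAxiom E → ∃ _ : ModelCategory (Mon E),
      IsTransferred (Mon.forget E) ∧ IsRelativelyLeftProper (Mon.forget E)) ∧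
    (IsStronglyHMonoidal E → ∃ _ : ModelCategory (Mon E),
      IsTransferred (Mon.forget E) ∧ IsLeftProper (Mon E)) := by
  exact ⟨isRelativelyAdequate_freeMonoidMonad hE, isAdequate_freeMonoidMonad hE,
    MonoidAxiom.exists_modelCategory_mon hE hc, IsStronglyHMonoidal.exists_modelCategory_mon hE hc⟩
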